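/- Let $\mathcal L$ be the translation surface obtained from the L-shaped octagon with corners $(0,0)$, $(1+\sqrt2,0)$, $(2+\sqrt2,0)$, $(2+\sqrt2,1)$, $(1+\sqrt2,1)$, $(1+\sqrt2,1+\sqrt2)$, $(0,1+\sqrt2)$, $(0,1)$ by gluing its sides in pairs by horizontal and vertical translations: $[(0,0),(0,1)]$ with $[(2+\sqrt2,0),(2+\sqrt2,1)]$, $[(0,1),(0,1+\sqrt2)]$ with $[(1+\sqrt2,1),(1+\sqrt2,1+\sqrt2)]$, $[(0,0),(1+\sqrt2,0)]$ with $[(0,1+\sqrt2),(1+\sqrt2,1+\sqrt2)]$, and $[(1+\sqrt2,0),(2+\sqrt2,0)]$ with $[(1+\sqrt2,1),(2+\sqrt2,1)]$. Let $SL(2,\mathbb R)$ act linearly on translation surfaces (taken up to translation equivalence), let $\Gamma$ be the stabilizer of $\mathcal L$ (its Veech group), let $\Theta:SL(2,\mathbb R)/\Gamma\to SL(2,\mathbb R)\cdot\mathcal L$, $g\Gamma\mapsto g\mathcal L$, be the canonical bijection, and put $$M_{a,b}=\begin{pmatrix}a&b\\0&a^{-1}\end{pmatrix},\qquad h_s=\begin{pmatrix}1&0\\-s&1\end{pmatrix},\qquad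 \mathcal L^R=\begin{pmatrix}0&1\\-1&0\end{pmatrix}\mathcal L .$$ Let $\Omega_h^M$ (respectively $\Omega_v^M$) be the set of cosets $g\Gamma$ such that $g\Gamma\binom10$ (respectively $g\Gamma\binom01$) contains a vector $\binom t0$ with $0<t\le1$; the set $\Omega_h^M\cup\Omega_v^M$ is the section for the horocycle flow $(h_s)$. Let $$\Omega_1=\{(a,b):0<a\le1,\ 1-(\sqrt2+2)a<b\le1\},\qquad \Omega_2=\{(a,b):0<a\le1,\ 1-a<b\le1\},$$ and write $\Omega=\Omega_1\sqcup\Omega_2$ for the disjoint union. (1) $\Theta(\Omega_h^M)=\{M_{a,b}\mathcal L:(a,b)\in\Omega_1\}$ and $\Theta(\Omega_v^M)=\{M_{a,b}\mathcal L^R:(a,b)\in\Omega_2\}$. The maps $(a,b)\mapsto M_{a,b}\mathcal L$ on $\Omega_1$ and $(a,b)\mapsto M_{a,b}\mathcal L^R$ on $\Omega_2$ are injective, and together they give a bijection from $\Omega$ onto $\Theta(\Omega_h^M\cup\Omega_v^M)$. (2) Identify $\Omega$ with the section by this bijection. For each point $x$ of the section there is a least $s>0$ such that $h_sx$ lies in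 the section. This return time $R:\Omega\to\mathbb R_{>0}$ satisfies $R\ge1$. The triangle $\Omega_1$ is the disjoint union of $$\Omega_{AH}=\{a+b>1\},\qquad \Omega_{BD}=\{a+b\le1,\ (1+\sqrt2)a+\sqrt2b>1,\ (1+\sqrt2)a+b>1\},$$ $$\Omega_{HF}=\{(1+\sqrt2)a+\sqrt2b\le1,\ (1+\sqrt2)a+b>1\},\qquad \Omega_{AE}=\{(1+\sqrt2)a+b\le1\},$$ and $$R(a,b)=\begin{cases}\frac1{ab}&\text{on }\Omega_{AH},\\[2pt] \frac1{a(a+b)}&\text{on }\Omega_{BD},\\[2pt] \frac{\sqrt2}{a((1+\sqrt2)a+\sqrt2b)}&\text{on }\Omega_{HF},\\[2pt] \frac1{a((1+\sqrt2)a+b)}&\text{on }\Omega_{AE},\\[2pt] \frac1{ab}&\text{on }\Omega_2.\end{cases}$$ (3) The return map $T:\Omega\to\Omega$, $T(x)=h_{R(x)}x$, is a bijection that preserves Lebesgue measure on $\Omega$. It is piecewise linear with countably many pieces: there is a countable partition of $\Omega$ into convex polygons (each contained in one of the two triangles, and with or without its sides) on each of which $T$ is the restriction of a linear map of $\mathbb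 R^2$, with values in one of the two triangles. Explicitly, $T(a,b)$ is $$\begin{array}{ll} (b,\,-a+bk)\in\Omega_2,\ k=\left\lfloor\frac{1+a}{b}\right\rfloor & \text{for }(a,b)\in\Omega_{AH},\\[4pt] (a+b,\ b+(2+\sqrt2)(a+b)k)\in\Omega_1,\ k=\left\lfloor\frac{1-b}{(2+\sqrt2)(a+b)}\right\rfloor & \text{for }(a,b)\in\Omega_{BD},\\[4pt] (a',\ c+(2+\sqrt2)a'k)\in\Omega_1,\ a'=(1+\sqrt2)a+\sqrt2b,\ c=(2+\sqrt2)a+(1+\sqrt2)b,\ k=\left\lfloor\frac{1-c}{(2+\sqrt2)a'}\right\rfloor & \text{for }(a,b)\in\Omega_{HF},\\[4pt] (a',\ c+(2+\sqrt2)a'k)\in\Omega_1,\ a'=(1+\sqrt2)a+b,\ c=2(1+\sqrt2)a+(1+\sqrt2)b,\ k=\left\lfloor\frac{1-c}{(2+\sqrt2)a'}\right\rfloor & \text{for }(a,b)\in\Omega_{AE},\\[4pt] (b,\ -a+(2+\sqrt2)bk)\in\Omega_1,\ k=\left\lfloor\frac{1+a}{(2+\sqrt2)b}\right\rfloor & \text{for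 }(a,b)\in\Omega_2. \end{array}$$ -/

import Mathlib

open scoped MatrixGroups
open MeasureTheory

/-! ## Translation surfaces, presented by Euclidean polygons -/

/-- The Euclidean plane (only its topology and its vector space structure matter). -/
abbrev Plane : Type := Fin 2 → ℝ

/-- The determinant of two plane vectors. -/
def cross (u v : Plane) : ℝ := u 0 * v 1 - u 1 * v 0

/-- A closed connected translation surface, given by finitely many convex polygons in the plane
(vertices listed counterclockwise, angles equal to `π` being allowed) whose edges are identified in
pairs by translations. -/
structure TranslationSurface where
  /-- the number of polygons -/
  numPolygons : ℕ
  numPolygons_pos : 0 < numPolygons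
  /-- the number of sides of each polygon -/
  sides : Fin numPolygons → ℕ
  three_le_sides : ∀ i, 3 ≤ sides i
  /-- the vertices of each polygon in cyclic order -/
  vertex : (i : Fin numPolygons) → ZMod (sides i) → Plane
  vertex_injective : ∀ i, Function.Injective (vertex i)
  /-- the whole polygon lies to the left of each of its oriented edges -/
  left_of_edge : ∀ i j l, 0 ≤ cross (vertex i (j + 1) - vertex i j) (vertex i l - vertex i j)
  nondegenerate : ∀ i, ∃ j l, 0 < cross (vertex i (j + 1) - vertex i j) (vertex i l - vertex i j)
  /-- the edge to which an edge is glued; the edge `⟨i, j⟩` goes from `vertex i j` to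
  `vertex i (j + 1)` -/
  pair : (Σ i, ZMod (sides i)) → (Σ i, ZMod (sides i))
  pair_pair : ∀ e, pair (pair e) = e
  pair_ne : ∀ e, pair e ≠ e
  /-- paired edges are parallel and of the same length, with opposite boundary orientations -/
  edge_pair : ∀ e, vertex (pair e).1 ((pair e).2 + 1) - vertex (pair e).1 (pair e).2 =
    -(vertex e.1 (e.2 + 1) - vertex e.1 e.2)
  connected : ∀ i j, Relation.ReflTransGen
    (fun i' j' => ∃ k l, pair ⟨i', k⟩ = ⟨j', l⟩) i j

namespace TranslationSurface

/-- The vector from the initial to the final vertex of an edge. -/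
def edge (X : TranslationSurface) (e : Σ i, ZMod (X.sides i)) : Plane :=
  X.vertex e.1 (e.2 + 1) - X.vertex e.1 e.2

/-- The closed polygon number `i`. -/
def polygon (X : TranslationSurface) (i : Fin X.numPolygons) : Set Plane :=
  convexHull ℝ (Set.range (X.vertex i))

/-- The disjoint union of the closed polygons. -/
abbrev Pre (X : TranslationSurface) : Type := Σ i : Fin X.numPolygons, X.polygon i

/-- The elementary identifications: each edge is glued to its partner by a translation. -/
def Glue (X : TranslationSurface) (p q : X.Pre) : Prop :=
  ∃ (e : Σ i, ZMod (X.sides i)) (t : ℝ), 0 ≤ t ∧ t ≤ 1 ∧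
    p.1 = e.1 ∧ (p.2 : Plane) = X.vertex e.1 e.2 + t • X.edge e ∧
    q.1 = (X.pair e).1 ∧
    (q.2 : Plane) = X.vertex (X.pair e).1 (X.pair e).2 + (1 - t) • X.edge (X.pair e)

/-- The underlying closed surface, with the quotient topology. (`Quot` divides by the equivalence
relation generated by the elementary identifications.) -/
abbrev Carrier (X : TranslationSurface) : Type := Quot X.Glue

/-- `X.Disp x v y`: a segment with holonomy vector `v`, contained in one of the closed polygons,
leads from `x` to `y`. For short vectors `v` this says that `y` is the end point of a straight
segment of the flat surface with starting point `x` and holonomy `v`; if `x` is a cone point there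
are several such end points. -/
def Disp (X : TranslationSurface) (x : X.Carrier) (v : Plane) (y : X.Carrier) : Prop :=
  ∃ (i : Fin X.numPolygons) (p q : X.polygon i),
    Quot.mk _ ⟨i, p⟩ = x ∧ Quot.mk _ ⟨i, q⟩ = y ∧ (q : Plane) - (p : Plane) = v

/-- Equivalence of translation surfaces: a homeomorphism that preserves the holonomy vectors of all
short segments, i.e. is a translation in the local flat coordinates (an orientation preserving
isometry that preserves the vertical direction). -/
def Equivalent (X Y : TranslationSurface) : Prop :=
  ∃ f : X.Carrier ≃ₜ Y.Carrier, ∀ x : X.Carrier, ∃ ε : ℝ, 0 < ε ∧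
    ∀ (v : Plane) (y : X.Carrier), ‖v‖ < ε → (X.Disp x v y ↔ Y.Disp (f x) v (f y))

theorem Equivalent.refl (X : TranslationSurface) : X.Equivalent X :=
  ⟨Homeomorph.refl _, fun _ => ⟨1, one_pos, fun _ _ _ => Iff.rfl⟩⟩

theorem Equivalent.symm {X Y : TranslationSurface} (h : X.Equivalent Y) : Y.Equivalent X := by
  obtain ⟨f, hf⟩ := h
  refine ⟨f.symm, fun x => ?_⟩
  obtain ⟨ε, hε, H⟩ := hf (f.symm x)
  refine ⟨ε, hε, fun v y hv => ?_⟩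
  have := H v (f.symm y) hv
  simpa using this.symm

theorem Equivalent.trans {X Y Z : TranslationSurface} (h : X.Equivalent Y)
    (h' : Y.Equivalent Z) : X.Equivalent Z := by
  obtain ⟨f, hf⟩ := h
  obtain ⟨g, hg⟩ := h'
  refine ⟨f.trans g, fun x => ?_⟩
  obtain ⟨ε, hε, H⟩ := hf x
  obtain ⟨δ, hδ, H'⟩ := hg (f x)
  refine ⟨min ε δ, lt_min hε hδ, fun v y hv => ?_⟩
  exact (H v y (lt_of_lt_of_le hv (min_le_left _ _))).trans
    (H' v (f y) (lt_of_lt_of_le hv (min_le_right _ _)))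

instance instSetoid : Setoid TranslationSurface where
  r := Equivalent
  iseqv := ⟨Equivalent.refl, Equivalent.symm, Equivalent.trans⟩

theorem cross_mulVec (A : SL(2, ℝ)) (u v : Plane) :
    cross (A.1.mulVec u) (A.1.mulVec v) = cross u v := by
  have hA := A.2
  rw [Matrix.det_fin_two] at hA
  simp only [cross, Matrix.mulVec, dotProduct, Fin.sum_univ_two]
  linear_combination (u 0 * v 1 - u 1 * v 0) * hA

theorem inv_mulVec_mulVec (A : SL(2, ℝ)) (u : Plane) :
    (A⁻¹).1.mulVec (A.1.mulVec u) = u := by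
  have h : (A⁻¹).1 * A.1 = 1 := congrArg Subtype.val (inv_mul_cancel A)
  rw [Matrix.mulVec_mulVec, h, Matrix.one_mulVec]

theorem mulVec_inv_mulVec (A : SL(2, ℝ)) (u : Plane) :
    A.1.mulVec ((A⁻¹).1.mulVec u) = u := by
  have h : A.1 * (A⁻¹).1 = 1 := congrArg Subtype.val (mul_inv_cancel A)
  rw [Matrix.mulVec_mulVec, h, Matrix.one_mulVec]

/-- The action of `SL(2, ℝ)`: apply the matrix to all polygons and keep the gluing pattern. -/
instance instSMul : SMul SL(2, ℝ) TranslationSurface where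
  smul A X :=
    { numPolygons := X.numPolygons
      numPolygons_pos := X.numPolygons_pos
      sides := X.sides
      three_le_sides := X.three_le_sides
      vertex := fun i j => A.1.mulVec (X.vertex i j)
      vertex_injective := fun i j l h => X.vertex_injective i (by
        have := congrArg (A⁻¹).1.mulVec h
        simpa only [inv_mulVec_mulVec] using this)
      left_of_edge := fun i j l => by
        rw [← Matrix.mulVec_sub, ← Matrix.mulVec_sub, cross_mulVec]
        exact X.left_of_edge i j l
      nondegenerate := fun i => by
        obtain ⟨j, l, h⟩ := X.nondegenerate i
        refine ⟨j, l, ?_⟩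
        rw [← Matrix.mulVec_sub, ← Matrix.mulVec_sub, cross_mulVec]
        exact h
      pair := X.pair
      pair_pair := X.pair_pair
      pair_ne := X.pair_ne
      edge_pair := fun e => by
        rw [← Matrix.mulVec_sub, ← Matrix.mulVec_sub, X.edge_pair e, Matrix.mulVec_neg]
      connected := X.connected }

theorem smul_polygon (A : SL(2, ℝ)) (X : TranslationSurface) (i : Fin X.numPolygons) :
    (A • X).polygon i = A.1.mulVec '' X.polygon i := by
  have h := (Matrix.mulVecLin A.1).image_convexHull (Set.range (X.vertex i))
  rw [← Set.range_comp] at h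
  exact h.symm

/-- The homeomorphism from a closed polygon onto its image. -/
def polygonHomeo (A : SL(2, ℝ)) (X : TranslationSurface) (i : Fin X.numPolygons) :
    X.polygon i ≃ₜ (A • X).polygon i where
  toFun p := ⟨A.1.mulVec p.1, by rw [smul_polygon]; exact ⟨p.1, p.2, rfl⟩⟩
  invFun q := ⟨(A⁻¹).1.mulVec q.1, by
    obtain ⟨p, hp, hpq⟩ := (smul_polygon A X i).subset q.2
    rw [← hpq, inv_mulVec_mulVec]
    exact hp⟩
  left_inv p := Subtype.ext (inv_mulVec_mulVec A p.1)
  right_inv q := Subtype.ext (mulVec_inv_mulVec A q.1)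
  continuous_toFun :=
    (Continuous.matrix_mulVec continuous_const continuous_subtype_val).subtype_mk _
  continuous_invFun :=
    (Continuous.matrix_mulVec continuous_const continuous_subtype_val).subtype_mk _

/-- The homeomorphism between the disjoint unions of polygons. -/
def preHomeo (A : SL(2, ℝ)) (X : TranslationSurface) : X.Pre ≃ₜ (A • X).Pre where
  toFun p := ⟨p.1, polygonHomeo A X p.1 p.2⟩
  invFun q := ⟨q.1, (polygonHomeo A X q.1).symm q.2⟩
  left_inv p := by
    obtain ⟨i, p⟩ := p
    simp
  right_inv q := by
    obtain ⟨i, q⟩ := q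
    simp
  continuous_toFun := continuous_sigma fun i =>
    (continuous_sigmaMk (σ := fun i => (A • X).polygon i)).comp (polygonHomeo A X i).continuous
  continuous_invFun := continuous_sigma fun i =>
    (continuous_sigmaMk (σ := fun i => X.polygon i)).comp (polygonHomeo A X i).symm.continuous

theorem mulVec_injective (A : SL(2, ℝ)) : Function.Injective (A.1.mulVec : Plane → Plane) :=
  Function.LeftInverse.injective (inv_mulVec_mulVec A)

theorem glue_preHomeo (A : SL(2, ℝ)) (X : TranslationSurface) (p q : X.Pre) :
    X.Glue p q ↔ (A • X).Glue (preHomeo A X p) (preHomeo A X q) := by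
  have key : ∀ (e : Σ i, ZMod (X.sides i)) (t : ℝ),
      (A • X).vertex e.1 e.2 + t • (A • X).edge e =
        A.1.mulVec (X.vertex e.1 e.2 + t • X.edge e) := by
    intro e t
    rw [Matrix.mulVec_add, Matrix.mulVec_smul]
    unfold edge
    rw [Matrix.mulVec_sub]
    rfl
  refine exists_congr fun e => exists_congr fun t => and_congr_right fun _ =>
    and_congr_right fun _ => and_congr Iff.rfl (and_congr ?_ (and_congr Iff.rfl ?_))
  · rw [key e t]
    exact (mulVec_injective A).eq_iff.symm
  · exact (mulVec_injective A).eq_iff.symm.trans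
      (Eq.congr_right (key (X.pair e) (1 - t))).symm

/-- The homeomorphism from a surface onto its image under a matrix. -/
def carrierHomeo (A : SL(2, ℝ)) (X : TranslationSurface) : X.Carrier ≃ₜ (A • X).Carrier :=
  Homeomorph.Quot.congr (preHomeo A X) (glue_preHomeo A X)

theorem disp_carrierHomeo (A : SL(2, ℝ)) (X : TranslationSurface) (x y : X.Carrier) (v : Plane) :
    X.Disp x v y ↔
      (A • X).Disp (carrierHomeo A X x) (A.1.mulVec v) (carrierHomeo A X y) := by
  constructor
  · rintro ⟨i, p, q, rfl, rfl, rfl⟩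
    exact ⟨i, polygonHomeo A X i p, polygonHomeo A X i q, rfl, rfl,
      (Matrix.mulVec_sub A.1 q.1 p.1).symm⟩
  · rintro ⟨i, p, q, hp, hq, h⟩
    refine ⟨i, (polygonHomeo A X i).symm p, (polygonHomeo A X i).symm q, ?_, ?_, ?_⟩
    · apply (carrierHomeo A X).injective
      rw [← hp]
      exact congrArg (Quot.mk _) ((preHomeo A X).apply_symm_apply ⟨i, p⟩)
    · apply (carrierHomeo A X).injective
      rw [← hq]
      exact congrArg (Quot.mk _) ((preHomeo A X).apply_symm_apply ⟨i, q⟩)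
    · apply mulVec_injective A
      rw [← h, Matrix.mulVec_sub]
      exact congrArg₂ (· - ·) (mulVec_inv_mulVec A q.1) (mulVec_inv_mulVec A p.1)

theorem Equivalent.smul (A : SL(2, ℝ)) {X Y : TranslationSurface} (h : X.Equivalent Y) :
    (A • X).Equivalent (A • Y) := by
  obtain ⟨f, hf⟩ := h
  refine ⟨((carrierHomeo A X).symm.trans f).trans (carrierHomeo A Y), fun x => ?_⟩
  obtain ⟨ε, hε, H⟩ := hf ((carrierHomeo A X).symm x)
  have hc : Continuous fun v : Plane => (A⁻¹).1.mulVec v :=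
    Continuous.matrix_mulVec continuous_const continuous_id
  obtain ⟨δ, hδ, H'⟩ := Metric.continuous_iff.1 hc 0 ε hε
  refine ⟨δ, hδ, fun v y hv => ?_⟩
  have h1 : ‖(A⁻¹).1.mulVec v‖ < ε := by
    have := H' v (by simpa using hv)
    simpa using this
  have h2 := H _ ((carrierHomeo A X).symm y) h1
  rw [disp_carrierHomeo A X, disp_carrierHomeo A Y, mulVec_inv_mulVec] at h2
  simpa using h2

theorem one_smul_surface (X : TranslationSurface) : (1 : SL(2, ℝ)) • X = X := by
  cases X
  change TranslationSurface.mk .. = _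
  congr 1
  funext i j
  exact Matrix.one_mulVec _

theorem mul_smul_surface (A B : SL(2, ℝ)) (X : TranslationSurface) :
    (A * B) • X = A • B • X := by
  cases X
  change TranslationSurface.mk .. = TranslationSurface.mk ..
  congr 1
  funext i j
  exact (Matrix.mulVec_mulVec _ _ _).symm

/-- The space of translation surfaces up to equivalence. -/
def Moduli : Type := Quotient instSetoid

noncomputable instance instMulActionModuli : MulAction SL(2, ℝ) Moduli where
  smul A := Quotient.map (fun X => A • X) fun _ _ h => Equivalent.smul A h
  one_smul := by
    rintro ⟨X⟩
    exact congrArg (Quotient.mk _) (one_smul_surface X)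
  mul_smul A B := by
    rintro ⟨X⟩
    exact congrArg (Quotient.mk _) (mul_smul_surface A B X)

end TranslationSurface

/-! ## The normalized L -/

namespace NormalizedL

/-- The corners of the rectangle `[x₀, x₁] × [y₀, y₁]`, counterclockwise from the lower left one;
edge number `j` of the rectangle is thus the bottom, right, top, left one for `j = 0, 1, 2, 3`. -/
def rect (x₀ x₁ y₀ y₁ : ℝ) : ZMod 4 → Plane :=
  ![![x₀, y₀], ![x₁, y₀], ![x₁, y₁], ![x₀, y₁]]

theorem forall_zmod4 {P : ZMod 4 → Prop} (h0 : P 0) (h1 : P 1) (h2 : P 2) (h3 : P 3) :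
    ∀ j, P j := by
  intro j
  change Fin 4 at j
  fin_cases j
  exacts [h0, h1, h2, h3]

theorem rect_zero (x₀ x₁ y₀ y₁ : ℝ) : rect x₀ x₁ y₀ y₁ 0 = ![x₀, y₀] := rfl
theorem rect_one (x₀ x₁ y₀ y₁ : ℝ) : rect x₀ x₁ y₀ y₁ 1 = ![x₁, y₀] := rfl
theorem rect_two (x₀ x₁ y₀ y₁ : ℝ) : rect x₀ x₁ y₀ y₁ 2 = ![x₁, y₁] := rfl
theorem rect_three (x₀ x₁ y₀ y₁ : ℝ) : rect x₀ x₁ y₀ y₁ 3 = ![x₀, y₁] := rfl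

theorem zmod4_add_one :
    (0 : ZMod 4) + 1 = 1 ∧ (1 : ZMod 4) + 1 = 2 ∧ (2 : ZMod 4) + 1 = 3 ∧ (3 : ZMod 4) + 1 = 0 :=
  ⟨rfl, rfl, rfl, rfl⟩

theorem zmod4_add_two :
    (0 : ZMod 4) + 2 = 2 ∧ (1 : ZMod 4) + 2 = 3 ∧ (2 : ZMod 4) + 2 = 0 ∧ (3 : ZMod 4) + 2 = 1 :=
  ⟨rfl, rfl, rfl, rfl⟩

theorem rect_injective {x₀ x₁ y₀ y₁ : ℝ} (hx : x₀ < x₁) (hy : y₀ < y₁) :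
    Function.Injective (rect x₀ x₁ y₀ y₁) := by
  have key : ∀ j l, rect x₀ x₁ y₀ y₁ j = rect x₀ x₁ y₀ y₁ l → j = l := by
    refine forall_zmod4 ?_ ?_ ?_ ?_ <;> refine forall_zmod4 ?_ ?_ ?_ ?_ <;> intro h <;>
      first
        | rfl
        | (exfalso
           have h0 := congrFun h 0
           have h1 := congrFun h 1
           simp [rect_zero, rect_one, rect_two, rect_three] at h0 h1
           linarith)
  exact fun j l h => key j l h

theorem rect_left_of_edge {x₀ x₁ y₀ y₁ : ℝ} (hx : x₀ < x₁) (hy : y₀ < y₁) :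
    ∀ j l, 0 ≤ cross (rect x₀ x₁ y₀ y₁ (j + 1) - rect x₀ x₁ y₀ y₁ j)
      (rect x₀ x₁ y₀ y₁ l - rect x₀ x₁ y₀ y₁ j) := by
  have h : 0 ≤ (x₁ - x₀) * (y₁ - y₀) :=
    mul_nonneg (sub_nonneg.2 hx.le) (sub_nonneg.2 hy.le)
  refine forall_zmod4 ?_ ?_ ?_ ?_ <;> refine forall_zmod4 ?_ ?_ ?_ ?_ <;>
    simp [zmod4_add_one, rect_zero, rect_one, rect_two, rect_three, cross] <;> linarith

theorem rect_nondegenerate {x₀ x₁ y₀ y₁ : ℝ} (hx : x₀ < x₁) (hy : y₀ < y₁) :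
    ∃ j l, 0 < cross (rect x₀ x₁ y₀ y₁ (j + 1) - rect x₀ x₁ y₀ y₁ j)
      (rect x₀ x₁ y₀ y₁ l - rect x₀ x₁ y₀ y₁ j) := by
  refine ⟨0, 2, ?_⟩
  have h : 0 < (x₁ - x₀) * (y₁ - y₀) := mul_pos (sub_pos.2 hx) (sub_pos.2 hy)
  rw [zmod4_add_one.1, rect_zero, rect_one, rect_two]
  simpa [cross] using h

/-- The three rectangles of the surface: `[0, 1+√2] × [0, 1]`, `[1+√2, 2+√2] × [0, 1]` and
`[0, 1+√2] × [1, 1+√2]`. -/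
noncomputable def corner : Fin 3 → ZMod 4 → Plane :=
  ![rect 0 (1 + √2) 0 1, rect (1 + √2) (2 + √2) 0 1, rect 0 (1 + √2) 1 (1 + √2)]

/-- The rectangle to which edge `j` of rectangle `i` is glued (always along the opposite edge). -/
def neighbor : Fin 3 → Fin 4 → Fin 3 :=
  ![![2, 1, 2, 1], ![1, 0, 1, 0], ![0, 2, 0, 2]]

/-- The normalized L-shaped surface: the L-shaped octagon with corners
`(0,0), (1+√2,0), (2+√2,0), (2+√2,1), (1+√2,1), (1+√2,1+√2), (0,1+√2), (0,1)`
whose sides are glued in pairs by horizontal and vertical translations. Here the octagon is cut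
along two segments into three rectangles, the two sides of each cut being glued as well. -/
noncomputable def surface : TranslationSurface where
  numPolygons := 3
  numPolygons_pos := by norm_num
  sides := fun _ => 4
  three_le_sides := fun _ => by norm_num
  vertex := corner
  vertex_injective := by
    have h : 0 < √2 := by positivity
    intro i
    fin_cases i <;> exact rect_injective (by linarith) (by linarith)
  left_of_edge := by
    have h : 0 < √2 := by positivity
    intro i
    fin_cases i <;> exact rect_left_of_edge (by linarith) (by linarith)
  nondegenerate := by
    have h : 0 < √2 := by positivity
    intro i
    fin_cases i <;> exact rect_nondegenerate (by linarith) (by linarith)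
  pair := fun e => ⟨neighbor e.1 e.2, e.2 + 2⟩
  pair_pair := by
    have key : ∀ (i : Fin 3) (j : Fin 4), neighbor (neighbor i j) (j + 2) = i ∧ j + 2 + 2 = j := by
      decide
    rintro ⟨i, j⟩
    exact Sigma.ext (key i j).1 (heq_of_eq (key i j).2)
  pair_ne := by
    have key : ∀ j : Fin 4, j + 2 ≠ j := by decide
    rintro ⟨i, j⟩ h
    exact key j (congrArg (fun e : (Σ _ : Fin 3, ZMod 4) => e.2) h)
  edge_pair := by
    have key : ∀ (i : Fin 3) (j : ZMod 4),
        corner (neighbor i j) (j + 2 + 1) - corner (neighbor i j) (j + 2) =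
          -(corner i (j + 1) - corner i j) := by
      intro i
      have c0 : corner 0 = rect 0 (1 + √2) 0 1 := rfl
      have c1 : corner 1 = rect (1 + √2) (2 + √2) 0 1 := rfl
      have c2 : corner 2 = rect 0 (1 + √2) 1 (1 + √2) := rfl
      have n : neighbor 0 (0 : ZMod 4) = 2 ∧ neighbor 0 (1 : ZMod 4) = 1 ∧
          neighbor 0 (2 : ZMod 4) = 2 ∧ neighbor 0 (3 : ZMod 4) = 1 ∧
          neighbor 1 (0 : ZMod 4) = 1 ∧ neighbor 1 (1 : ZMod 4) = 0 ∧
          neighbor 1 (2 : ZMod 4) = 1 ∧ neighbor 1 (3 : ZMod 4) = 0 ∧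
          neighbor 2 (0 : ZMod 4) = 0 ∧ neighbor 2 (1 : ZMod 4) = 2 ∧
          neighbor 2 (2 : ZMod 4) = 0 ∧ neighbor 2 (3 : ZMod 4) = 2 := by
        refine ⟨rfl, rfl, rfl, rfl, rfl, rfl, rfl, rfl, rfl, rfl, rfl, rfl⟩
      fin_cases i <;> refine forall_zmod4 ?_ ?_ ?_ ?_ <;> funext c <;> fin_cases c <;>
        simp [zmod4_add_one, zmod4_add_two, n, c0, c1, c2, rect_zero, rect_one, rect_two,
          rect_three]
    rintro ⟨i, j⟩
    exact key i j
  connected := by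
    have key : ∀ i j : Fin 3, ∃ k l : Fin 4, neighbor (neighbor i k) l = j := by
      decide
    intro i j
    obtain ⟨k, l, h⟩ := key i j
    exact (Relation.ReflTransGen.single
      ⟨k, k + (2 : Fin 4), rfl⟩).tail ⟨l, l + (2 : Fin 4), Sigma.ext h (heq_of_eq rfl)⟩

/-- The point `ℒ` of the space of translation surfaces. -/
noncomputable def L : TranslationSurface.Moduli :=
  Quotient.mk TranslationSurface.instSetoid surface

/-- The Veech group `Γ = SL(ℒ)`: the stabilizer of `ℒ` in `SL(2, ℝ)`. -/
noncomputable def veechGroup : Subgroup SL(2, ℝ) := MulAction.stabilizer SL(2, ℝ) L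

/-- The rotation by `π / 2` in the clockwise direction. -/
def rot : SL(2, ℝ) := ⟨!![0, 1; -1, 0], by simp [Matrix.det_fin_two]⟩

/-- The rotated surface `ℒᴿ`. -/
noncomputable def LR : TranslationSurface.Moduli := rot • L

/-- The matrix `h_s` of the horocycle flow. -/
def horo (s : ℝ) : SL(2, ℝ) := ⟨!![1, 0; -s, 1], by simp [Matrix.det_fin_two]⟩

/-- The matrix `M_{a,b}`, for `a ≠ 0`. -/
noncomputable def M (a b : ℝ) (ha : a ≠ 0) : SL(2, ℝ) :=
  ⟨!![a, b; 0, a⁻¹], by simp [Matrix.det_fin_two, ha]⟩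

/-- The canonical bijection from `SL(2, ℝ) ⧸ Γ` to the orbit of `ℒ`, sending `gΓ` to `gℒ`. -/
noncomputable def Θ : SL(2, ℝ) ⧸ veechGroup ≃ MulAction.orbit SL(2, ℝ) L :=
  (MulAction.orbitEquivQuotientStabilizer SL(2, ℝ) L).symm

/-- The `Γ`-orbit of the horizontal saddle connection vector `(1, 0)`. -/
def lambdaH : Set Plane := {v | ∃ γ ∈ veechGroup, v = γ.1.mulVec ![1, 0]}

/-- The `Γ`-orbit of the vertical saddle connection vector `(0, 1)`. -/
def lambdaV : Set Plane := {v | ∃ γ ∈ veechGroup, v = γ.1.mulVec ![0, 1]}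

/-- The cosets `gΓ` for which `g Λ` contains a vector `(t, 0)` with `0 < t ≤ 1`. -/
def shortHorizontal (Λ : Set Plane) : Set (SL(2, ℝ) ⧸ veechGroup) :=
  {x | ∃ g : SL(2, ℝ), x = (g : SL(2, ℝ) ⧸ veechGroup) ∧
    ∃ v ∈ Λ, ∃ t : ℝ, 0 < t ∧ t ≤ 1 ∧ g.1.mulVec v = ![t, 0]}

/-- The part `Ω_h^M` of the section. -/
def sectionH : Set (SL(2, ℝ) ⧸ veechGroup) := shortHorizontal lambdaH

/-- The part `Ω_v^M` of the section. -/
def sectionV : Set (SL(2, ℝ) ⧸ veechGroup) := shortHorizontal lambdaV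

/-- The section `Ω_h^M ∪ Ω_v^M`, regarded as a set of translation surfaces by means of `Θ`. -/
def sectionSurfaces : Set TranslationSurface.Moduli :=
  (fun x => (Θ x : TranslationSurface.Moduli)) '' (sectionH ∪ sectionV)

/-- The triangle `Ω₁`. -/
def Ω₁ : Set (ℝ × ℝ) := {p | 0 < p.1 ∧ p.1 ≤ 1 ∧ 1 - (√2 + 2) * p.1 < p.2 ∧ p.2 ≤ 1}

/-- The triangle `Ω₂`. -/
def Ω₂ : Set (ℝ × ℝ) := {p | 0 < p.1 ∧ p.1 ≤ 1 ∧ 1 - p.1 < p.2 ∧ p.2 ≤ 1}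

/-- The surface `M_{a,b} ℒ`, for `(a, b) ∈ Ω₁`. -/
noncomputable def point₁ (p : Ω₁) : TranslationSurface.Moduli :=
  M p.1.1 p.1.2 (ne_of_gt p.2.1) • L

/-- The surface `M_{a,b} ℒᴿ`, for `(a, b) ∈ Ω₂`. -/
noncomputable def point₂ (p : Ω₂) : TranslationSurface.Moduli :=
  M p.1.1 p.1.2 (ne_of_gt p.2.1) • LR

/-- The surface with given coordinates. As `Ω₁` and `Ω₂` overlap as subsets of the plane, the
coordinates live in their disjoint union. -/
noncomputable def point : Ω₁ ⊕ Ω₂ → TranslationSurface.Moduli := Sum.elim point₁ point₂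

/-- The pair of real coordinates. -/
def coord : Ω₁ ⊕ Ω₂ → ℝ × ℝ := Sum.elim Subtype.val Subtype.val

/-- The first of the four regions into which `Ω₁` is divided. The names are those of the saddle
connections of `ℒ`, with holonomy `(0,1)`, `(1,1)`, `(1+√2,√2)` and `(1+√2,1)`, whose images
become horizontal first. -/
def ΩAH : Set (ℝ × ℝ) := {p | p ∈ Ω₁ ∧ 1 < p.1 + p.2}

/-- The second region of `Ω₁`. -/
def ΩBD : Set (ℝ × ℝ) := {p | p ∈ Ω₁ ∧ p.1 + p.2 ≤ 1 ∧
  1 < (1 + √2) * p.1 + √2 * p.2 ∧ 1 < (1 + √2) * p.1 + p.2}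

/-- The third region of `Ω₁`. -/
def ΩHF : Set (ℝ × ℝ) := {p | p ∈ Ω₁ ∧ (1 + √2) * p.1 + √2 * p.2 ≤ 1 ∧ 1 < (1 + √2) * p.1 + p.2}

/-- The fourth region of `Ω₁`. -/
def ΩAE : Set (ℝ × ℝ) := {p | p ∈ Ω₁ ∧ (1 + √2) * p.1 + p.2 ≤ 1}

/-- Lebesgue measure on the disjoint union of `Ω₁` and `Ω₂`. -/
noncomputable def lebesgue : Measure (Ω₁ ⊕ Ω₂) :=
  Measure.map Sum.inl (Measure.comap (Subtype.val : Ω₁ → ℝ × ℝ) volume) +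
    Measure.map Sum.inr (Measure.comap (Subtype.val : Ω₂ → ℝ × ℝ) volume)

/-- Open or closed half planes. -/
def IsHalfPlane (H : Set (ℝ × ℝ)) : Prop :=
  ∃ α β γ : ℝ, (α, β) ≠ (0, 0) ∧
    (H = {p | α * p.1 + β * p.2 ≤ γ} ∨ H = {p | α * p.1 + β * p.2 < γ})

/-- Convex polygons, each side of which may or may not belong to the set. -/
def IsConvexPolygon (P : Set (ℝ × ℝ)) : Prop :=
  Bornology.IsBounded P ∧
    ∃ F : Set (Set (ℝ × ℝ)), F.Finite ∧ (∀ H ∈ F, IsHalfPlane H) ∧ P = ⋂₀ F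

/-- A subset of the disjoint union that is a convex polygon in one of the two triangles. -/
def IsPiece (P : Set (Ω₁ ⊕ Ω₂)) : Prop :=
  IsConvexPolygon (coord '' P) ∧ (P ⊆ Set.range Sum.inl ∨ P ⊆ Set.range Sum.inr)

/-- Piecewise linear maps with countably many pieces: there is a countable partition into convex
polygons on each of which the map is the restriction of a linear map of the plane into one of the
two triangles. -/
def IsPiecewiseLinear (T : Ω₁ ⊕ Ω₂ → Ω₁ ⊕ Ω₂) : Prop :=
  ∃ 𝒬 : Set (Set (Ω₁ ⊕ Ω₂)), 𝒬.Countable ∧ (∀ P ∈ 𝒬, IsPiece P) ∧ (∀ x, ∃! P, P ∈ 𝒬 ∧ x ∈ P) ∧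
    ∀ P ∈ 𝒬, ∃ A : (ℝ × ℝ) →ₗ[ℝ] (ℝ × ℝ), (∀ x ∈ P, coord (T x) = A (coord x)) ∧
      (T '' P ⊆ Set.range Sum.inl ∨ T '' P ⊆ Set.range Sum.inr)

end NormalizedL

open NormalizedL

/-! # The horocycle flow on the orbit of the L-shaped surface

The whole theorem follows from two facts on the Veech group `Γ` of `ℒ`.

* `Γ` contains `(1, 2 + √2; 0, 1)` and `(1, 0; 1, 1)` (`upper_mem`, `lower_mem`). In the horizontal
  as in the vertical direction `ℒ` decomposes into two cylinders whose moduli have a common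
  multiple, so that simultaneous Dehn twists of the cylinders, built by unrolling them
  (`cyl`, `shearMap`), are affine homeomorphisms.
* A vector of the `Γ`-orbits of `(1, 0)` and `(0, 1)` has no coordinate strictly between `0` and `1`
  (`not_between`). Indeed an affine homeomorphism fixes the cone point, or at least maps it to a
  point of height `0` in its cylinder, because three short segments in a common generic direction
  start there and at most two start at any point that is not a corner of a rectangle
  (`height_map_conePoint`). Hence it takes a side of the unit square to a path of constant direction
  that starts and ends at height `0`. All cylinders have height at least `1`, so the path cannot
  end at height `0` after climbing by an amount strictly between `0` and `1`.

Moving vectors by the two parabolic elements, the second fact also bounds their determinants with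
other saddle connection vectors (`sides_dets`) and determines the triangular elements of `Γ`
(`exists_of_upper_mem`, `exists_of_lower_mem`, `apply_one_one_ne_zero`). That makes the
parametrization of the section by the two triangles injective (`point_injective`). A surface with
coordinates `(a, b)` returns when the first of the vectors of the orbits, in the vertical strip of
width `1`, becomes horizontal. The directions `(1, 0)`, `(1 + √2, 1)`, `(1 + √2, √2)`, `(1, 1)` and
`(0, 1)` cut the quadrant into cones. Inside a cone a vector is a combination of the two sides with
coefficients at least `1`, so that it lies outside the strip if its slope is smaller than that of
the vector of the respective branch (`slope_le`).

Each branch of the return map is linear with determinant `1` on each of the convex polygons on which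
the integer `Branch.shift` is constant. The return map is injective since return times are minimal.
It is surjective since return times are at least `1`, so that every point has a last visit in the
past, and some visit in the past exists by the symmetry `(x, y) ↦ (x, -y)`
(`exists_past`). Therefore it preserves Lebesgue measure.
-/

namespace NormalizedL

/-! ### The surface in offset coordinates -/

/-- The lower left corners of the three rectangles. -/
noncomputable def lo : Fin 3 → Plane := ![![0, 0], ![1 + √2, 0], ![0, 1]]

/-- The side lengths of the three rectangles. -/
noncomputable def sz : Fin 3 → Plane := ![![1 + √2, 1], ![1, 1], ![1 + √2, √2]]

/-- The rectangle reached by leaving rectangle `i` in coordinate direction `c`. As horizontal (and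
vertical) cylinders consist of at most two rectangles, it does not matter on which side one
leaves. -/
def nb : Fin 2 → Fin 3 → Fin 3 := ![![1, 0, 2], ![2, 1, 0]]

theorem one_le_sqrt_two : (1 : ℝ) ≤ √2 := Real.one_le_sqrt.2 one_le_two

theorem sqrt_two_mul_self : √2 * √2 = (2 : ℝ) := Real.mul_self_sqrt zero_le_two

theorem sqrt_two_lt : √2 < (3 : ℝ) / 2 := by
  nlinarith [sqrt_two_mul_self, one_le_sqrt_two]

theorem lt_sqrt_two : (7 : ℝ) / 5 < √2 := by
  nlinarith [sqrt_two_mul_self, one_le_sqrt_two]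

theorem one_le_sz (i : Fin 3) (c : Fin 2) : 1 ≤ sz i c := by
  fin_cases i <;> fin_cases c <;> simp [sz]

theorem sz_pos (i : Fin 3) (c : Fin 2) : 0 < sz i c := one_pos.trans_le (one_le_sz i c)

theorem nb_nb (c : Fin 2) (i : Fin 3) : nb c (nb c i) = i := by
  revert c i; decide

theorem sz_nb (c : Fin 2) (i : Fin 3) : sz (nb c i) (1 - c) = sz i (1 - c) := by
  fin_cases i <;> fin_cases c <;> simp [sz, nb]

theorem eq_or_eq_one_sub (c k : Fin 2) : k = c ∨ k = 1 - c := by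
  revert c k; decide

theorem one_sub_ne (c : Fin 2) : 1 - c ≠ c := by
  revert c; decide

theorem one_sub_one_sub (c : Fin 2) : 1 - (1 - c) = c := by
  revert c; decide

/-- The offset `u` from the lower left corner describes a point of rectangle `i`. -/
def InBox (i : Fin 3) (u : Plane) : Prop := ∀ c, 0 ≤ u c ∧ u c ≤ sz i c

theorem corner_eq (i : Fin 3) :
    corner i = rect (lo i 0) (lo i 0 + sz i 0) (lo i 1) (lo i 1 + sz i 1) := by
  fin_cases i <;> simp [corner, lo, sz] <;> ring_nf

theorem convexHull_rect {x₀ x₁ y₀ y₁ : ℝ} (hx : x₀ < x₁) (hy : y₀ < y₁) :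
    convexHull ℝ (Set.range (rect x₀ x₁ y₀ y₁)) =
      {p | (x₀ ≤ p 0 ∧ p 0 ≤ x₁) ∧ (y₀ ≤ p 1 ∧ p 1 ≤ y₁)} := by
  apply subset_antisymm
  · apply convexHull_min
    · rintro _ ⟨j, rfl⟩
      revert j
      refine forall_zmod4 ?_ ?_ ?_ ?_ <;>
        simp [rect_zero, rect_one, rect_two, rect_three, hx.le, hy.le]
    · rintro p ⟨⟨h1, h2⟩, h3, h4⟩ q ⟨⟨h5, h6⟩, h7, h8⟩ a b ha hb hab
      have e : ∀ r : ℝ, r = a * r + b * r := fun r => by rw [← add_mul, hab, one_mul]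
      simp only [Set.mem_ofPred_eq, Pi.add_apply, Pi.smul_apply, smul_eq_mul]
      refine ⟨⟨?_, ?_⟩, ?_, ?_⟩
      · rw [e x₀]; gcongr
      · rw [e x₁]; gcongr
      · rw [e y₀]; gcongr
      · rw [e y₁]; gcongr
  · rintro p ⟨⟨h1, h2⟩, h3, h4⟩
    have hc := convex_convexHull ℝ (Set.range (rect x₀ x₁ y₀ y₁))
    have hm : ∀ j, rect x₀ x₁ y₀ y₁ j ∈ convexHull ℝ (Set.range (rect x₀ x₁ y₀ y₁)) :=
      fun j => subset_convexHull ℝ _ ⟨j, rfl⟩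
    have hx' : x₁ - x₀ ≠ 0 := by linarith
    have hy' : y₁ - y₀ ≠ 0 := by linarith
    have hs : (x₁ - p 0) / (x₁ - x₀) + (p 0 - x₀) / (x₁ - x₀) = 1 := by field_simp; ring
    have ht : (y₁ - p 1) / (y₁ - y₀) + (p 1 - y₀) / (y₁ - y₀) = 1 := by field_simp; ring
    have hs0 : 0 ≤ (x₁ - p 0) / (x₁ - x₀) := div_nonneg (by linarith) (by linarith)
    have hs1 : 0 ≤ (p 0 - x₀) / (x₁ - x₀) := div_nonneg (by linarith) (by linarith)
    have ht0 : 0 ≤ (y₁ - p 1) / (y₁ - y₀) := div_nonneg (by linarith) (by linarith)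
    have ht1 : 0 ≤ (p 1 - y₀) / (y₁ - y₀) := div_nonneg (by linarith) (by linarith)
    have hb := hc (hm 0) (hm 1) hs0 hs1 hs
    have hu := hc (hm 3) (hm 2) hs0 hs1 hs
    convert hc hb hu ht0 ht1 ht using 1
    funext k
    fin_cases k
    · simp [rect_zero, rect_one, rect_two, rect_three]
      field_simp
      ring
    · simp [rect_zero, rect_one, rect_two, rect_three]
      field_simp
      ring

theorem mem_polygon (i : Fin 3) (p : Plane) :
    p ∈ surface.polygon i ↔ InBox i (p - lo i) := by
  have h : surface.polygon i = convexHull ℝ (Set.range (corner i)) := rfl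
  rw [h, corner_eq, convexHull_rect (by linarith [sz_pos i 0]) (by linarith [sz_pos i 1])]
  simp only [Set.mem_ofPred_eq, InBox, Fin.forall_fin_two, Pi.sub_apply]
  constructor <;> rintro ⟨⟨h1, h2⟩, h3, h4⟩ <;> refine ⟨⟨?_, ?_⟩, ?_, ?_⟩ <;> linarith

/-- The offset of a point of the disjoint union of the rectangles. -/
noncomputable def off (p : surface.Pre) : Plane := (p.2 : Plane) - lo p.1

theorem inBox_off (p : surface.Pre) : InBox p.1 (off p) := (mem_polygon _ _).1 p.2.2

/-- Elementary identification across an edge that is crossed in coordinate direction `c`, in terms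
of offsets. -/
def GlueC (c : Fin 2) (i : Fin 3) (u : Plane) (i' : Fin 3) (u' : Plane) : Prop :=
  i' = nb c i ∧ ((u c = 0 ∧ u' c = sz i' c) ∨ (u c = sz i c ∧ u' c = 0)) ∧ u (1 - c) = u' (1 - c)

theorem GlueC.symm {c : Fin 2} {i i' : Fin 3} {u u' : Plane} (h : GlueC c i u i' u') :
    GlueC c i' u' i u := by
  obtain ⟨rfl, h, h'⟩ := h
  exact ⟨(nb_nb c i).symm, h.symm.imp And.symm And.symm, h'.symm⟩

theorem surface_edge (i : Fin 3) (j : ZMod 4) :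
    surface.edge ⟨i, j⟩ = corner i (j + 1) - corner i j := rfl

theorem edge_values (i : Fin 3) :
    (surface.edge ⟨i, (0 : ZMod 4)⟩ = ![sz i 0, 0] ∧
      surface.edge ⟨i, (1 : ZMod 4)⟩ = ![0, sz i 1]) ∧
    (surface.edge ⟨i, (2 : ZMod 4)⟩ = ![-sz i 0, 0] ∧
      surface.edge ⟨i, (3 : ZMod 4)⟩ = ![0, -sz i 1]) := by
  simp only [surface_edge, zmod4_add_one, corner_eq, rect_zero, rect_one, rect_two, rect_three]
  refine ⟨⟨?_, ?_⟩, ?_, ?_⟩ <;> funext k <;> fin_cases k <;> simp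

theorem vertex_values (i : Fin 3) :
    (surface.vertex i (0 : ZMod 4) = ![lo i 0, lo i 1] ∧
      surface.vertex i (1 : ZMod 4) = ![lo i 0 + sz i 0, lo i 1]) ∧
    (surface.vertex i (2 : ZMod 4) = ![lo i 0 + sz i 0, lo i 1 + sz i 1] ∧
      surface.vertex i (3 : ZMod 4) = ![lo i 0, lo i 1 + sz i 1]) := by
  change (corner i 0 = _ ∧ corner i 1 = _) ∧ (corner i 2 = _ ∧ corner i 3 = _)
  simp only [corner_eq, rect_zero, rect_one, rect_two, rect_three, and_self]

theorem pair_values (i : Fin 3) :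
    (surface.pair ⟨i, (0 : ZMod 4)⟩ = ⟨nb 1 i, (2 : ZMod 4)⟩ ∧
      surface.pair ⟨i, (1 : ZMod 4)⟩ = ⟨nb 0 i, (3 : ZMod 4)⟩) ∧
    (surface.pair ⟨i, (2 : ZMod 4)⟩ = ⟨nb 1 i, (0 : ZMod 4)⟩ ∧
      surface.pair ⟨i, (3 : ZMod 4)⟩ = ⟨nb 0 i, (1 : ZMod 4)⟩) := by
  fin_cases i <;> exact ⟨⟨rfl, rfl⟩, rfl, rfl⟩

/-- Rectangles are glued along opposite sides, and the offset along the side is preserved. -/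
theorem glue_iff (p q : surface.Pre) :
    surface.Glue p q ↔ ∃ c, GlueC c p.1 (off p) q.1 (off q) := by
  obtain ⟨i, p, hp⟩ := p
  obtain ⟨i', q, hq⟩ := q
  change Fin 3 at i i'
  have hp' := (mem_polygon i p).1 hp
  have hq' := (mem_polygon i' q).1 hq
  constructor
  · rintro ⟨⟨k, j⟩, t, h0, h1, h2, h3, h4, h5⟩
    change i = k at h2
    subst h2
    change p = _ at h3
    change q = _ at h5
    change i' = _ at h4
    revert h3 h4 h5
    revert j
    have e := edge_values i
    have v := vertex_values i
    have r := pair_values i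
    have e0 := edge_values (nb 0 i)
    have v0 := vertex_values (nb 0 i)
    have e1 := edge_values (nb 1 i)
    have v1 := vertex_values (nb 1 i)
    have s0 := sz_nb 0 i
    have s1 := sz_nb 1 i
    simp only [sub_zero, sub_self] at s0 s1
    refine forall_zmod4 ?_ ?_ ?_ ?_ <;> intro h3 h5 h4
    · rw [r.1.1] at h4 h5
      change i' = nb 1 i at h4
      subst h4
      rw [e.1.1, v.1.1] at h3
      rw [e1.2.1, v1.2.1] at h5
      refine ⟨1, rfl, Or.inl ⟨?_, ?_⟩, ?_⟩ <;> simp [off, h3, h5, s1]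
      ring
    · rw [r.1.2] at h4 h5
      change i' = nb 0 i at h4
      subst h4
      rw [e.1.2, v.1.2] at h3
      rw [e0.2.2, v0.2.2] at h5
      refine ⟨0, rfl, Or.inr ⟨?_, ?_⟩, ?_⟩ <;> simp [off, h3, h5, s0]
      ring
    · rw [r.2.1] at h4 h5
      change i' = nb 1 i at h4
      subst h4
      rw [e.2.1, v.2.1] at h3
      rw [e1.1.1, v1.1.1] at h5
      refine ⟨1, rfl, Or.inr ⟨?_, ?_⟩, ?_⟩ <;> simp [off, h3, h5, s1]
      ring
    · rw [r.2.2] at h4 h5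
      change i' = nb 0 i at h4
      subst h4
      rw [e.2.2, v.2.2] at h3
      rw [e0.1.2, v0.1.2] at h5
      refine ⟨0, rfl, Or.inl ⟨?_, ?_⟩, ?_⟩ <;> simp [off, h3, h5, s0]
      ring
  · rintro ⟨c, h4, h, h'⟩
    change i' = nb c i at h4
    subst h4
    have e := edge_values i
    have v := vertex_values i
    have r := pair_values i
    have e0 := edge_values (nb c i)
    have v0 := vertex_values (nb c i)
    have s := sz_nb c i
    have z0 := (sz_pos i 0).ne'
    have z1 := (sz_pos i 1).ne'
    change ((p - lo i) c = 0 ∧ (q - lo (nb c i)) c = sz (nb c i) c) ∨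
      ((p - lo i) c = sz i c ∧ (q - lo (nb c i)) c = 0) at h
    change (p - lo i) (1 - c) = (q - lo (nb c i)) (1 - c) at h'
    have b0 := hp' 0
    have b1 := hp' 1
    simp only [Pi.sub_apply] at h h' b0 b1
    have unit : ∀ {a b : ℝ}, 0 < b → 0 ≤ a ∧ a ≤ b → 0 ≤ a / b ∧ a / b ≤ 1 := fun hb h =>
      ⟨div_nonneg h.1 hb.le, (div_le_one hb).2 h.2⟩
    have t0 := unit (sz_pos i 0) b0
    have t1 := unit (sz_pos i 1) b1
    fin_cases c
    · simp only [Fin.zero_eta, sub_zero] at h h' s e0 v0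
      rcases h with ⟨h1, h2⟩ | ⟨h1, h2⟩
      · refine ⟨⟨i, (3 : ZMod 4)⟩, 1 - (p 1 - lo i 1) / sz i 1, by linarith, by linarith, rfl,
          ?_, ?_, ?_⟩
        · change p = _
          rw [e.2.2, v.2.2]
          funext k; fin_cases k <;> simp [z1, sub_mul] <;> linarith
        · rw [r.2.2]; rfl
        · change q = _
          rw [r.2.2, e0.1.2, v0.1.2]
          funext k; fin_cases k <;> simp [s, z1] <;> linarith
      · refine ⟨⟨i, (1 : ZMod 4)⟩, (p 1 - lo i 1) / sz i 1, by linarith, by linarith, rfl,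
          ?_, ?_, ?_⟩
        · change p = _
          rw [e.1.2, v.1.2]
          funext k; fin_cases k <;> simp [z1] <;> linarith
        · rw [r.1.2]; rfl
        · change q = _
          rw [r.1.2, e0.2.2, v0.2.2]
          funext k; fin_cases k <;> simp [s, z1, sub_mul] <;> linarith
    · simp only [Fin.mk_one, sub_self] at h h' s e0 v0
      rcases h with ⟨h1, h2⟩ | ⟨h1, h2⟩
      · refine ⟨⟨i, (0 : ZMod 4)⟩, (p 0 - lo i 0) / sz i 0, by linarith, by linarith, rfl,
          ?_, ?_, ?_⟩
        · change p = _
          rw [e.1.1, v.1.1]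
          funext k; fin_cases k <;> simp [z0] <;> linarith
        · rw [r.1.1]; rfl
        · change q = _
          rw [r.1.1, e0.2.1, v0.2.1]
          funext k; fin_cases k <;> simp [s, z0, sub_mul] <;> linarith
      · refine ⟨⟨i, (2 : ZMod 4)⟩, 1 - (p 0 - lo i 0) / sz i 0, by linarith, by linarith, rfl,
          ?_, ?_, ?_⟩
        · change p = _
          rw [e.2.1, v.2.1]
          funext k; fin_cases k <;> simp [z0, sub_mul] <;> linarith
        · rw [r.2.1]; rfl
        · change q = _
          rw [r.2.1, e0.1.1, v0.1.1]
          funext k; fin_cases k <;> simp [s, z0] <;> linarith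

/-! ### Points of the surface -/

/-- The underlying space of the surface `ℒ`. -/
abbrev K : Type := surface.Carrier

/-- Truncation of an offset to rectangle `i`. -/
noncomputable def clamp (i : Fin 3) (u : Plane) : Plane := fun c => max 0 (min (sz i c) (u c))

theorem inBox_clamp (i : Fin 3) (u : Plane) : InBox i (clamp i u) := fun c =>
  ⟨le_max_left _ _, max_le (sz_pos i c).le (min_le_left _ _)⟩

theorem clamp_apply {i : Fin 3} {u : Plane} {c : Fin 2} (h : 0 ≤ u c ∧ u c ≤ sz i c) :
    clamp i u c = u c := by
  rw [clamp, min_eq_right h.2, max_eq_right h.1]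

theorem clamp_eq {i : Fin 3} {u : Plane} (h : InBox i u) : clamp i u = u :=
  funext fun c => clamp_apply (h c)

theorem continuous_clamp (i : Fin 3) : Continuous (clamp i) := by
  unfold clamp
  fun_prop

/-- The point of the disjoint union of the rectangles with (truncated) offset `u` in rectangle
`i`. -/
noncomputable def pre (i : Fin 3) (u : Plane) : surface.Pre :=
  ⟨i, ⟨lo i + clamp i u, (mem_polygon _ _).2 (by
    rw [add_sub_cancel_left]; exact inBox_clamp i u)⟩⟩

theorem off_pre (i : Fin 3) (u : Plane) : off (pre i u) = clamp i u :=
  add_sub_cancel_left (lo i) (clamp i u)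

theorem pre_off (p : surface.Pre) : pre p.1 (off p) = p := by
  obtain ⟨i, p, hp⟩ := p
  refine Sigma.ext rfl (heq_of_eq (Subtype.ext ?_))
  change lo i + clamp i (p - lo i) = p
  rw [clamp_eq ((mem_polygon i p).1 hp), add_sub_cancel]

/-- The point of the surface with (truncated) offset `u` in rectangle `i`. -/
noncomputable def pt (i : Fin 3) (u : Plane) : K := Quot.mk _ (pre i u)

theorem continuous_pt (i : Fin 3) : Continuous (pt i) := by
  refine continuous_quot_mk.comp ((continuous_sigmaMk (σ := fun i => surface.polygon i)).comp ?_)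
  exact (continuous_const.add (continuous_clamp i)).subtype_mk _

theorem exists_pt (X : K) : ∃ i u, InBox i u ∧ pt i u = X := by
  obtain ⟨p, rfl⟩ := Quot.exists_rep X
  exact ⟨p.1, off p, inBox_off p, congrArg (Quot.mk _) (pre_off p)⟩

/-- The offset with coordinate `s` in direction `c` and coordinate `t` in the other direction. -/
def mkv (c : Fin 2) (s t : ℝ) : Plane := fun k => if k = c then s else t

@[simp] theorem mkv_self (c : Fin 2) (s t : ℝ) : mkv c s t c = s := if_pos rfl

@[simp] theorem mkv_other (c : Fin 2) (s t : ℝ) : mkv c s t (1 - c) = t := if_neg (one_sub_ne c)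

theorem mkv_eta (c : Fin 2) (u : Plane) : mkv c (u c) (u (1 - c)) = u := by
  funext k
  rcases eq_or_eq_one_sub c k with rfl | rfl <;> simp

theorem mkv_swap (c : Fin 2) (s t : ℝ) : mkv (1 - c) s t = mkv c t s := by
  funext k
  rcases eq_or_eq_one_sub c k with rfl | rfl
  · have := mkv_other (1 - k) s t
    rw [one_sub_one_sub] at this
    simp [this]
  · simp

theorem inBox_mkv {c : Fin 2} {i : Fin 3} {s t : ℝ} (hs : 0 ≤ s ∧ s ≤ sz i c)
    (ht : 0 ≤ t ∧ t ≤ sz i (1 - c)) : InBox i (mkv c s t) := by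
  intro k
  rcases eq_or_eq_one_sub c k with rfl | rfl <;> simpa

theorem continuous_mkv (c : Fin 2) : Continuous fun z : ℝ × ℝ => mkv c z.1 z.2 := by
  refine continuous_pi fun k => ?_
  rcases eq_or_eq_one_sub c k with rfl | rfl
  · simpa using continuous_fst
  · simpa using continuous_snd

theorem clamp_mkv (i : Fin 3) (c : Fin 2) (s t : ℝ) :
    clamp i (mkv c s t) = mkv c (max 0 (min (sz i c) s)) (max 0 (min (sz i (1 - c)) t)) := by
  funext k
  rcases eq_or_eq_one_sub c k with rfl | rfl <;> simp [clamp]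

/-- The right side of a rectangle is the left side of its neighbour. -/
theorem pt_cross (c : Fin 2) (i : Fin 3) (t : ℝ) :
    pt i (mkv c (sz i c) t) = pt (nb c i) (mkv c 0 t) := by
  refine Quot.sound ((glue_iff _ _).2 ⟨c, ?_⟩)
  rw [off_pre, off_pre, clamp_mkv, clamp_mkv]
  refine ⟨rfl, Or.inr ⟨?_, ?_⟩, ?_⟩
  · rw [mkv_self, min_self, max_eq_right (sz_pos i c).le]
    rfl
  · rw [mkv_self, min_eq_right (sz_pos _ c).le, max_self]
  · rw [mkv_other, mkv_other, sz_nb]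

/-! ### Functions on the surface -/

/-- Functions on the surface are families of functions on the rectangles that respect the
identifications. -/
noncomputable def lift {β : Type*} (F : Fin 3 → Plane → β)
    (hF : ∀ c i u i' u', InBox i u → InBox i' u' → GlueC c i u i' u' → F i u = F i' u') :
    K → β :=
  Quot.lift (fun p => F p.1 (off p)) fun p q h => by
    obtain ⟨c, h⟩ := (glue_iff p q).1 h
    exact hF c _ _ _ _ (inBox_off p) (inBox_off q) h

theorem lift_pt {β : Type*} {F : Fin 3 → Plane → β} {hF} {i : Fin 3} {u : Plane}
    (hu : InBox i u) : lift F hF (pt i u) = F i u := by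
  change F i (off (pre i u)) = F i u
  rw [off_pre, clamp_eq hu]

theorem continuous_lift {β : Type*} [TopologicalSpace β] {F : Fin 3 → Plane → β} {hF}
    (h : ∀ i, Continuous (F i)) : Continuous (lift F hF) := by
  refine continuous_quot_lift _ ?_
  exact continuous_sigma fun i => (h i).comp (continuous_subtype_val.sub continuous_const)

/-! ### The fibres of the projection to the surface -/

/-- The corners of the rectangles. -/
def IsCorner (i : Fin 3) (u : Plane) : Prop := ∀ c, u c = 0 ∨ u c = sz i c

theorem GlueC.isCorner {c : Fin 2} {i i' : Fin 3} {u u' : Plane} (h : GlueC c i u i' u')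
    (hu : IsCorner i u) : IsCorner i' u' := by
  obtain ⟨rfl, h, h'⟩ := h
  intro k
  rcases eq_or_eq_one_sub c k with rfl | rfl
  · exact h.elim (fun h => Or.inr h.2) fun h => Or.inl h.2
  · rw [← h', sz_nb]
    exact hu _

/-- A point on a side of a rectangle that is not a corner is identified with one other point
only. -/
theorem GlueC.unique {c c₁ : Fin 2} {i i' i₁ : Fin 3} {u u' u₁ : Plane} (h : GlueC c i u i' u')
    (h₁ : GlueC c₁ i u i₁ u₁) (hu : ¬ IsCorner i u) : i' = i₁ ∧ u' = u₁ := by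
  have hc : c₁ = c := by
    by_contra hne
    apply hu
    intro k
    have key : ∀ c c₁ k : Fin 2, c₁ ≠ c → k = c ∨ k = c₁ := by decide
    have hk := key c c₁ k hne
    rcases hk with rfl | rfl
    · exact h.2.1.imp And.left And.left
    · exact h₁.2.1.imp And.left And.left
  subst hc
  obtain ⟨rfl, h, h'⟩ := h
  obtain ⟨rfl, h₁, h₁'⟩ := h₁
  refine ⟨rfl, ?_⟩
  funext k
  have := sz_pos i c₁
  rcases eq_or_eq_one_sub c₁ k with rfl | rfl
  · rcases h with h | h <;> rcases h₁ with h₁ | h₁ <;> linarith [h.1, h.2, h₁.1, h₁.2]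
  · rw [← h', h₁']

/-- An equivalence relation that contains the elementary identifications: all corners are
equivalent, and any other point is equivalent only to itself and to the points to which it is
glued. -/
def Rel (i : Fin 3) (u : Plane) (i' : Fin 3) (u' : Plane) : Prop :=
  (IsCorner i u ∧ IsCorner i' u') ∨ (¬ IsCorner i u ∧ ¬ IsCorner i' u' ∧
    ((i = i' ∧ u = u') ∨ ∃ c, GlueC c i u i' u'))

theorem Rel.refl (i : Fin 3) (u : Plane) : Rel i u i u := by
  by_cases h : IsCorner i u
  · exact Or.inl ⟨h, h⟩
  · exact Or.inr ⟨h, h, Or.inl ⟨rfl, rfl⟩⟩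

theorem Rel.symm {i i' : Fin 3} {u u' : Plane} (h : Rel i u i' u') : Rel i' u' i u := by
  rcases h with h | ⟨h, h', ⟨rfl, rfl⟩ | ⟨c, hc⟩⟩
  · exact Or.inl h.symm
  · exact Rel.refl _ _
  · exact Or.inr ⟨h', h, Or.inr ⟨c, hc.symm⟩⟩

theorem Rel.trans {i i' i₁ : Fin 3} {u u' u₁ : Plane} (h : Rel i u i' u')
    (h₁ : Rel i' u' i₁ u₁) : Rel i u i₁ u₁ := by
  rcases h with h | ⟨h, h', hc⟩
  · rcases h₁ with h₁ | ⟨h₁, -⟩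
    · exact Or.inl ⟨h.1, h₁.2⟩
    · exact absurd h.2 h₁
  · rcases h₁ with h₁ | ⟨-, h₁, hc₁⟩
    · exact absurd h₁.1 h'
    · refine Or.inr ⟨h, h₁, ?_⟩
      rcases hc with ⟨rfl, rfl⟩ | ⟨c, hc⟩
      · exact hc₁
      · rcases hc₁ with ⟨rfl, rfl⟩ | ⟨c₁, hc₁⟩
        · exact Or.inr ⟨c, hc⟩
        · exact Or.inl (hc.symm.unique hc₁ h')

theorem rel_of_mk_eq {p q : surface.Pre}
    (h : (Quot.mk surface.Glue p) = Quot.mk surface.Glue q) :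
    Rel p.1 (off p) q.1 (off q) := by
  have h' := Quot.eqvGen_exact h
  clear h
  induction h' with
  | rel p q h =>
    obtain ⟨c, h⟩ := (glue_iff p q).1 h
    by_cases hc : IsCorner p.1 (off p)
    · exact Or.inl ⟨hc, h.isCorner hc⟩
    · exact Or.inr ⟨hc, fun h' => hc (h.symm.isCorner h'), Or.inr ⟨c, h⟩⟩
  | refl p => exact Rel.refl _ _
  | symm p q _ ih => exact ih.symm
  | trans p q r _ _ ih ih' => exact ih.trans ih'

theorem rel_of_pt_eq {i i' : Fin 3} {u u' : Plane} (hu : InBox i u) (hu' : InBox i' u')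
    (h : pt i u = pt i' u') : Rel i u i' u' := by
  have := rel_of_mk_eq h
  rw [off_pre, off_pre, clamp_eq hu, clamp_eq hu'] at this
  exact this

/-- Every point of the surface comes from finitely many points of the rectangles. -/
theorem finite_fibre (X : K) : {z : Fin 3 × Plane | InBox z.1 z.2 ∧ pt z.1 z.2 = X}.Finite := by
  obtain ⟨i, u, hu, rfl⟩ := exists_pt X
  have hcorner : {z : Fin 3 × Plane | IsCorner z.1 z.2}.Finite := by
    refine (Set.finite_range fun z : Fin 3 × (Fin 2 → Bool) =>
      (⟨z.1, fun c => if z.2 c then 0 else sz z.1 c⟩ : Fin 3 × Plane)).subset ?_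
    classical
    rintro ⟨i, u⟩ h
    refine ⟨⟨i, fun c => decide (u c = 0)⟩, Prod.ext rfl ?_⟩
    funext c
    by_cases hc : u c = 0
    · simp [hc]
    · simpa [hc] using ((h c).resolve_left hc).symm
  by_cases h : IsCorner i u
  · refine hcorner.subset ?_
    rintro ⟨i', u'⟩ ⟨hu', h'⟩
    rcases rel_of_pt_eq hu hu' h'.symm with h1 | h1
    · exact h1.2
    · exact absurd h h1.1
  · have hglue : {z : Fin 3 × Plane | ∃ c, GlueC c i u z.1 z.2}.Subsingleton := by
      rintro ⟨i₁, u₁⟩ ⟨c₁, h₁⟩ ⟨i₂, u₂⟩ ⟨c₂, h₂⟩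
      exact Prod.ext_iff.2 (h₁.unique h₂ h)
    refine ((Set.finite_singleton (i, u)).union hglue.finite).subset ?_
    rintro ⟨i', u'⟩ ⟨hu', h'⟩
    rcases rel_of_pt_eq hu hu' h'.symm with h1 | ⟨-, -, ⟨rfl, rfl⟩ | h1⟩
    · exact absurd h1.1 h
    · exact Or.inl rfl
    · exact Or.inr h1

/-! ### Segments -/

theorem disp_iff (X : K) (v : Plane) (Y : K) :
    surface.Disp X v Y ↔
      ∃ i u u', InBox i u ∧ InBox i u' ∧ pt i u = X ∧ pt i u' = Y ∧ u' - u = v := by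
  constructor
  · rintro ⟨i, p, q, rfl, rfl, rfl⟩
    refine ⟨i, off ⟨i, p⟩, off ⟨i, q⟩, inBox_off ⟨i, p⟩, inBox_off ⟨i, q⟩,
      congrArg (Quot.mk _) (pre_off ⟨i, p⟩), congrArg (Quot.mk _) (pre_off ⟨i, q⟩), ?_⟩
    exact sub_sub_sub_cancel_right _ _ _
  · rintro ⟨i, u, u', hu, hu', rfl, rfl, rfl⟩
    refine ⟨i, (pre i u).2, (pre i u').2, rfl, rfl, ?_⟩
    change (lo i + clamp i u') - (lo i + clamp i u) = _
    rw [clamp_eq hu, clamp_eq hu', add_sub_add_left_eq_sub]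

theorem disp_symm {X Y : K} {v : Plane} (h : surface.Disp X v Y) : surface.Disp Y (-v) X := by
  obtain ⟨i, p, q, hp, hq, rfl⟩ := h
  exact ⟨i, q, p, hq, hp, (neg_sub _ _).symm⟩

open Filter Topology

/-! ### Cylinders -/

/-- The circumference of the cylinder in direction `c` through rectangle `i`, or twice the
circumference if the cylinder consists of that rectangle alone. -/
noncomputable def per (c : Fin 2) (i : Fin 3) : ℝ := sz i c + sz (nb c i) c

theorem per_pos (c : Fin 2) (i : Fin 3) : 0 < per c i := add_pos (sz_pos _ _) (sz_pos _ _)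

theorem per_nb (c : Fin 2) (i : Fin 3) : per c (nb c i) = per c i := by
  rw [per, per, nb_nb, add_comm]

/-- Rectangle `i` followed by its neighbour in direction `c`. -/
noncomputable def piece (c : Fin 2) (i : Fin 3) (r t : ℝ) : K :=
  if r ≤ sz i c then pt i (mkv c r t) else pt (nb c i) (mkv c (r - sz i c) t)

theorem piece_of_le {c : Fin 2} {i : Fin 3} {r t : ℝ} (h : sz i c ≤ r) :
    piece c i r t = pt (nb c i) (mkv c (r - sz i c) t) := by
  rw [piece]
  split_ifs with h'
  · obtain rfl := le_antisymm h' h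
    rw [sub_self, pt_cross]
  · rfl

theorem piece_per (c : Fin 2) (i : Fin 3) (t : ℝ) : piece c i (per c i) t = piece c i 0 t := by
  rw [piece_of_le (by have := sz_pos (nb c i) c; unfold per; linarith), per, add_sub_cancel_left,
    pt_cross, nb_nb, piece, if_pos (sz_pos i c).le]

theorem continuous_piece (c : Fin 2) (i : Fin 3) :
    Continuous fun z : ℝ × ℝ => piece c i z.1 z.2 := by
  have h1 : Continuous fun z : ℝ × ℝ => pt i (mkv c z.1 z.2) :=
    (continuous_pt i).comp (continuous_mkv c)
  have h2 : Continuous fun z : ℝ × ℝ => pt (nb c i) (mkv c (z.1 - sz i c) z.2) :=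
    ((continuous_pt (nb c i)).comp (continuous_mkv c)).comp
      ((continuous_fst.sub continuous_const).prodMk continuous_snd)
  refine Continuous.if_le h1 h2 continuous_fst continuous_const ?_
  rintro ⟨r, t⟩ (rfl : r = _)
  rw [sub_self, pt_cross]

/-- The unrolled cylinder in direction `c` through rectangle `i`: the point that is reached by
starting at height `t` on the lower side (in direction `c`) of rectangle `i` and going the distance
`s` in direction `c`. -/
noncomputable def cyl (c : Fin 2) (i : Fin 3) (s t : ℝ) : K :=
  piece c i (per c i * Int.fract (s / per c i)) t

theorem continuous_cyl (c : Fin 2) (i : Fin 3) :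
    Continuous fun z : ℝ × ℝ => cyl c i z.1 z.2 := by
  have h : Continuous (Function.uncurry fun (z : ℝ × ℝ) (r : ℝ) => piece c i (per c i * r) z.2) :=
    (continuous_piece c i).comp
      ((continuous_const.mul continuous_snd).prodMk (continuous_snd.comp continuous_fst))
  exact ContinuousOn.comp_fract (s := fun z : ℝ × ℝ => z.1 / per c i) h.continuousOn
    (continuous_fst.div_const _) fun z => by simp only [mul_zero, mul_one, piece_per]

theorem cyl_periodic (c : Fin 2) (i : Fin 3) (t : ℝ) :
    Function.Periodic (fun s => cyl c i s t) (per c i) := by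
  intro s
  have h := (per_pos c i).ne'
  simp only [cyl]
  rw [add_div, div_self h, Int.fract_add_one]

theorem cyl_eq_piece {c : Fin 2} {i : Fin 3} {s t : ℝ} (h : 0 ≤ s) (h' : s < per c i) :
    cyl c i s t = piece c i s t := by
  have hp := per_pos c i
  rw [cyl, Int.fract_eq_self.2 ⟨div_nonneg h hp.le, (div_lt_one hp).2 h'⟩,
    mul_div_cancel₀ _ hp.ne']

theorem cyl_of_mem {c : Fin 2} {i : Fin 3} {s t : ℝ} (h : 0 ≤ s) (h' : s ≤ sz i c) :
    cyl c i s t = pt i (mkv c s t) := by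
  rw [cyl_eq_piece h (by have := sz_pos (nb c i) c; unfold per; linarith), piece, if_pos h']

/-- Walking along the whole of rectangle `i` leads to its neighbour. -/
theorem cyl_add (c : Fin 2) (i : Fin 3) (s t : ℝ) :
    cyl c i (s + sz i c) t = cyl c (nb c i) s t := by
  have hper : Function.Periodic (fun s => cyl c i (s + sz i c) t = cyl c (nb c i) s t)
      (per c i) := by
    intro s
    have h1 := cyl_periodic c i t (s + sz i c)
    have h2 := cyl_periodic c (nb c i) t s
    rw [per_nb] at h2
    simp only at h1 h2 ⊢
    rw [add_right_comm, h1, h2]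
  obtain ⟨r, ⟨h0, h1⟩, h⟩ := hper.exists_mem_Ico₀ (per_pos c i) s
  refine h.mpr ?_
  have hi := sz_pos i c
  have hn := sz_pos (nb c i) c
  rcases lt_or_ge r (sz (nb c i) c) with h2 | h2
  · rw [cyl_of_mem h0 h2.le, cyl_eq_piece (by linarith) (by unfold per; linarith),
      piece_of_le (by linarith), add_sub_cancel_right]
  · have h3 := (cyl_periodic c i t).sub_eq (r + sz i c)
    rw [← h3, cyl_eq_piece h0 (by rwa [per_nb]), piece_of_le h2, nb_nb, per,
      add_comm (sz i c), add_sub_add_right_eq_sub]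
    unfold per at h1
    exact cyl_of_mem (by linarith) (by linarith)

/-- A position on the unrolled cylinder can be normalized to lie in one of its rectangles. -/
theorem exists_cyl_eq (c : Fin 2) (i : Fin 3) (s : ℝ) :
    ∃ i' r, 0 ≤ r ∧ r < sz i' c ∧ sz i' (1 - c) = sz i (1 - c) ∧
      ∀ s' t, cyl c i (s + s') t = cyl c i' (r + s') t := by
  have hp := per_pos c i
  set r := per c i * Int.fract (s / per c i) with hr
  have hs : s = r + ⌊s / per c i⌋ * per c i := by
    rw [hr, Int.fract]
    field_simp
    ring
  have h0 : 0 ≤ r := mul_nonneg hp.le (Int.fract_nonneg _)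
  have h1 : r < per c i := by
    simpa using mul_lt_mul_of_pos_left (Int.fract_lt_one (s / per c i)) hp
  have h : ∀ s' t, cyl c i (s + s') t = cyl c i (r + s') t := by
    intro s' t
    have := (cyl_periodic c i t).int_mul ⌊s / per c i⌋ (r + s')
    rw [← this]
    congr 1
    linarith
  rcases lt_or_ge r (sz i c) with h2 | h2
  · exact ⟨i, r, h0, h2, rfl, h⟩
  · refine ⟨nb c i, r - sz i c, by linarith, by unfold per at h1; linarith, sz_nb c i, ?_⟩
    intro s' t
    rw [h, ← cyl_add]
    congr 1
    ring

/-- Nearby positions on the unrolled cylinder lie in a common rectangle, at every height. -/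
theorem exists_common_rectangle (c : Fin 2) (i : Fin 3) (s : ℝ) :
    ∃ ε > 0, ∀ δ, |δ| < ε → ∃ i' r, (0 ≤ r ∧ r ≤ sz i' c) ∧ (0 ≤ r + δ ∧ r + δ ≤ sz i' c) ∧
      sz i' (1 - c) = sz i (1 - c) ∧
      ∀ t, cyl c i s t = pt i' (mkv c r t) ∧ cyl c i (s + δ) t = pt i' (mkv c (r + δ) t) := by
  obtain ⟨i', r, h0, h1, hsz, h⟩ := exists_cyl_eq c i s
  have hs : ∀ t, cyl c i s t = pt i' (mkv c r t) := by
    intro t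
    rw [← cyl_of_mem h0 h1.le]
    simpa using h 0 t
  rcases h0.eq_or_lt with rfl | h0
  · refine ⟨1, one_pos, fun δ hδ => ?_⟩
    obtain ⟨h2, h3⟩ := abs_lt.1 hδ
    rcases le_or_gt 0 δ with h4 | h4
    · have h5 : δ ≤ sz i' c := h3.le.trans (one_le_sz _ _)
      refine ⟨i', 0, ⟨le_rfl, h1.le⟩, ?_, hsz, fun t => ⟨hs t, ?_⟩⟩
      · rw [zero_add]
        exact ⟨h4, h5⟩
      · rw [h, cyl_of_mem] <;> rwa [zero_add]
    · have h5 := one_le_sz (nb c i') c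
      refine ⟨nb c i', sz (nb c i') c, ⟨by linarith, le_rfl⟩, ⟨by linarith, by linarith⟩,
        by rw [sz_nb, hsz], fun t => ⟨?_, ?_⟩⟩
      · rw [hs, pt_cross, nb_nb]
      · have h6 := cyl_add c (nb c i') δ t
        rw [nb_nb] at h6
        rw [h, zero_add, ← h6, add_comm δ, cyl_of_mem (by linarith) (by linarith)]
  · refine ⟨min r (sz i' c - r), lt_min h0 (sub_pos.2 h1), fun δ hδ => ?_⟩
    obtain ⟨h2, h3⟩ := abs_lt.1 hδ
    have h4 := min_le_left r (sz i' c - r)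
    have h5 := min_le_right r (sz i' c - r)
    refine ⟨i', r, ⟨h0.le, h1.le⟩, ⟨by linarith, by linarith⟩, hsz, fun t => ⟨hs t, ?_⟩⟩
    rw [h, cyl_of_mem (by linarith) (by linarith)]

/-! ### Cylinder shears -/

/-- The amount of shear that fixes the boundaries of all cylinders in direction `c` pointwise. -/
noncomputable def twist (c : Fin 2) : ℝ := ![2 + √2, 1] c

theorem cyl_twist (c : Fin 2) (i : Fin 3) (t : ℝ) :
    Function.Periodic (fun s => cyl c i s t) (twist c * sz i (1 - c)) := by
  have h2 := sqrt_two_mul_self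
  have hp : i = 1 ∧ c = 1 ∨ twist c * sz i (1 - c) = per c i := by
    fin_cases i <;> fin_cases c <;> simp [twist, sz, per, nb] <;> linarith
  rcases hp with ⟨rfl, rfl⟩ | hp
  · intro s
    have := cyl_add 1 1 s t
    simpa [sz, nb, twist] using this
  · rw [hp]
    exact cyl_periodic c i t

/-- The linear map that shears `n` times in direction `c`. -/
noncomputable def shear (c : Fin 2) (n : ℤ) (v : Plane) : Plane :=
  mkv c (v c + n * (twist c * v (1 - c))) (v (1 - c))

theorem shear_neg_shear (c : Fin 2) (n : ℤ) (v : Plane) : shear c (-n) (shear c n v) = v := by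
  conv_rhs => rw [← mkv_eta c v]
  simp [shear]

theorem continuous_shear (c : Fin 2) (n : ℤ) : Continuous (shear c n) := by
  refine (continuous_mkv c).comp (f := fun v : Plane =>
    (v c + n * (twist c * v (1 - c)), v (1 - c))) ?_
  fun_prop

/-- The affine map of the surface that shears all cylinders in direction `c`. -/
noncomputable def shearMap (c : Fin 2) (n : ℤ) : K → K :=
  lift (fun i u => cyl c i (u c + n * (twist c * u (1 - c))) (u (1 - c))) (by
    -- by symmetry only the crossing of a right or an upper side has to be considered
    have key : ∀ k i u i' u', InBox i u → GlueC k i u i' u' → u k = sz i k → u' k = 0 →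
        cyl c i (u c + n * (twist c * u (1 - c))) (u (1 - c)) =
          cyl c i' (u' c + n * (twist c * u' (1 - c))) (u' (1 - c)) := by
      rintro k i u i' u' hu ⟨rfl, -, h'⟩ h0 h1
      rcases eq_or_eq_one_sub c k with rfl | rfl
      · rw [h0, h1, h', add_comm, cyl_add, zero_add]
      · rw [one_sub_one_sub] at h'
        have h2 := (cyl_twist c i (sz i (1 - c))).int_mul n (u c)
        have h3 := pt_cross (1 - c) i (u c)
        rw [mkv_swap, mkv_swap] at h3
        have h4 : sz (nb (1 - c) i) c = sz i c := by
          have := sz_nb (1 - c) i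
          rwa [one_sub_one_sub] at this
        rw [h0, h1, h2, cyl_of_mem (hu c).1 (hu c).2, h3, mul_zero, mul_zero, add_zero, ← h',
          cyl_of_mem (hu c).1 (by rw [h4]; exact (hu c).2)]
    intro k i u i' u' hu hu' h
    rcases h.2.1 with ⟨h0, h1⟩ | ⟨h0, h1⟩
    · exact (key k i' u' i u hu' h.symm h1 h0).symm
    · exact key k i u i' u' hu h h0 h1)

theorem shearMap_pt (c : Fin 2) (n : ℤ) {i : Fin 3} {u : Plane} (hu : InBox i u) :
    shearMap c n (pt i u) = cyl c i (u c + n * (twist c * u (1 - c))) (u (1 - c)) :=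
  lift_pt hu

theorem shearMap_cyl (c : Fin 2) (n : ℤ) {i : Fin 3} {s t : ℝ}
    (ht : 0 ≤ t ∧ t ≤ sz i (1 - c)) :
    shearMap c n (cyl c i s t) = cyl c i (s + n * (twist c * t)) t := by
  obtain ⟨i', r, h0, h1, hsz, h⟩ := exists_cyl_eq c i s
  have h2 := h 0 t
  rw [add_zero, add_zero, cyl_of_mem h0 h1.le] at h2
  rw [h2, h, shearMap_pt c n (inBox_mkv ⟨h0, h1.le⟩ (by rwa [hsz]))]
  simp

theorem continuous_shearMap (c : Fin 2) (n : ℤ) : Continuous (shearMap c n) := by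
  refine continuous_lift fun i => ?_
  refine (continuous_cyl c i).comp (f := fun u : Plane =>
    (u c + n * (twist c * u (1 - c)), u (1 - c))) ?_
  fun_prop

theorem shearMap_neg_shearMap (c : Fin 2) (n : ℤ) (X : K) :
    shearMap c (-n) (shearMap c n X) = X := by
  obtain ⟨i, u, hu, rfl⟩ := exists_pt X
  rw [shearMap_pt c n hu, shearMap_cyl c (-n) (hu _)]
  push_cast
  rw [neg_mul, add_neg_cancel_right, cyl_of_mem (hu _).1 (hu _).2, mkv_eta]

/-- The shear as a homeomorphism of the surface. -/
noncomputable def shearHomeo (c : Fin 2) (n : ℤ) : K ≃ₜ K where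
  toFun := shearMap c n
  invFun := shearMap c (-n)
  left_inv := shearMap_neg_shearMap c n
  right_inv X := by simpa using shearMap_neg_shearMap c (-n) X
  continuous_toFun := continuous_shearMap c n
  continuous_invFun := continuous_shearMap c (-n)

/-- The shear of the surface acts on short segments as the linear shear. -/
theorem disp_shearMap (c : Fin 2) (n : ℤ) (X : K) :
    ∀ᶠ v in 𝓝 (0 : Plane), ∀ Y, surface.Disp X v Y →
      surface.Disp (shearMap c n X) (shear c n v) (shearMap c n Y) := by
  have key : ∀ z ∈ {z : Fin 3 × Plane | InBox z.1 z.2 ∧ pt z.1 z.2 = X},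
      ∀ᶠ v in 𝓝 (0 : Plane), InBox z.1 (z.2 + v) →
        surface.Disp (shearMap c n (pt z.1 z.2)) (shear c n v)
          (shearMap c n (pt z.1 (z.2 + v))) := by
    rintro ⟨i, u⟩ ⟨hu, -⟩
    obtain ⟨ε, hε, h⟩ := exists_common_rectangle c i (u c + n * (twist c * u (1 - c)))
    have hc : Continuous fun v : Plane => |v c + n * (twist c * v (1 - c))| := by fun_prop
    have hev := hc.continuousAt.eventually_lt (x₀ := (0 : Plane)) continuousAt_const
      (show _ < ε by simpa using hε)
    filter_upwards [hev] with v hv huv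
    obtain ⟨i', r, hr, hr', hsz, h⟩ := h _ hv
    rw [shearMap_pt c n hu, shearMap_pt c n huv]
    refine (disp_iff _ _ _).2 ⟨i', mkv c r (u (1 - c)),
      mkv c (r + (v c + n * (twist c * v (1 - c)))) ((u + v) (1 - c)),
      inBox_mkv hr (by rw [hsz]; exact hu _), inBox_mkv hr' (by rw [hsz]; exact huv _),
      (h _).1.symm, ?_, ?_⟩
    · rw [← (h _).2]
      congr 1
      simp only [Pi.add_apply]
      ring
    · funext k
      rcases eq_or_eq_one_sub c k with rfl | rfl <;> simp [shear]
  filter_upwards [(eventually_all_finite (finite_fibre X)).2 key] with v hv Y hY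
  obtain ⟨i, u, u', hu, hu', rfl, rfl, rfl⟩ := (disp_iff _ _ _).1 hY
  have := hv (i, u) ⟨hu, rfl⟩
  simp only [add_sub_cancel] at this
  exact this hu'

/-! ### Affine homeomorphisms and the Veech group -/

theorem mem_veechGroup_iff (A : SL(2, ℝ)) : A ∈ veechGroup ↔ ∃ f : K ≃ₜ K, ∀ X,
    ∀ᶠ v in 𝓝 (0 : Plane), ∀ Y,
      surface.Disp X v Y ↔ surface.Disp (f X) (A.1.mulVec v) (f Y) := by
  have hA : Continuous fun v : Plane => A.1.mulVec v :=
    Continuous.matrix_mulVec continuous_const continuous_id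
  have hA' : Continuous fun v : Plane => (A⁻¹).1.mulVec v :=
    Continuous.matrix_mulVec continuous_const continuous_id
  have h0 : A.1.mulVec (0 : Plane) = 0 := Matrix.mulVec_zero _
  have h0' : (A⁻¹).1.mulVec (0 : Plane) = 0 := Matrix.mulVec_zero _
  have hL : A ∈ veechGroup ↔ (A • surface).Equivalent surface :=
    Iff.trans (b := A • L = L) Iff.rfl Quotient.eq
  rw [hL]
  constructor
  · rintro ⟨f, hf⟩
    refine ⟨(TranslationSurface.carrierHomeo A surface).trans f, fun X => ?_⟩
    obtain ⟨ε, hε, h⟩ := hf (TranslationSurface.carrierHomeo A surface X)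
    have hev := hA.norm.continuousAt.eventually_lt (x₀ := (0 : Plane)) continuousAt_const
      (show _ < ε by simpa [h0] using hε)
    filter_upwards [hev] with v hv Y
    rw [TranslationSurface.disp_carrierHomeo A]
    exact h _ _ hv
  · rintro ⟨f, hf⟩
    refine ⟨(TranslationSurface.carrierHomeo A surface).symm.trans f, fun X => ?_⟩
    have hev := (hA'.tendsto' 0 0 h0').eventually
      (hf ((TranslationSurface.carrierHomeo A surface).symm X))
    obtain ⟨ε, hε, h⟩ := Metric.eventually_nhds_iff.1 hev
    refine ⟨ε, hε, fun v Y hv => ?_⟩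
    have := h (by simpa using hv) ((TranslationSurface.carrierHomeo A surface).symm Y)
    rw [TranslationSurface.disp_carrierHomeo A, TranslationSurface.mulVec_inv_mulVec] at this
    simpa using this

theorem mem_veechGroup_of_shear {A : SL(2, ℝ)} {c : Fin 2} {n : ℤ}
    (hA : ∀ v, A.1.mulVec v = shear c n v) : A ∈ veechGroup := by
  refine (mem_veechGroup_iff A).2 ⟨shearHomeo c n, fun X => ?_⟩
  have h1 := disp_shearMap c n X
  have h0 : shear c n 0 = 0 := by rw [← hA]; exact Matrix.mulVec_zero _
  have h2 := ((continuous_shear c n).tendsto' 0 0 h0).eventually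
    (disp_shearMap c (-n) (shearMap c n X))
  filter_upwards [h1, h2] with v h1 h2 Y
  rw [hA]
  refine ⟨h1 Y, fun h => ?_⟩
  have := h2 _ h
  rw [shearMap_neg_shearMap, shear_neg_shear] at this
  rwa [show shearMap c (-n) (shearHomeo c n Y) = Y from shearMap_neg_shearMap c n Y] at this

/-! ### Heights in the cylinders -/

/-- The offset in coordinate direction `j`, i.e. the height above the lower boundary of the
cylinder transverse to that direction. -/
noncomputable def height (j : Fin 2) : K → ℝ :=
  lift (fun i u => if u j = sz i j then 0 else u j) (by
    rintro k i u i' u' - - ⟨rfl, h, h'⟩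
    rcases eq_or_eq_one_sub k j with rfl | rfl
    · rcases h with ⟨h0, h1⟩ | ⟨h0, h1⟩ <;> simp [h0, h1]
    · simp only [h', sz_nb])

theorem height_pt (j : Fin 2) {i : Fin 3} {u : Plane} (hu : InBox i u) :
    height j (pt i u) = if u j = sz i j then 0 else u j := lift_pt hu

/-- Below height `1` no boundary of a cylinder is met, as all cylinders have height at least
`1`. -/
theorem height_of_disp {j : Fin 2} {X Y : K} {v : Plane} (h : surface.Disp X v Y)
    (hv : 0 ≤ v j) (hX : height j X + v j < 1) : height j Y = height j X + v j := by
  obtain ⟨i, u, u', hu, hu', rfl, rfl, rfl⟩ := (disp_iff _ _ _).1 h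
  have h1 := one_le_sz i j
  have h2 := hu j
  have h3 := hu' j
  rw [height_pt j hu] at hX ⊢
  rw [height_pt j hu']
  simp only [Pi.sub_apply] at hv hX ⊢
  split_ifs at hX ⊢ with h4 h5 h5
  · linarith
  · linarith
  · exact absurd (le_antisymm h3.2 (by linarith)) h4
  · linarith

/-! ### The cone point -/

/-- The cone point of the surface. -/
noncomputable def conePoint : K := pt 0 0

theorem mkv_zero_zero (c : Fin 2) : mkv c 0 0 = 0 := by
  funext k
  rcases eq_or_eq_one_sub c k with rfl | rfl <;> simp

theorem mkv_zero_eq (s t : ℝ) : mkv 0 s t = mkv 1 t s := mkv_swap 1 s t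

/-- All corners of the rectangles are the same point of the surface. Only those that are needed are
listed. -/
theorem pt_corner_eq : pt 2 0 = conePoint ∧ pt 1 0 = conePoint ∧
    pt 1 (mkv 0 1 0) = conePoint ∧ pt 1 (mkv 1 1 0) = conePoint := by
  have h1 : pt 1 (mkv 0 1 0) = conePoint := by
    have := pt_cross 0 1 0
    rwa [mkv_zero_zero, show nb 0 1 = 0 from rfl, show sz 1 0 = 1 from rfl] at this
  have h2 : pt 1 (mkv 0 1 0) = pt 1 (mkv 0 1 1) := by
    have := pt_cross 1 1 1
    rw [show nb 1 1 = 1 from rfl, show sz 1 1 = 1 from rfl] at this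
    rw [mkv_zero_eq, mkv_zero_eq, ← this]
  have h3 : pt 1 (mkv 0 1 1) = pt 0 (mkv 0 0 1) := by
    have := pt_cross 0 1 1
    rwa [show nb 0 1 = 0 from rfl, show sz 1 0 = 1 from rfl] at this
  have h4 : pt 0 (mkv 0 0 1) = pt 2 0 := by
    have := pt_cross 1 0 0
    rwa [mkv_zero_zero, show nb 1 0 = 2 from rfl, show sz 0 1 = 1 from rfl,
      ← mkv_zero_eq] at this
  have h5 : pt 1 (mkv 1 1 0) = pt 1 0 := by
    have := pt_cross 1 1 0
    rwa [mkv_zero_zero, show nb 1 1 = 1 from rfl, show sz 1 1 = 1 from rfl] at this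
  have h6 : pt 0 (mkv 0 (sz 0 0) 1) = pt 1 (mkv 1 1 0) := by
    rw [pt_cross, show nb 0 0 = 1 from rfl, mkv_zero_eq]
  have h7 : pt 0 (mkv 0 (sz 0 0) 1) = pt 2 (mkv 0 (sz 2 0) 0) := by
    have := pt_cross 1 0 (sz 0 0)
    rwa [show nb 1 0 = 2 from rfl, show sz 0 1 = 1 from rfl, ← mkv_zero_eq,
      ← mkv_zero_eq] at this
  have h8 : pt 2 (mkv 0 (sz 2 0) 0) = pt 2 0 := by
    rw [pt_cross, mkv_zero_zero]; rfl
  have h9 : pt 2 0 = conePoint := by rw [← h4, ← h3, ← h2, h1]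
  exact ⟨h9, by rw [← h5, ← h6, h7, h8, h9], h1, by rw [← h6, h7, h8, h9]⟩

theorem pt_zero (i : Fin 3) : pt i 0 = conePoint := by
  fin_cases i
  · rfl
  · exact pt_corner_eq.2.1
  · exact pt_corner_eq.1

/-- An affine homeomorphism maps the cone point to a corner: in a generic direction three short
segments start at the cone point, but at most two can start elsewhere. -/
theorem height_map_conePoint {A : SL(2, ℝ)} {f : K ≃ₜ K}
    (hf : ∀ X, ∀ᶠ v in 𝓝 (0 : Plane), ∀ Y,
      surface.Disp X v Y ↔ surface.Disp (f X) (A.1.mulVec v) (f Y)) (j : Fin 2) :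
    height j (f conePoint) = 0 := by
  obtain ⟨i, u, hu, hX⟩ := exists_pt (f conePoint)
  by_cases hcorner : IsCorner i u
  · rw [← hX, height_pt j hu]
    rcases hcorner j with h | h <;> simp [h]
  exfalso
  -- a short diagonal vector
  have ht : Tendsto (fun r : ℝ => mkv 0 r r) (𝓝[>] 0) (𝓝 0) := by
    have : Continuous fun r : ℝ => mkv 0 r r :=
      (continuous_mkv 0).comp (continuous_id.prodMk continuous_id)
    exact (this.tendsto' 0 0 (mkv_zero_zero 0)).mono_left nhdsWithin_le_nhds
  obtain ⟨r, h, hr0, hr1⟩ := ((ht.eventually (hf conePoint)).and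
    (Ioo_mem_nhdsGT (one_pos : (0 : ℝ) < 1))).exists
  have hr : ∀ (k : Fin 3) (c : Fin 2), 0 < mkv 0 r r c ∧ mkv 0 r r c < sz k c := by
    intro k c
    have h1 := one_le_sz k c
    have h2 : mkv 0 r r c = r := by simp [mkv]
    rw [h2]
    exact ⟨hr0, by linarith⟩
  have hbox : ∀ k, InBox k (mkv 0 r r) := fun k c => ⟨(hr k c).1.le, (hr k c).2.le⟩
  have hinj : ∀ k l, pt k (mkv 0 r r) = pt l (mkv 0 r r) → k = l := by
    intro k l hkl
    rcases rel_of_pt_eq (hbox k) (hbox l) hkl with h | ⟨-, -, h | ⟨c, -, h, -⟩⟩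
    · rcases h.1 0 with h | h <;> linarith [hr k 0]
    · exact h.1
    · rcases h with h | h <;> linarith [hr k c]
  -- the three segments give three representatives of the image point
  have hrep : ∀ k, ∃ i' u' w, InBox i' u' ∧ pt i' u' = pt i u ∧ u' + A.1.mulVec (mkv 0 r r) = w ∧
      pt i' w = f (pt k (mkv 0 r r)) := by
    intro k
    have hd : surface.Disp conePoint (mkv 0 r r) (pt k (mkv 0 r r)) :=
      (disp_iff _ _ _).2 ⟨k, 0, mkv 0 r r, fun c => ⟨le_rfl, (sz_pos k c).le⟩, hbox k, pt_zero k,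
        rfl, sub_zero _⟩
    obtain ⟨i', u', w, hu', -, h1, h2, h3⟩ := (disp_iff _ _ _).1 ((h _).1 hd)
    exact ⟨i', u', w, hu', by rw [h1, hX], by rw [← h3, add_sub_cancel], h2⟩
  choose i' u' w hu' h1 h2 h3 using hrep
  have hsame : ∀ k l, i' k = i' l → u' k = u' l → k = l := by
    intro k l h4 h5
    apply hinj
    apply f.injective
    rw [← h3, ← h3, ← h2, ← h2, h4, h5]
  have hclass : ∀ k, (i = i' k ∧ u = u' k) ∨ ∃ c, GlueC c i u (i' k) (u' k) := fun k =>
    ((rel_of_pt_eq hu (hu' k) (h1 k).symm).resolve_left fun h => hcorner h.1).2.2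
  have hA : ∀ k l, (i = i' k ∧ u = u' k) → (i = i' l ∧ u = u' l) → k = l := fun k l hk hl =>
    hsame k l (hk.1.symm.trans hl.1) (hk.2.symm.trans hl.2)
  have hB : ∀ k l, (∃ c, GlueC c i u (i' k) (u' k)) → (∃ c, GlueC c i u (i' l) (u' l)) → k = l :=
    fun k l ⟨_, hk⟩ ⟨_, hl⟩ => hsame k l (hk.unique hl hcorner).1 (hk.unique hl hcorner).2
  have h01 : (0 : Fin 3) ≠ 1 := by decide
  have h02 : (0 : Fin 3) ≠ 2 := by decide
  have h12 : (1 : Fin 3) ≠ 2 := by decide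
  rcases hclass 0 with k0 | k0 <;> rcases hclass 1 with k1 | k1 <;> rcases hclass 2 with k2 | k2
  · exact h01 (hA _ _ k0 k1)
  · exact h01 (hA _ _ k0 k1)
  · exact h02 (hA _ _ k0 k2)
  · exact h12 (hB _ _ k1 k2)
  · exact h12 (hA _ _ k1 k2)
  · exact h02 (hB _ _ k0 k2)
  · exact h01 (hB _ _ k0 k1)
  · exact h01 (hB _ _ k0 k1)

/-! ### Images of saddle connections -/

/-- Induction along the unit interval: a property that propagates locally to the right, and to
the right end of short intervals, holds at the end. -/
theorem unitInterval_induction {P : ℝ → Prop} (h0 : P 0)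
    (h : ∀ τ, 0 ≤ τ → τ ≤ 1 → ∀ᶠ t in 𝓝 τ,
      (0 ≤ t → t ≤ τ → P t → P τ) ∧ (τ ≤ t → t ≤ 1 → P τ → P t)) : P 1 := by
  set S := {t | (0 ≤ t ∧ t ≤ 1) ∧ P t} with hS
  have hne : S.Nonempty := ⟨0, ⟨le_rfl, zero_le_one⟩, h0⟩
  have hbdd : BddAbove S := ⟨1, fun t ht => ht.1.2⟩
  have hs0 : 0 ≤ sSup S := le_csSup hbdd ⟨⟨le_rfl, zero_le_one⟩, h0⟩
  have hs1 : sSup S ≤ 1 := csSup_le hne fun t ht => ht.1.2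
  obtain ⟨ε, hε, hev⟩ := Metric.eventually_nhds_iff.1 (h _ hs0 hs1)
  obtain ⟨t, ht, hts⟩ := exists_lt_of_lt_csSup hne (sub_lt_self (sSup S) hε)
  have hts' := le_csSup hbdd ht
  have hP : P (sSup S) := by
    refine (hev ?_).1 ht.1.1 hts' ht.2
    rw [Real.dist_eq, abs_lt]
    constructor <;> linarith
  rcases hs1.eq_or_lt with h1 | h1
  · rwa [h1] at hP
  · exfalso
    have hm1 := min_le_left (sSup S + ε / 2) 1
    have hm2 := min_le_right (sSup S + ε / 2) 1
    have hlt : sSup S < min (sSup S + ε / 2) 1 := lt_min (by linarith) h1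
    have hm : min (sSup S + ε / 2) 1 ∈ S := by
      refine ⟨⟨by linarith, hm2⟩, (hev ?_).2 hlt.le hm2 hP⟩
      rw [Real.dist_eq, abs_lt]
      constructor <;> linarith
    exact absurd (le_csSup hbdd hm) (not_le.2 hlt)

/-- Let `e` be a side of the square number `1`. No coordinate of the image of `e` under an element
of the Veech group is strictly between `0` and `1`. -/
theorem not_between {A : SL(2, ℝ)} (hA : A ∈ veechGroup) {e : Plane} (he : InBox 1 e)
    (hcone : pt 1 e = conePoint) (j : Fin 2) :
    ¬ (0 < A.1.mulVec e j ∧ A.1.mulVec e j < 1) := by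
  rintro ⟨hpos, hlt⟩
  obtain ⟨f, hf⟩ := (mem_veechGroup_iff A).1 hA
  have h0 := height_map_conePoint hf j
  have hbox : ∀ t : ℝ, 0 ≤ t → t ≤ 1 → InBox 1 (t • e) := by
    intro t ht0 ht1 c
    have h1 := he c
    simp only [Pi.smul_apply, smul_eq_mul]
    exact ⟨mul_nonneg ht0 h1.1, (mul_le_of_le_one_left h1.1 ht1).trans h1.2⟩
  have hmul : ∀ s : ℝ, A.1.mulVec (s • e) j = s * A.1.mulVec e j := by
    intro s
    rw [Matrix.mulVec_smul]
    rfl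
  have key : height j (f (pt 1 ((1 : ℝ) • e))) = 1 * A.1.mulVec e j := by
    refine unitInterval_induction
      (P := fun t => height j (f (pt 1 (t • e))) = t * A.1.mulVec e j) ?_ ?_
    · rw [zero_smul, pt_zero, h0, zero_mul]
    · intro τ hτ0 hτ1
      have hc : Continuous fun t : ℝ => (t - τ) • e := by fun_prop
      have hev := (hc.tendsto' τ 0 (by simp)).eventually (hf (pt 1 (τ • e)))
      filter_upwards [hev] with t ht
      have hd : 0 ≤ t → t ≤ 1 → surface.Disp (f (pt 1 (τ • e))) (A.1.mulVec ((t - τ) • e))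
          (f (pt 1 (t • e))) := fun ht0 ht1 =>
        (ht _).1 ((disp_iff _ _ _).2 ⟨1, τ • e, t • e, hbox τ hτ0 hτ1, hbox t ht0 ht1, rfl, rfl,
          (sub_smul _ _ _).symm⟩)
      have hle : ∀ s : ℝ, s ≤ 1 → s * A.1.mulVec e j < 1 := fun s hs =>
        (mul_le_of_le_one_left hpos.le hs).trans_lt hlt
      constructor
      · intro ht0 htτ hP
        have h1 := disp_symm (hd ht0 (htτ.trans hτ1))
        have h2 : (-A.1.mulVec ((t - τ) • e)) j = (τ - t) * A.1.mulVec e j := by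
          rw [Pi.neg_apply, hmul]
          ring
        have h3 := height_of_disp (j := j) h1
          (by rw [h2]; exact mul_nonneg (sub_nonneg.2 htτ) hpos.le)
          (by rw [h2, hP, ← add_mul, add_sub_cancel]; exact hle τ hτ1)
        rw [h3, h2, hP]
        ring
      · intro htτ ht1 hP
        have h1 := hd (hτ0.trans htτ) ht1
        have h3 := height_of_disp (j := j) h1
          (by rw [hmul]; exact mul_nonneg (sub_nonneg.2 htτ) hpos.le)
          (by rw [hmul, hP, ← add_mul, add_sub_cancel]; exact hle t ht1)
        rw [h3, hmul, hP]
        ring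
  rw [one_smul, hcone, h0, one_mul] at key
  exact hpos.ne key

/-! ### Parabolic elements of the Veech group -/

/-- The upper unipotent matrix. -/
def upper (x : ℝ) : SL(2, ℝ) := ⟨!![1, x; 0, 1], by simp [Matrix.det_fin_two]⟩

/-- The lower unipotent matrix. -/
def lower (x : ℝ) : SL(2, ℝ) := ⟨!![1, 0; x, 1], by simp [Matrix.det_fin_two]⟩

theorem mulVec_eq (A : SL(2, ℝ)) (v : Plane) :
    A.1.mulVec v = ![A.1 0 0 * v 0 + A.1 0 1 * v 1, A.1 1 0 * v 0 + A.1 1 1 * v 1] := by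
  funext k
  fin_cases k <;> simp [Matrix.mulVec, dotProduct, Fin.sum_univ_two]

theorem mul_mulVec (A B : SL(2, ℝ)) (v : Plane) :
    (A * B).1.mulVec v = A.1.mulVec (B.1.mulVec v) :=
  (Matrix.mulVec_mulVec _ _ _).symm

theorem ext_entries {A B : SL(2, ℝ)} (h00 : A.1 0 0 = B.1 0 0) (h01 : A.1 0 1 = B.1 0 1)
    (h10 : A.1 1 0 = B.1 1 0) (h11 : A.1 1 1 = B.1 1 1) : A = B := by
  apply Subtype.ext
  ext i j
  fin_cases i <;> fin_cases j <;> assumption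

theorem mul_entries (A B : SL(2, ℝ)) (i j : Fin 2) :
    (A * B).1 i j = A.1 i 0 * B.1 0 j + A.1 i 1 * B.1 1 j := by
  change (A.1 * B.1) i j = _
  rw [Matrix.mul_apply, Fin.sum_univ_two]

theorem inv_entries (A : SL(2, ℝ)) : (A⁻¹).1 0 0 = A.1 1 1 ∧ (A⁻¹).1 0 1 = -A.1 0 1 ∧
    (A⁻¹).1 1 0 = -A.1 1 0 ∧ (A⁻¹).1 1 1 = A.1 0 0 := by
  rw [Matrix.SpecialLinearGroup.SL2_inv_expl]
  simp

/-- The matrix with given entries. -/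
def mk2 (a b c d : ℝ) (h : a * d - b * c = 1) : SL(2, ℝ) :=
  ⟨!![a, b; c, d], by rwa [Matrix.det_fin_two_of]⟩

@[simp] theorem mk2_apply (a b c d : ℝ) (h : a * d - b * c = 1) :
    ((mk2 a b c d h).1 0 0 = a ∧ (mk2 a b c d h).1 0 1 = b) ∧
      ((mk2 a b c d h).1 1 0 = c ∧ (mk2 a b c d h).1 1 1 = d) :=
  ⟨⟨rfl, rfl⟩, rfl, rfl⟩

@[simp] theorem upper_apply (x : ℝ) :
    ((upper x).1 0 0 = 1 ∧ (upper x).1 0 1 = x) ∧ ((upper x).1 1 0 = 0 ∧ (upper x).1 1 1 = 1) :=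
  ⟨⟨rfl, rfl⟩, rfl, rfl⟩

@[simp] theorem lower_apply (x : ℝ) :
    ((lower x).1 0 0 = 1 ∧ (lower x).1 0 1 = 0) ∧ ((lower x).1 1 0 = x ∧ (lower x).1 1 1 = 1) :=
  ⟨⟨rfl, rfl⟩, rfl, rfl⟩

@[simp] theorem rot_apply :
    (rot.1 0 0 = 0 ∧ rot.1 0 1 = 1) ∧ (rot.1 1 0 = -1 ∧ rot.1 1 1 = 0) :=
  ⟨⟨rfl, rfl⟩, rfl, rfl⟩

@[simp] theorem horo_apply (s : ℝ) :
    ((horo s).1 0 0 = 1 ∧ (horo s).1 0 1 = 0) ∧ ((horo s).1 1 0 = -s ∧ (horo s).1 1 1 = 1) :=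
  ⟨⟨rfl, rfl⟩, rfl, rfl⟩

@[simp] theorem M_apply (a b : ℝ) (ha : a ≠ 0) :
    ((M a b ha).1 0 0 = a ∧ (M a b ha).1 0 1 = b) ∧
      ((M a b ha).1 1 0 = 0 ∧ (M a b ha).1 1 1 = a⁻¹) :=
  ⟨⟨rfl, rfl⟩, rfl, rfl⟩

theorem upper_mul_upper (a b : ℝ) : upper a * upper b = upper (a + b) := by
  apply ext_entries <;> simp [mul_entries, add_comm]

theorem upper_inv (a : ℝ) : (upper a)⁻¹ = upper (-a) := by
  have := inv_entries (upper a)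
  apply ext_entries <;> simp [this]

theorem lower_mul_lower (a b : ℝ) : lower a * lower b = lower (a + b) := by
  apply ext_entries <;> simp [mul_entries]

theorem upper_mem (k : ℤ) : upper (k * (2 + √2)) ∈ veechGroup := by
  refine mem_veechGroup_of_shear (c := 0) (n := k) fun v => ?_
  rw [mulVec_eq]
  funext j
  fin_cases j <;> simp [upper, shear, mkv, twist]
  ring

theorem lower_mem (k : ℤ) : lower k ∈ veechGroup := by
  refine mem_veechGroup_of_shear (c := 1) (n := k) fun v => ?_
  rw [mulVec_eq]
  funext j
  fin_cases j <;> simp [lower, shear, mkv, twist]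
  ring

theorem upper_mem' : upper (2 + √2) ∈ veechGroup ∧ upper (-(2 + √2)) ∈ veechGroup := by
  have h1 := upper_mem 1
  have h2 := upper_mem (-1)
  push_cast at h1 h2
  rw [one_mul] at h1
  rw [neg_one_mul] at h2
  exact ⟨h1, h2⟩

theorem lower_mem' : lower 1 ∈ veechGroup ∧ lower (-1) ∈ veechGroup := by
  have h1 := lower_mem 1
  have h2 := lower_mem (-1)
  push_cast at h1 h2
  exact ⟨h1, h2⟩

/-- The matrix `-1` is the fourth power of an elliptic element. -/
theorem neg_one_mem : (-1 : SL(2, ℝ)) ∈ veechGroup := by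
  have h := pow_mem (mul_mem upper_mem'.1 lower_mem'.2) 4
  convert h using 1
  have h2 := sqrt_two_mul_self
  have e : upper (2 + √2) * lower (-1) * (upper (2 + √2) * lower (-1)) =
      mk2 (1 + √2) (-(2 + 2 * √2)) (√2) (-(1 + √2)) (by linear_combination h2) := by
    apply ext_entries <;> simp [mul_entries] <;> linarith
  rw [show 4 = 2 * 2 from rfl, pow_mul, sq (upper (2 + √2) * lower (-1)), e, sq]
  apply ext_entries <;> simp [mul_entries] <;> linarith

/-! ### The saddle connection vectors -/

/-- The union of the orbits of the two sides of the square. -/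
def sides : Set Plane := lambdaH ∪ lambdaV

theorem mulVec_mem_sides {A : SL(2, ℝ)} (hA : A ∈ veechGroup) {v : Plane} (hv : v ∈ sides) :
    A.1.mulVec v ∈ sides := by
  rcases hv with ⟨B, hB, rfl⟩ | ⟨B, hB, rfl⟩
  · exact Or.inl ⟨A * B, mul_mem hA hB, (mul_mulVec _ _ _).symm⟩
  · exact Or.inr ⟨A * B, mul_mem hA hB, (mul_mulVec _ _ _).symm⟩

theorem upper_mem_sides {x y : ℝ} (h : ![x, y] ∈ sides) (k : ℤ) :
    ![x + k * (2 + √2) * y, y] ∈ sides := by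
  have := mulVec_mem_sides (upper_mem k) h
  rw [mulVec_eq] at this
  simpa [upper] using this

theorem lower_mem_sides {x y : ℝ} (h : ![x, y] ∈ sides) (k : ℤ) :
    ![x, k * x + y] ∈ sides := by
  have := mulVec_mem_sides (lower_mem k) h
  rw [mulVec_eq] at this
  simpa [lower] using this

theorem neg_mem_sides {v : Plane} (h : v ∈ sides) : -v ∈ sides := by
  have := mulVec_mem_sides neg_one_mem h
  rw [mulVec_eq] at this
  convert this using 1
  funext k
  fin_cases k <;> simp

theorem horizontal_mem_sides : ![1, 0] ∈ sides :=
  Or.inl ⟨1, one_mem _, by simp⟩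

theorem vertical_mem_sides : ![0, 1] ∈ sides :=
  Or.inr ⟨1, one_mem _, by simp⟩

theorem not_between_of_mem_sides {v : Plane} (hv : v ∈ sides) (j : Fin 2) :
    ¬ (0 < v j ∧ v j < 1) := by
  have e0 : (![1, 0] : Plane) = mkv 0 1 0 := by funext k; fin_cases k <;> simp [mkv]
  have e1 : (![0, 1] : Plane) = mkv 1 1 0 := by funext k; fin_cases k <;> simp [mkv]
  have hb : ∀ c, InBox 1 (mkv c 1 0) := fun c =>
    inBox_mkv ⟨zero_le_one, one_le_sz _ _⟩ ⟨le_rfl, (sz_pos _ _).le⟩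
  rcases hv with ⟨A, hA, rfl⟩ | ⟨A, hA, rfl⟩
  · rw [e0]
    exact not_between hA (hb 0) pt_corner_eq.2.2.1 j
  · rw [e1]
    exact not_between hA (hb 1) pt_corner_eq.2.2.2 j

/-- The coordinates of the vectors in the two orbits vanish or have absolute value at least `1`. -/
theorem one_le_of_mem_sides {v : Plane} (hv : v ∈ sides) {j : Fin 2} (h : 0 < v j) : 1 ≤ v j :=
  not_lt.1 fun h' => not_between_of_mem_sides hv j ⟨h, h'⟩

theorem le_neg_one_of_mem_sides {v : Plane} (hv : v ∈ sides) {j : Fin 2} (h : v j < 0) :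
    v j ≤ -1 := by
  have := one_le_of_mem_sides (neg_mem_sides hv) (j := j) (by simpa using h)
  rw [Pi.neg_apply] at this
  linarith

theorem one_le_fst {x y : ℝ} (h : ![x, y] ∈ sides) (hx : 0 < x) : 1 ≤ x :=
  one_le_of_mem_sides h (j := 0) hx

theorem one_le_snd {x y : ℝ} (h : ![x, y] ∈ sides) (hy : 0 < y) : 1 ≤ y :=
  one_le_of_mem_sides h (j := 1) hy

theorem snd_le_neg_one {x y : ℝ} (h : ![x, y] ∈ sides) (hy : y < 0) : y ≤ -1 :=
  le_neg_one_of_mem_sides h (j := 1) hy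

theorem fst_le_neg_one {x y : ℝ} (h : ![x, y] ∈ sides) (hy : x < 0) : x ≤ -1 :=
  le_neg_one_of_mem_sides h (j := 0) hy

/-- The determinants of a vector of the two orbits with the directions `(1, 1)`, `(1 + √2, 1)` and
`(1 + √2, √2)` are, up to sign, coordinates of other such vectors. -/
theorem sides_dets {x y : ℝ} (h : ![x, y] ∈ sides) :
    (∃ z, ![z, y - x] ∈ sides) ∧ (∃ z, ![z, x - (1 + √2) * y] ∈ sides) ∧
      ∃ z, ![z, (1 + √2) * y - √2 * x] ∈ sides := by
  have h2 := sqrt_two_mul_self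
  have key : ∀ {x y : ℝ}, ![x, y] ∈ sides →
      ![x - (2 + √2) * y, x - (1 + √2) * y] ∈ sides := by
    intro x y h
    have h1 := lower_mem_sides (upper_mem_sides h (-1)) 1
    convert h1 using 2
    · push_cast; ring
    · congr 1; push_cast; ring
  refine ⟨⟨x, ?_⟩, ⟨_, key h⟩, ?_⟩
  · have h1 := lower_mem_sides h (-1)
    convert h1 using 3
    push_cast; ring
  · have h1 := key (key h)
    refine ⟨x - (2 + √2) * y - (2 + √2) * (x - (1 + √2) * y), ?_⟩
    convert h1 using 3
    linear_combination -y * h2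

/-! ### Triangular elements of the Veech group -/

theorem apply_mem_sides {A : SL(2, ℝ)} (hA : A ∈ veechGroup) :
    ![A.1 0 0, A.1 1 0] ∈ sides ∧ ![A.1 0 1, A.1 1 1] ∈ sides := by
  have h1 := mulVec_mem_sides hA horizontal_mem_sides
  have h2 := mulVec_mem_sides hA vertical_mem_sides
  rw [mulVec_eq] at h1 h2
  simp only [Matrix.cons_val_zero, Matrix.cons_val_one, mul_one, mul_zero, add_zero,
    zero_add] at h1 h2
  exact ⟨h1, h2⟩

/-- Diagonal entries of triangular elements of the Veech group. -/
theorem diag_eq_one {A : SL(2, ℝ)} (hA : A ∈ veechGroup) (h0 : 0 < A.1 0 0)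
    (h : A.1 1 0 = 0 ∨ A.1 0 1 = 0) : A.1 0 0 = 1 ∧ A.1 1 1 = 1 := by
  have hdet := A.2
  rw [Matrix.det_fin_two] at hdet
  have hdet : A.1 0 0 * A.1 1 1 = 1 := by
    rcases h with h | h <;> rw [h] at hdet <;> linarith
  have h1 : 0 < A.1 1 1 := pos_of_mul_pos_right (by rw [hdet]; exact one_pos) h0.le
  have h2 := one_le_fst (apply_mem_sides hA).1 h0
  have h3 := one_le_snd (apply_mem_sides hA).2 h1
  constructor <;> nlinarith

/-- The square of the matrix would map `(0, 1)` to `(2, 1)`, whose determinant with `(1 + √2, 1)` is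
`1 - √2`. -/
theorem not_upper_one_mem : upper 1 ∉ veechGroup := by
  intro h
  have h2 := mulVec_mem_sides h (mulVec_mem_sides h vertical_mem_sides)
  rw [mulVec_eq, mulVec_eq] at h2
  simp only [upper_apply, Matrix.cons_val_zero, Matrix.cons_val_one, mul_one, mul_zero,
    zero_add] at h2
  obtain ⟨-, ⟨z, h3⟩, -⟩ := sides_dets h2
  have h4 := snd_le_neg_one h3
  have := lt_sqrt_two
  have := sqrt_two_lt
  linarith [h4 (by linarith)]

/-- The upper unipotent elements of the Veech group. A remainder `r` strictly between `0` and
`2 + √2` leads to the vectors `(r, 1)` and `(2 + √2 - r, 1)`, which forces `r` or `2 + √2 - r` to be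
`1`. -/
theorem exists_of_upper_mem {x : ℝ} (h : upper x ∈ veechGroup) :
    ∃ k : ℤ, x = k * (2 + √2) := by
  have hpos : 0 < 2 + √2 := by positivity
  have hs := lt_sqrt_two
  have hs' := sqrt_two_lt
  -- reduce to a number `r` between `0` and `2 + √2`
  set k := ⌊x / (2 + √2)⌋ with hk
  set r := x + (-k : ℤ) * (2 + √2) with hr
  have hrmem : upper r ∈ veechGroup := by
    rw [hr, ← upper_mul_upper]
    exact mul_mem h (upper_mem _)
  have hr' : r = (2 + √2) * Int.fract (x / (2 + √2)) := by
    rw [hr, Int.fract, ← hk]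
    push_cast
    field_simp
    ring
  have h0 : 0 ≤ r := by rw [hr']; exact mul_nonneg hpos.le (Int.fract_nonneg _)
  have h1 : r < 2 + √2 := by
    rw [hr']
    simpa using mul_lt_mul_of_pos_left (Int.fract_lt_one (x / (2 + √2))) hpos
  rcases h0.eq_or_lt with h0 | h0
  · refine ⟨k, ?_⟩
    push_cast at hr
    linarith
  exfalso
  have hv : ![r, 1] ∈ sides := by simpa [upper] using (apply_mem_sides hrmem).2
  have hv' : ![2 + √2 - r, 1] ∈ sides := by
    have h3 := (apply_mem_sides (inv_mem hrmem)).2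
    rw [upper_inv] at h3
    simp only [upper_apply] at h3
    have := upper_mem_sides h3 1
    convert this using 2
    push_cast
    ring
  have key : ∀ {t : ℝ}, ![t, 1] ∈ sides → 0 < t → t = 1 ∨ 2 ≤ t := by
    intro t ht h2
    have h3 := one_le_fst ht h2
    obtain ⟨⟨z, h4⟩, -⟩ := sides_dets ht
    rcases h3.eq_or_lt with h5 | h5
    · exact Or.inl h5.symm
    · right
      linarith [snd_le_neg_one h4 (by linarith)]
  -- the two numbers cannot both be at least `2`, as their sum is less than `4`
  rcases key hv h0 with h2 | h2
  · exact not_upper_one_mem (h2 ▸ hrmem)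
  rcases key hv' (by linarith) with h3 | h3
  · apply not_upper_one_mem
    have h4 := mul_mem upper_mem'.1 (inv_mem hrmem)
    rwa [upper_inv, upper_mul_upper, ← sub_eq_add_neg, h3] at h4
  · linarith

/-- The lower unipotent elements of the Veech group. -/
theorem exists_of_lower_mem {x : ℝ} (h : lower x ∈ veechGroup) : ∃ k : ℤ, x = k := by
  refine ⟨⌊x⌋, ?_⟩
  have h1 : lower (Int.fract x) ∈ veechGroup := by
    have := mul_mem h (lower_mem (-⌊x⌋))
    rwa [lower_mul_lower, Int.cast_neg, ← sub_eq_add_neg] at this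
  have h2 := (apply_mem_sides h1).1
  simp only [lower_apply] at h2
  have h3 := Int.fract_nonneg x
  rcases h3.eq_or_lt with h3 | h3
  · rw [Int.fract] at h3
    linarith
  · exact absurd (one_le_snd h2 h3) (not_le.2 (Int.fract_lt_one x))

/-- No element of the Veech group maps the vertical to the horizontal direction. Otherwise the
upper left entry could be changed by integers and by multiples of the irrational number `2 + √2`,
and would become a number strictly between `0` and `1`. -/
theorem apply_one_one_ne_zero {A : SL(2, ℝ)} (hA : A ∈ veechGroup) (h0 : 0 < A.1 0 1) :
    A.1 1 1 ≠ 0 := by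
  intro h
  have hdet := A.2
  rw [Matrix.det_fin_two, h, mul_zero, zero_sub] at hdet
  have h1 : A.1 1 0 < 0 := by
    by_contra h1
    nlinarith
  have h2 := one_le_fst (apply_mem_sides hA).2 h0
  have h3 := snd_le_neg_one (apply_mem_sides hA).1 h1
  have h4 : A.1 0 1 = 1 := by nlinarith
  have h5 : A.1 1 0 = -1 := by rw [h4] at hdet; linarith
  have key : ∀ k n : ℤ, ![A.1 0 0 + n - k * (2 + √2), -1] ∈ sides := by
    intro k n
    have h6 := (apply_mem_sides (mul_mem (mul_mem (upper_mem k) hA) (lower_mem n))).1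
    simp only [mul_entries, upper_apply, lower_apply, h, h4, h5] at h6
    convert h6 using 2
    · ring
    · congr 1
      ring
  have hfract : ∀ k : ℤ, Int.fract (A.1 0 0 - k * (2 + √2)) = 0 := by
    intro k
    by_contra h6
    have h7 := key k (-⌊A.1 0 0 - k * (2 + √2)⌋)
    have h8 : A.1 0 0 + (-⌊A.1 0 0 - k * (2 + √2)⌋ : ℤ) - k * (2 + √2) =
        Int.fract (A.1 0 0 - k * (2 + √2)) := by
      rw [Int.fract]
      push_cast
      ring
    rw [h8] at h7
    exact absurd (one_le_fst h7 (lt_of_le_of_ne (Int.fract_nonneg _) (Ne.symm h6)))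
      (not_le.2 (Int.fract_lt_one _))
  obtain ⟨m, hm⟩ := Int.fract_eq_zero_iff.1 (hfract 0)
  obtain ⟨n, hn⟩ := Int.fract_eq_zero_iff.1 (hfract 1)
  refine irrational_sqrt_two ⟨(m - n - 2 : ℤ), ?_⟩
  push_cast at hm hn ⊢
  linarith

/-! ### Coordinates on the section -/

/-- The coset representative of the two types of surfaces: `base j • L` is `ℒ` for `j = false` and
`ℒᴿ` for `j = true`. -/
def base (j : Bool) : SL(2, ℝ) := cond j rot 1

/-- The width of the cusp that belongs to the two types of surfaces. -/
noncomputable def width (j : Bool) : ℝ := cond j 1 (2 + √2)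

/-- The triangle that belongs to the two types of surfaces. -/
def triangle (j : Bool) : Set (ℝ × ℝ) :=
  {p | 0 < p.1 ∧ p.1 ≤ 1 ∧ 1 - width j * p.1 < p.2 ∧ p.2 ≤ 1}

theorem width_pos (j : Bool) : 0 < width j := by
  cases j
  · exact add_pos two_pos (by positivity)
  · exact one_pos

theorem mem_Ω₁_iff (p : ℝ × ℝ) : p ∈ Ω₁ ↔ p ∈ triangle false := by
  change (_ ∧ _ ∧ 1 - (√2 + 2) * p.1 < p.2 ∧ _) ↔ (_ ∧ _ ∧ 1 - (2 + √2) * p.1 < p.2 ∧ _)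
  rw [add_comm]

theorem mem_Ω₂_iff (p : ℝ × ℝ) : p ∈ Ω₂ ↔ p ∈ triangle true := by
  change (_ ∧ _ ∧ 1 - p.1 < p.2 ∧ _) ↔ (_ ∧ _ ∧ 1 - 1 * p.1 < p.2 ∧ _)
  rw [one_mul]

/-- The triangle to which a point of the disjoint union belongs. -/
def kind : Ω₁ ⊕ Ω₂ → Bool := Sum.elim (fun _ => false) fun _ => true

theorem coord_mem (x : Ω₁ ⊕ Ω₂) : coord x ∈ triangle (kind x) := by
  rcases x with x | x
  · exact (mem_Ω₁_iff _).1 x.2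
  · exact (mem_Ω₂_iff _).1 x.2

theorem ext_kind_coord {x y : Ω₁ ⊕ Ω₂} (h : kind x = kind y) (h' : coord x = coord y) :
    x = y := by
  rcases x with x | x <;> rcases y with y | y
  · exact congrArg Sum.inl (Subtype.ext h')
  · exact absurd h Bool.false_ne_true
  · exact absurd h.symm Bool.false_ne_true
  · exact congrArg Sum.inr (Subtype.ext h')

theorem exists_kind_coord {j : Bool} {p : ℝ × ℝ} (h : p ∈ triangle j) :
    ∃ x, kind x = j ∧ coord x = p := by
  cases j
  · exact ⟨Sum.inl ⟨p, (mem_Ω₁_iff p).2 h⟩, rfl, rfl⟩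
  · exact ⟨Sum.inr ⟨p, (mem_Ω₂_iff p).2 h⟩, rfl, rfl⟩

theorem point_eq (x : Ω₁ ⊕ Ω₂) :
    point x = M (coord x).1 (coord x).2 (coord_mem x).1.ne' • base (kind x) • L := by
  rcases x with x | x
  · change _ • L = _ • (1 : SL(2, ℝ)) • L
    rw [one_smul]
    rfl
  · rfl

theorem smul_L_eq_iff (A B : SL(2, ℝ)) : A • L = B • L ↔ A⁻¹ * B ∈ veechGroup := by
  rw [eq_comm, ← inv_smul_eq_iff, smul_smul]
  rfl

theorem smul_L_of_mem {A : SL(2, ℝ)} (h : A ∈ veechGroup) : A • L = L := h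

theorem upper_smul_base (j : Bool) (k : ℤ) : upper (k * width j) • base j • L = base j • L := by
  cases j
  · change upper (k * (2 + √2)) • (1 : SL(2, ℝ)) • L = (1 : SL(2, ℝ)) • L
    rw [one_smul, smul_L_of_mem (upper_mem k)]
  · change upper (k * 1) • rot • L = rot • L
    have : upper (k * 1) * rot = rot * lower (-k : ℤ) := by
      apply ext_entries <;> simp [mul_entries]
    rw [smul_smul, this, mul_smul, smul_L_of_mem (lower_mem _)]

theorem M_mul_upper {a : ℝ} (b x : ℝ) (ha : a ≠ 0) : M a b ha * upper x = M a (b + a * x) ha := by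
  apply ext_entries <;> simp [mul_entries, add_comm]

/-- Surfaces given by upper triangular matrices have representatives in the triangles. -/
theorem exists_point_eq (j : Bool) {a : ℝ} (b : ℝ) (ha : 0 < a) (ha1 : a ≤ 1) :
    ∃ x, kind x = j ∧ point x = M a b ha.ne' • base j • L ∧
      coord x = (a, b + width j * a * ⌊(1 - b) / (width j * a)⌋) := by
  have hw := mul_pos (width_pos j) ha
  have h1 := Int.floor_le ((1 - b) / (width j * a))
  have h2 := Int.lt_floor_add_one ((1 - b) / (width j * a))
  rw [le_div_iff₀ hw] at h1
  rw [div_lt_iff₀ hw] at h2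
  obtain ⟨x, rfl, hx⟩ := exists_kind_coord (j := j)
    (p := (a, b + width j * a * ⌊(1 - b) / (width j * a)⌋))
    ⟨ha, ha1, by simp only; linarith, by simp only; linarith⟩
  refine ⟨x, rfl, ?_, hx⟩
  rw [point_eq]
  conv_rhs => rw [← upper_smul_base _ ⌊(1 - b) / (width (kind x) * a)⌋, smul_smul, M_mul_upper]
  congr 1
  apply ext_entries <;> simp [hx]
  ring

/-- The parametrization by upper triangular matrices is injective up to translations by multiples
of the cusp width. -/
theorem smul_base_eq {i j : Bool} {a b a' b' : ℝ} (ha : 0 < a) (ha' : 0 < a')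
    (h : M a b ha.ne' • base i • L = M a' b' ha'.ne' • base j • L) :
    i = j ∧ a = a' ∧ ∃ k : ℤ, b' = b + k * (width i * a) := by
  have hne := ha.ne'
  have hne' := ha'.ne'
  rw [smul_smul, smul_smul, smul_L_eq_iff] at h
  have key : ∀ {i j : Bool} {a b a' b' : ℝ} (hne : a ≠ 0) (hne' : a' ≠ 0),
      (M a b hne * base i)⁻¹ * (M a' b' hne' * base j) =
        (base i)⁻¹ * mk2 (a⁻¹ * a') (a⁻¹ * b' - b * a'⁻¹) 0 (a * a'⁻¹) (by field_simp; ring) *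
          base j := by
    intro i j a b a' b' hne hne'
    have : (M a b hne)⁻¹ * M a' b' hne' =
        mk2 (a⁻¹ * a') (a⁻¹ * b' - b * a'⁻¹) 0 (a * a'⁻¹) (by field_simp; ring) := by
      have := inv_entries (M a b hne)
      apply ext_entries <;> simp [mul_entries, this]
      ring
    rw [mul_inv_rev, ← this]
    group
  have hdiag : a⁻¹ * a' = 1 → a = a' := fun h => by field_simp at h; exact h.symm
  have hrot := inv_entries rot
  simp only [rot_apply] at hrot
  rw [key hne hne'] at h
  cases i <;> cases j
  · refine ⟨rfl, ?_⟩
    change 1⁻¹ * _ * (1 : SL(2, ℝ)) ∈ _ at h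
    rw [inv_one, one_mul, mul_one] at h
    have h1 := diag_eq_one h (by simpa using mul_pos (inv_pos.2 ha) ha') (by simp)
    simp only [mk2_apply] at h1
    obtain rfl := hdiag h1.1
    refine ⟨rfl, ?_⟩
    obtain ⟨k, hk⟩ := exists_of_upper_mem (x := a⁻¹ * b' - b * a⁻¹) (by
      convert h using 1
      apply ext_entries <;> simp [hne])
    refine ⟨k, ?_⟩
    change b' = b + k * ((2 + √2) * a)
    field_simp at hk
    linarith
  · exfalso
    change 1⁻¹ * _ * rot ∈ _ at h
    refine apply_one_one_ne_zero h ?_ ?_ <;> simp [mul_entries]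
    positivity
  · exfalso
    have h' := inv_mem h
    rw [← key hne hne', mul_inv_rev, inv_inv, key hne' hne] at h'
    change 1⁻¹ * _ * rot ∈ _ at h'
    refine apply_one_one_ne_zero h' ?_ ?_ <;> simp [mul_entries]
    positivity
  · refine ⟨rfl, ?_⟩
    change rot⁻¹ * _ * rot ∈ _ at h
    have h1 := diag_eq_one h
      (by simpa [mul_entries, hrot] using mul_pos ha (inv_pos.2 ha'))
      (by simp [mul_entries, hrot])
    simp only [mul_entries, hrot, mk2_apply, rot_apply] at h1
    obtain rfl := hdiag (by linarith [h1.2])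
    refine ⟨rfl, ?_⟩
    obtain ⟨k, hk⟩ := exists_of_lower_mem (x := -(a⁻¹ * b' - b * a⁻¹)) (by
      convert h using 1
      apply ext_entries <;> simp [mul_entries, hrot, hne])
    refine ⟨-k, ?_⟩
    change b' = b + _ * (1 * a)
    push_cast
    field_simp at hk
    linarith

theorem point_injective : Function.Injective point := by
  intro x y h
  rw [point_eq, point_eq] at h
  obtain ⟨h1, h2, k, hk⟩ := smul_base_eq (coord_mem x).1 (coord_mem y).1 h
  obtain ⟨hx1, -, hx2, hx3⟩ := coord_mem x
  obtain ⟨-, -, hy2, hy3⟩ := coord_mem y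
  rw [← h1, ← h2] at hy2
  have hw := mul_pos (width_pos (kind x)) hx1
  have h3 : (k : ℝ) < 1 := by
    by_contra! h4
    nlinarith
  have h4 : (-1 : ℝ) < k := by
    by_contra! h4
    nlinarith
  have h5 : k = 0 := by
    have h6 : k < 1 := by exact_mod_cast h3
    have h7 : -1 < k := by exact_mod_cast h4
    omega
  rw [h5, Int.cast_zero, zero_mul, add_zero] at hk
  exact ext_kind_coord h1 (Prod.ext h2 hk.symm)

/-! ### The section -/

/-- The orbits of the two sides of the square. -/
def orbitOf (j : Bool) : Set Plane := cond j lambdaV lambdaH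

theorem mem_orbitOf (j : Bool) (v : Plane) :
    v ∈ orbitOf j ↔ ∃ γ ∈ veechGroup, v = (γ * (base j)⁻¹).1.mulVec ![1, 0] := by
  cases j
  · change (∃ γ ∈ veechGroup, _) ↔ ∃ γ ∈ veechGroup, v = (γ * 1⁻¹).1.mulVec ![1, 0]
    simp only [inv_one, mul_one]
  · have h : (rot⁻¹).1.mulVec ![1, 0] = ![0, 1] := by
      have := inv_entries rot
      rw [mulVec_eq, this.1, this.2.1, this.2.2.1, this.2.2.2]
      simp
    change (∃ γ ∈ veechGroup, _) ↔ ∃ γ ∈ veechGroup, v = (γ * rot⁻¹).1.mulVec ![1, 0]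
    simp only [mul_mulVec, h]

theorem image_shortHorizontal (Λ : Set Plane) :
    (fun x => (Θ x : TranslationSurface.Moduli)) '' shortHorizontal Λ =
      {X | ∃ g : SL(2, ℝ), X = g • L ∧ ∃ v ∈ Λ, ∃ t : ℝ, 0 < t ∧ t ≤ 1 ∧
        g.1.mulVec v = ![t, 0]} := by
  ext X
  constructor
  · rintro ⟨_, ⟨g, rfl, h⟩, rfl⟩
    exact ⟨g, rfl, h⟩
  · rintro ⟨g, rfl, h⟩
    exact ⟨_, ⟨g, rfl, h⟩, rfl⟩

theorem image_section (j : Bool) :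
    (fun x => (Θ x : TranslationSurface.Moduli)) '' shortHorizontal (orbitOf j) =
      {X | ∃ x, kind x = j ∧ point x = X} := by
  rw [image_shortHorizontal]
  ext X
  constructor
  · rintro ⟨g, rfl, v, hv, t, ht0, ht1, h⟩
    obtain ⟨γ, hγ, rfl⟩ := (mem_orbitOf j v).1 hv
    rw [← mul_mulVec, mulVec_eq] at h
    have h0 := congrFun h 0
    have h1 := congrFun h 1
    simp only [Matrix.cons_val_zero, Matrix.cons_val_one, mul_one, mul_zero, add_zero] at h0 h1
    set A := g * (γ * (base j)⁻¹) with hA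
    have hdet := A.2
    rw [Matrix.det_fin_two, h0, h1, mul_zero, sub_zero] at hdet
    obtain ⟨x, hx, hx', -⟩ := exists_point_eq j (A.1 0 1) ht0 ht1
    refine ⟨x, hx, ?_⟩
    rw [hx']
    have hM : M t (A.1 0 1) ht0.ne' = A := by
      apply ext_entries <;> simp [h0, h1]
      field_simp
      linarith
    rw [hM, hA, smul_smul, mul_assoc, inv_mul_cancel_right, mul_smul, smul_L_of_mem hγ]
  · rintro ⟨x, rfl, rfl⟩
    obtain ⟨h1, h2, -⟩ := coord_mem x
    refine ⟨M (coord x).1 (coord x).2 h1.ne' * base (kind x), by rw [point_eq, mul_smul], _,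
      (mem_orbitOf _ _).2 ⟨1, one_mem _, rfl⟩, _, h1, h2, ?_⟩
    rw [one_mul, ← mul_mulVec, mul_assoc, mul_inv_cancel, mul_one, mulVec_eq]
    simp

theorem sectionSurfaces_eq : sectionSurfaces = Set.range point := by
  rw [sectionSurfaces, Set.image_union]
  have h0 := image_section false
  have h1 := image_section true
  change _ '' sectionH = _ at h0
  change _ '' sectionV = _ at h1
  rw [h0, h1]
  ext X
  constructor
  · rintro (⟨x, -, h⟩ | ⟨x, -, h⟩) <;> exact ⟨x, h⟩
  · rintro ⟨x, rfl⟩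
    cases h : kind x
    · exact Or.inl ⟨x, h, rfl⟩
    · exact Or.inr ⟨x, h, rfl⟩

theorem smul_L_mem_section (A : SL(2, ℝ)) : A • L ∈ sectionSurfaces ↔
    ∃ v ∈ sides, ∃ t : ℝ, 0 < t ∧ t ≤ 1 ∧ A.1.mulVec v = ![t, 0] := by
  have h : sectionSurfaces =
      (fun x => (Θ x : TranslationSurface.Moduli)) '' shortHorizontal sides := by
    rw [sectionSurfaces]
    congr 1
    ext x
    constructor
    · rintro (⟨g, h, v, hv, h'⟩ | ⟨g, h, v, hv, h'⟩)
      · exact ⟨g, h, v, Or.inl hv, h'⟩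
      · exact ⟨g, h, v, Or.inr hv, h'⟩
    · rintro ⟨g, h, v, hv | hv, h'⟩
      · exact Or.inl ⟨g, h, v, hv, h'⟩
      · exact Or.inr ⟨g, h, v, hv, h'⟩
  rw [h, image_shortHorizontal]
  constructor
  · rintro ⟨g, hg, v, hv, t, ht0, ht1, h⟩
    refine ⟨_, mulVec_mem_sides ((smul_L_eq_iff A g).1 hg) hv, t, ht0, ht1, ?_⟩
    rw [← mul_mulVec, mul_inv_cancel_left, h]
  · rintro h
    exact ⟨A, rfl, h⟩

/-- The vectors of the two orbits, in the coordinates of the surfaces of the two types. -/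
def rotated (j : Bool) (x y : ℝ) : Plane := cond j ![-y, x] ![x, y]

/-- The horocycle through a point of the section meets the section when one of the vectors of the
two orbits becomes horizontal. -/
theorem horo_smul_mem_section (s : ℝ) (x : Ω₁ ⊕ Ω₂) {a b : ℝ} (hx : coord x = (a, b)) :
    horo s • point x ∈ sectionSurfaces ↔ ∃ X Y, rotated (kind x) X Y ∈ sides ∧
      0 < a * X + b * Y ∧ a * X + b * Y ≤ 1 ∧ s = Y / (a * (a * X + b * Y)) := by
  have ha : 0 < a := by
    have := (coord_mem x).1
    rwa [hx] at this
  have hne := ha.ne'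
  have hM : ∀ X Y, (horo s * M a b hne).1.mulVec ![X, Y] =
      ![a * X + b * Y, -s * (a * X + b * Y) + Y / a] := by
    intro X Y
    rw [mulVec_eq]
    simp only [mul_entries, horo_apply, M_apply, Matrix.cons_val_zero, Matrix.cons_val_one]
    congr 1
    · ring
    · congr 1
      ring
  have hpt : point x = M a b hne • base (kind x) • L := by
    rw [point_eq]
    simp only [hx]
  have hb : ∀ X Y, (base (kind x)).1.mulVec (rotated (kind x) X Y) = ![X, Y] := by
    intro X Y
    cases kind x
    · change (1 : SL(2, ℝ)).1.mulVec ![X, Y] = _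
      simp
    · change rot.1.mulVec ![-Y, X] = _
      rw [mulVec_eq]
      simp
  have hb' : ∀ v, ∃ X Y, v = rotated (kind x) X Y := by
    intro v
    cases kind x
    · exact ⟨v 0, v 1, by funext k; fin_cases k <;> rfl⟩
    · exact ⟨v 1, -v 0, by funext k; fin_cases k <;> simp [rotated]⟩
  rw [hpt, smul_smul, smul_smul, smul_L_mem_section]
  constructor
  · rintro ⟨v, hv, t, ht0, ht1, h⟩
    obtain ⟨X, Y, rfl⟩ := hb' v
    rw [mul_mulVec, hb, hM] at h
    have h0 : a * X + b * Y = t := congrFun h 0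
    have h1 : -s * (a * X + b * Y) + Y / a = 0 := congrFun h 1
    refine ⟨X, Y, hv, by rwa [h0], by rwa [h0], ?_⟩
    rw [h0] at h1 ⊢
    field_simp at h1 ⊢
    linarith
  · rintro ⟨X, Y, hv, h0, h1, rfl⟩
    refine ⟨_, hv, a * X + b * Y, h0, h1, ?_⟩
    rw [mul_mulVec, hb, hM]
    have h2 := h0.ne'
    generalize a * X + b * Y = t at *
    congr 2
    field_simp
    ring

/-! ### The branches of the return map -/

/-- The scalar product of the plane. -/
def dot (u p : ℝ × ℝ) : ℝ := u.1 * p.1 + u.2 * p.2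

/-- The data of a branch of the return map. On the part `dom` of the triangle `src`, the saddle
connection vector `u` of the surface of type `src` becomes horizontal first. The matrix with
columns `u` and `w` takes the surface of type `tgt` to the surface of type `src`. -/
structure Branch where
  src : Bool
  tgt : Bool
  dom : Set (ℝ × ℝ)
  u : ℝ × ℝ
  w : ℝ × ℝ

/-- The five branches of the return map. -/
noncomputable def branch : Fin 5 → Branch :=
  ![⟨false, true, ΩAH, (0, 1), (-1, 0)⟩,
    ⟨false, false, ΩBD, (1, 1), (0, 1)⟩,
    ⟨false, false, ΩHF, (1 + √2, √2), (2 + √2, 1 + √2)⟩,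
    ⟨false, false, ΩAE, (1 + √2, 1), (2 * (1 + √2), 1 + √2)⟩,
    ⟨true, false, Ω₂, (0, 1), (-1, 0)⟩]

/-- The number of times by which the image has to be translated back into the triangle. -/
noncomputable def Branch.shift (B : Branch) (p : ℝ × ℝ) : ℤ :=
  ⌊(1 - dot B.w p) / (width B.tgt * dot B.u p)⌋

/-- The coordinates of the image under a branch of the return map. -/
noncomputable def Branch.image (B : Branch) (p : ℝ × ℝ) : ℝ × ℝ :=
  (dot B.u p, dot B.w p + width B.tgt * dot B.u p * B.shift p)

/-- The return time on a branch. -/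
noncomputable def Branch.time (B : Branch) (p : ℝ × ℝ) : ℝ := B.u.2 / (p.1 * dot B.u p)

theorem branch_det (r : Fin 5) :
    (branch r).u.1 * (branch r).w.2 - (branch r).w.1 * (branch r).u.2 = 1 := by
  have h2 := sqrt_two_mul_self
  fin_cases r <;> simp [branch] <;> linarith

theorem one_le_branch (r : Fin 5) : 1 ≤ (branch r).u.2 := by
  fin_cases r <;> simp [branch]

/-- The matrix of a branch. -/
noncomputable def branchMatrix (r : Fin 5) : SL(2, ℝ) :=
  mk2 (branch r).u.1 (branch r).w.1 (branch r).u.2 (branch r).w.2 (branch_det r)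

/-- The first branch and the last one, where the type changes, rotate the surface by a right angle.
The matrices of the other branches are products of the known elements of the Veech group. -/
theorem branchMatrix_smul (r : Fin 5) :
    branchMatrix r • base (branch r).tgt • L = base (branch r).src • L := by
  have h2 := sqrt_two_mul_self
  have hneg : ∀ {A : SL(2, ℝ)}, -1 * A ∈ veechGroup → A ∈ veechGroup := fun h => by
    have := mul_mem neg_one_mem h
    rwa [neg_one_mul, neg_one_mul, neg_neg] at this
  have hsource : ∀ {A : SL(2, ℝ)}, A ∈ veechGroup →
      A • (1 : SL(2, ℝ)) • L = (1 : SL(2, ℝ)) • L := fun h => by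
    rw [one_smul, smul_L_of_mem h]
  have hup := upper_mem'
  have hlo := lower_mem'
  fin_cases r
  · change branchMatrix 0 • rot • L = (1 : SL(2, ℝ)) • L
    rw [smul_smul]
    congr 1
    apply ext_entries <;> simp [mul_entries, branchMatrix, branch]
  · refine hsource ?_
    convert hlo.1 using 1
    apply ext_entries <;> simp [branchMatrix, branch]
  · refine hsource ?_
    have h3 : √2 * √2 * √2 = 2 * √2 := by rw [h2]
    convert mul_mem (mul_mem (mul_mem hup.1 hlo.2) (mul_mem hup.1 hlo.2)) hup.1 using 1
    apply ext_entries <;> simp [mul_entries, branchMatrix, branch] <;> linarith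
  · refine hsource (hneg ?_)
    convert mul_mem (mul_mem hup.1 hlo.2) hup.1 using 1
    apply ext_entries <;> simp [mul_entries, branchMatrix, branch] <;> linarith
  · change branchMatrix 4 • (1 : SL(2, ℝ)) • L = rot • L
    have h4 : branchMatrix 4 = rot * -1 := by
      apply ext_entries <;> simp [branchMatrix, branch]
    rw [one_smul, h4, mul_smul, smul_L_of_mem neg_one_mem]

theorem exists_branch (x : Ω₁ ⊕ Ω₂) :
    ∃ r, kind x = (branch r).src ∧ coord x ∈ (branch r).dom := by
  rcases x with ⟨p, hp⟩ | ⟨p, hp⟩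
  · change ∃ r, false = (branch r).src ∧ p ∈ (branch r).dom
    rcases lt_or_ge 1 (p.1 + p.2) with h1 | h1
    · exact ⟨0, rfl, hp, h1⟩
    rcases lt_or_ge 1 ((1 + √2) * p.1 + p.2) with h2 | h2
    · rcases lt_or_ge 1 ((1 + √2) * p.1 + √2 * p.2) with h3 | h3
      · exact ⟨1, rfl, hp, h1, h3, h2⟩
      · exact ⟨2, rfl, hp, h3, h2⟩
    · exact ⟨3, rfl, hp, h2⟩
  · exact ⟨4, rfl, hp⟩

theorem disjoint_regions : Disjoint ΩAH ΩBD ∧ Disjoint ΩAH ΩHF ∧ Disjoint ΩAH ΩAE ∧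
    Disjoint ΩBD ΩHF ∧ Disjoint ΩBD ΩAE ∧ Disjoint ΩHF ΩAE := by
  have hs := lt_sqrt_two
  simp only [Set.disjoint_left]
  refine ⟨?_, ?_, ?_, ?_, ?_, ?_⟩
  · rintro p ⟨-, h⟩ ⟨-, h', -⟩
    linarith
  · rintro p ⟨hp, h⟩ ⟨-, h', -⟩
    nlinarith [hp.1]
  · rintro p ⟨hp, h⟩ ⟨-, h'⟩
    nlinarith [hp.1]
  · rintro p ⟨-, -, h, -⟩ ⟨-, h', -⟩
    linarith
  · rintro p ⟨-, -, -, h⟩ ⟨-, h'⟩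
    linarith
  · rintro p ⟨-, -, h⟩ ⟨-, h'⟩
    linarith

theorem branch_unique {j : Bool} {p : ℝ × ℝ} {r s : Fin 5} (hr : j = (branch r).src)
    (hr' : p ∈ (branch r).dom) (hs : j = (branch s).src) (hs' : p ∈ (branch s).dom) : r = s := by
  obtain ⟨h1, h2, h3, h4, h5, h6⟩ := disjoint_regions
  simp only [Set.disjoint_left] at h1 h2 h3 h4 h5 h6
  subst hr
  fin_cases r <;> fin_cases s <;> first
    | rfl
    | exact absurd hs (by decide)
    | exact absurd hs' (h1 hr')
    | exact absurd hs' (h2 hr')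
    | exact absurd hs' (h3 hr')
    | exact absurd hs' (h4 hr')
    | exact absurd hs' (h5 hr')
    | exact absurd hs' (h6 hr')
    | exact absurd hr' (h1 hs')
    | exact absurd hr' (h2 hs')
    | exact absurd hr' (h3 hs')
    | exact absurd hr' (h4 hs')
    | exact absurd hr' (h5 hs')
    | exact absurd hr' (h6 hs')

theorem dot_pos_and_le {r : Fin 5} {p : ℝ × ℝ} (h : p ∈ triangle (branch r).src)
    (h' : p ∈ (branch r).dom) : 0 < dot (branch r).u p ∧ dot (branch r).u p ≤ 1 := by
  obtain ⟨a, b⟩ := p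
  have hs := lt_sqrt_two
  have h2 := sqrt_two_mul_self
  obtain ⟨ha, ha1, hb, hb1⟩ := h
  fin_cases r
  · change (a, b) ∈ ΩAH at h'
    change 0 < 0 * a + 1 * b ∧ 0 * a + 1 * b ≤ 1
    have h3 : 1 < a + b := h'.2
    simp only at ha1 hb1
    constructor <;> linarith
  · change (a, b) ∈ ΩBD at h'
    change 0 < 1 * a + 1 * b ∧ 1 * a + 1 * b ≤ 1
    obtain ⟨-, h3, h4, h5⟩ := h'
    simp only at ha1 hb1 h3 h4
    constructor <;> nlinarith
  · change (a, b) ∈ ΩHF at h'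
    change 0 < (1 + √2) * a + √2 * b ∧ (1 + √2) * a + √2 * b ≤ 1
    change 1 - (2 + √2) * a < b at hb
    obtain ⟨-, h3, h4⟩ := h'
    simp only at ha1 hb1 h3 h4
    constructor <;> nlinarith
  · change (a, b) ∈ ΩAE at h'
    change 0 < (1 + √2) * a + 1 * b ∧ (1 + √2) * a + 1 * b ≤ 1
    change 1 - (2 + √2) * a < b at hb
    obtain ⟨-, h3⟩ := h'
    simp only at ha1 hb1 h3
    constructor <;> linarith
  · change 0 < 0 * a + 1 * b ∧ 0 * a + 1 * b ≤ 1
    change 1 - 1 * a < b at hb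
    simp only at ha1 hb1
    constructor <;> linarith

/-- The vector `u` of a branch has the smallest slope: a vector `(X, Y)` of smaller slope is a
combination of adjacent vectors with coefficients at least `1`, so that its first coordinate
becomes larger than `1`. -/
theorem slope_le {r : Fin 5} {a b : ℝ} (h : (a, b) ∈ triangle (branch r).src)
    (h' : (a, b) ∈ (branch r).dom) {X Y : ℝ} (hv : rotated (branch r).src X Y ∈ sides)
    (hY : 0 < Y) (h1 : a * X + b * Y ≤ 1) :
    (branch r).u.2 * X ≤ (branch r).u.1 * Y := by
  have hs := lt_sqrt_two
  have hs' := sqrt_two_lt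
  have h2 := sqrt_two_mul_self
  obtain ⟨hd0, hd1⟩ := dot_pos_and_le h h'
  obtain ⟨ha, ha1, hb, hb1⟩ := h
  simp only at ha ha1 hb hb1
  by_contra! hlt
  -- vectors below the direction `(1 + √2, 1)`
  have low : ∀ {X Y : ℝ}, ![X, Y] ∈ sides → 0 < Y → (1 + √2) * Y < X →
      1 - (2 + √2) * a < b → 0 < (1 + √2) * a + b → 1 < a * X + b * Y := by
    intro X Y hv hY hlt hb he
    obtain ⟨-, ⟨z, hz⟩, -⟩ := sides_dets hv
    have h3 := one_le_snd hv hY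
    have h4 := one_le_snd hz (by linarith)
    have h5 := mul_le_mul_of_nonneg_left h4 ha.le
    have h6 := mul_le_mul_of_nonneg_left h3 he.le
    linarith
  fin_cases r
  · change (a, b) ∈ ΩAH at h'
    change 0 * Y < 1 * X at hlt
    have h3 : 1 < a + b := h'.2
    have h4 := one_le_fst hv (by linarith)
    have h5 := one_le_snd hv hY
    have hb0 : 0 < b := by linarith
    have h6 := mul_le_mul_of_nonneg_left h4 ha.le
    have h7 := mul_le_mul_of_nonneg_left h5 hb0.le
    linarith
  · change (a, b) ∈ ΩBD at h'
    change 1 * Y < 1 * X at hlt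
    change 1 - (2 + √2) * a < b at hb
    change 0 < 1 * a + 1 * b at hd0
    obtain ⟨-, h3, h4, h5⟩ := h'
    simp only at h3 h4 h5
    obtain ⟨⟨z, hz⟩, ⟨z', hz'⟩, ⟨z'', hz''⟩⟩ := sides_dets hv
    rcases lt_or_ge ((1 + √2) * Y) X with h6 | h6
    · linarith [low hv hY h6 hb (by linarith)]
    -- the coefficients with respect to `(1 + √2, √2)` and `(1 + √2, 1)`
    set α := (1 + √2) * Y - X with hα
    set β := √2 * X - (1 + √2) * Y with hβ
    have hα0 : 0 ≤ α := by linarith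
    have hX : a * X + b * Y = α * ((1 + √2) * a + √2 * b) + β * ((1 + √2) * a + b) := by
      rw [hα, hβ]
      linear_combination (-X * a - b * Y) * h2
    rcases lt_or_ge β 0 with h7 | h7
    · -- the vector lies between `(1, 1)` and `(1 + √2, √2)`
      have h8 := snd_le_neg_one hz (by linarith)
      have hX' : a * X + b * Y = -β * (1 * a + 1 * b) + (X - Y) * ((1 + √2) * a + √2 * b) := by
        rw [hβ]
        ring
      have h9 : 1 < (X - Y) * ((1 + √2) * a + √2 * b) := by nlinarith
      have h10 := mul_pos (neg_pos.2 h7) hd0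
      linarith
    · rcases hα0.eq_or_lt with h8 | h8
      · rcases h7.eq_or_lt with h9 | h9
        · have : (√2 - 1) * X = 0 := by linarith
          have : 0 < (√2 - 1) * X := mul_pos (by linarith) (by linarith)
          linarith
        · have h10 : β = -((1 + √2) * Y - √2 * X) := by rw [hβ]; ring
          have h11 := snd_le_neg_one hz'' (by linarith)
          rw [← h8] at hX
          nlinarith
      · have h10 := snd_le_neg_one hz' (by linarith)
        have h11 : 1 ≤ α := by linarith
        nlinarith
  · change (a, b) ∈ ΩHF at h'
    change (1 + √2) * Y < √2 * X at hlt
    change 1 - (2 + √2) * a < b at hb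
    change 0 < (1 + √2) * a + √2 * b at hd0
    obtain ⟨-, h3, h4⟩ := h'
    simp only at h3 h4
    obtain ⟨-, -, ⟨z'', hz''⟩⟩ := sides_dets hv
    rcases lt_or_ge ((1 + √2) * Y) X with h6 | h6
    · linarith [low hv hY h6 hb (by linarith)]
    have h7 := snd_le_neg_one hz'' (by linarith)
    set α := (1 + √2) * Y - X with hα
    set β := √2 * X - (1 + √2) * Y with hβ
    have hα0 : 0 ≤ α := by linarith
    have hβ1 : 1 ≤ β := by linarith
    have hX : a * X + b * Y = α * ((1 + √2) * a + √2 * b) + β * ((1 + √2) * a + b) := by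
      rw [hα, hβ]
      linear_combination (-X * a - b * Y) * h2
    have h8 := mul_nonneg hα0 hd0.le
    nlinarith
  · change (1 + √2) * Y < 1 * X at hlt
    change 1 - (2 + √2) * a < b at hb
    change 0 < (1 + √2) * a + 1 * b at hd0
    linarith [low hv hY (by linarith) hb (by linarith)]
  · change 0 * Y < 1 * X at hlt
    change 1 - 1 * a < b at hb
    change 0 < 0 * a + 1 * b at hd0
    have h4 := one_le_snd hv (by linarith)
    have h5 := fst_le_neg_one hv (by linarith)
    have hb0 : 0 < b := by linarith
    have h6 := mul_le_mul_of_nonneg_left h4 ha.le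
    have h7 := mul_le_mul_of_nonneg_left h5 hb0.le
    linarith

/-- The first return to the section. -/
theorem exists_return {r : Fin 5} (x : Ω₁ ⊕ Ω₂) (hr : kind x = (branch r).src)
    (hr' : coord x ∈ (branch r).dom) :
    ∃ y, kind y = (branch r).tgt ∧ coord y = (branch r).image (coord x) ∧
      point y = horo ((branch r).time (coord x)) • point x := by
  have hmem := coord_mem x
  have ha : 0 < (coord x).1 := hmem.1
  obtain ⟨h0, h1⟩ := dot_pos_and_le (hr ▸ hmem) hr'
  obtain ⟨y, hy, hy', hy''⟩ := exists_point_eq (branch r).tgt (dot (branch r).w (coord x)) h0 h1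
  refine ⟨y, hy, hy'', ?_⟩
  have hb : base (kind x) = base (branch r).src := by rw [hr]
  rw [hy', point_eq, hb, ← branchMatrix_smul, smul_smul, smul_smul (M _ _ _), smul_smul (horo _),
    smul_smul]
  congr 1
  have hne := ha.ne'
  have hne' := h0.ne'
  have hdet := branch_det r
  rw [← mul_assoc]
  congr 1
  unfold Branch.time
  generalize hd : dot (branch r).u (coord x) = d at *
  unfold dot at *
  apply ext_entries <;> simp only [mul_entries, branchMatrix, mk2_apply, M_apply, horo_apply]
  · linarith
  · ring
  · field_simp
    rw [← hd]
    ring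
  · field_simp
    rw [← hd]
    linear_combination -(coord x).1 * hdet

/-! ### The first return -/

theorem one_le_time {r : Fin 5} {x : Ω₁ ⊕ Ω₂} (hr : kind x = (branch r).src)
    (hr' : coord x ∈ (branch r).dom) : 1 ≤ (branch r).time (coord x) := by
  have hmem := coord_mem x
  obtain ⟨h0, h1⟩ := dot_pos_and_le (hr ▸ hmem) hr'
  have h2 := mul_pos hmem.1 h0
  rw [Branch.time, one_le_div h2]
  exact (mul_le_one₀ hmem.2.1 h0.le h1).trans (one_le_branch r)

theorem isLeast_time {r : Fin 5} {x : Ω₁ ⊕ Ω₂} (hr : kind x = (branch r).src)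
    (hr' : coord x ∈ (branch r).dom) :
    IsLeast {s : ℝ | 0 < s ∧ horo s • point x ∈ sectionSurfaces} ((branch r).time (coord x)) := by
  constructor
  · obtain ⟨y, -, -, hy⟩ := exists_return x hr hr'
    refine ⟨one_pos.trans_le (one_le_time hr hr'), ?_⟩
    rw [← hy, sectionSurfaces_eq]
    exact ⟨y, rfl⟩
  · rintro s ⟨hs, h⟩
    have hmem := coord_mem x
    obtain ⟨h0, h1⟩ := dot_pos_and_le (hr ▸ hmem) hr'
    have ha := hmem.1
    obtain ⟨X, Y, hv, h2, h3, rfl⟩ := (horo_smul_mem_section s x (a := (coord x).1)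
      (b := (coord x).2) rfl).1 h
    have h4 := mul_pos ha h2
    have hY : 0 < Y := by
      by_contra! hY
      exact absurd hs (not_lt.2 (div_nonpos_of_nonpos_of_nonneg hY h4.le))
    have h5 := slope_le (a := (coord x).1) (b := (coord x).2) (hr ▸ hmem) hr' (hr ▸ hv) hY h3
    rw [Branch.time, div_le_div_iff₀ (mul_pos ha h0) h4]
    have h6 := mul_le_mul_of_nonneg_left h5 (mul_pos ha ha).le
    unfold dot
    linarith

/-- The return map and the return time, described by the branches. -/
def IsReturn (R : Ω₁ ⊕ Ω₂ → ℝ) (T : Ω₁ ⊕ Ω₂ → Ω₁ ⊕ Ω₂) : Prop :=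
  ∀ x r, kind x = (branch r).src → coord x ∈ (branch r).dom →
    R x = (branch r).time (coord x) ∧ kind (T x) = (branch r).tgt ∧
      coord (T x) = (branch r).image (coord x) ∧ point (T x) = horo (R x) • point x

theorem exists_isReturn : ∃ R T, IsReturn R T := by
  have h : ∀ x, ∃ z : ℝ × (Ω₁ ⊕ Ω₂), ∀ r, kind x = (branch r).src → coord x ∈ (branch r).dom →
      z.1 = (branch r).time (coord x) ∧ kind z.2 = (branch r).tgt ∧
        coord z.2 = (branch r).image (coord x) ∧ point z.2 = horo z.1 • point x := by
    intro x
    obtain ⟨r, hr, hr'⟩ := exists_branch x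
    obtain ⟨y, h1, h2, h3⟩ := exists_return x hr hr'
    refine ⟨((branch r).time (coord x), y), fun s hs hs' => ?_⟩
    obtain rfl := branch_unique hr hr' hs hs'
    exact ⟨rfl, h1, h2, h3⟩
  choose z hz using h
  exact ⟨fun x => (z x).1, fun x => (z x).2, hz⟩

theorem horo_mul_horo (s t : ℝ) : horo s * horo t = horo (s + t) := by
  apply ext_entries <;> simp [mul_entries]
  ring

theorem horo_neg_smul (s : ℝ) (X : TranslationSurface.Moduli) : horo (-s) • horo s • X = X := by
  have : horo (-s) * horo s = 1 := by
    apply ext_entries <;> simp [mul_entries]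
  rw [smul_smul, this, one_smul]

/-- The reflections of the vectors `u` of the branches also belong to the two orbits. -/
theorem reflected_mem_sides (r : Fin 5) :
    rotated (branch r).src (branch r).u.1 (-(branch r).u.2) ∈ sides := by
  have h1 : ![1, -1] ∈ sides := by
    simpa using lower_mem_sides horizontal_mem_sides (-1)
  have h2 : ![1 + √2, 1] ∈ sides := by
    have h3 : ![-1, 1] ∈ sides := by simpa using neg_mem_sides h1
    have h4 := upper_mem_sides h3 1
    convert h4 using 2
    push_cast
    ring
  fin_cases r
  · change ![0, -1] ∈ sides
    simpa using neg_mem_sides vertical_mem_sides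
  · exact h1
  · change ![1 + √2, -√2] ∈ sides
    convert lower_mem_sides h2 (-1) using 3
    push_cast
    ring
  · change ![1 + √2, -1] ∈ sides
    have h3 : ![-1, -1] ∈ sides := by
      have := neg_mem_sides (lower_mem_sides horizontal_mem_sides 1)
      simpa using this
    have h4 := upper_mem_sides h3 (-1)
    convert h4 using 2
    push_cast
    ring
  · change ![- -1, 0] ∈ sides
    simpa using horizontal_mem_sides

theorem rotated_add_mem_sides {j : Bool} {x y : ℝ} (h : rotated j x y ∈ sides) (k : ℤ) :
    rotated j (x + k * width j * y) y ∈ sides := by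
  cases j
  · exact upper_mem_sides h k
  · change ![-y, x + k * 1 * y] ∈ sides
    convert lower_mem_sides h (-k) using 3
    push_cast
    ring

/-- Every point of the section has returned from the past: reflecting `(a, b)` to `(a, -b)`
reverses the direction of the flow. -/
theorem exists_past (y : Ω₁ ⊕ Ω₂) : ∃ s, 0 < s ∧ horo (-s) • point y ∈ sectionSurfaces := by
  have hmem := coord_mem y
  have ha := hmem.1
  obtain ⟨x, hx, -, hxy⟩ := exists_point_eq (kind y) (-(coord y).2) ha hmem.2.1
  obtain ⟨r, hr, hr'⟩ := exists_branch x
  obtain ⟨h0, h1⟩ := dot_pos_and_le (hr ▸ coord_mem x) hr'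
  have hu := one_le_branch r
  set k := ⌊(1 - -(coord y).2) / (width (kind y) * (coord y).1)⌋
  have hd : dot (branch r).u (coord x) = (coord y).1 * ((branch r).u.1 + (-k : ℤ) *
      width (kind y) * -(branch r).u.2) + (coord y).2 * -(branch r).u.2 := by
    rw [hxy, dot]
    push_cast
    ring
  refine ⟨(branch r).u.2 / ((coord y).1 * dot (branch r).u (coord x)),
    div_pos (by linarith) (mul_pos ha h0), (horo_smul_mem_section _ y
      (a := (coord y).1) (b := (coord y).2) rfl).2
    ⟨_, _, rotated_add_mem_sides (k := -k) (?_ : rotated _ _ (-(branch r).u.2) ∈ sides),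
      hd ▸ h0, hd ▸ h1, ?_⟩⟩
  · rw [← hx, hr]
    exact reflected_mem_sides r
  · rw [← hd, neg_div]

theorem IsReturn.isLeast {R T} (h : IsReturn R T) (x : Ω₁ ⊕ Ω₂) :
    IsLeast {s : ℝ | 0 < s ∧ horo s • point x ∈ sectionSurfaces} (R x) := by
  obtain ⟨r, hr, hr'⟩ := exists_branch x
  rw [(h x r hr hr').1]
  exact isLeast_time hr hr'

theorem IsReturn.one_le {R T} (h : IsReturn R T) (x : Ω₁ ⊕ Ω₂) : 1 ≤ R x := by
  obtain ⟨r, hr, hr'⟩ := exists_branch x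
  rw [(h x r hr hr').1]
  exact one_le_time hr hr'

theorem IsReturn.point_eq {R T} (h : IsReturn R T) (x : Ω₁ ⊕ Ω₂) :
    point (T x) = horo (R x) • point x := by
  obtain ⟨r, hr, hr'⟩ := exists_branch x
  exact (h x r hr hr').2.2.2

/-- Two points with the same image lie on one orbit, and the return time of the earlier one would
not be minimal. -/
theorem IsReturn.injective {R T} (h : IsReturn R T) : Function.Injective T := by
  have key : ∀ x y, T x = T y → R y ≤ R x := by
    intro x y hxy
    by_contra! hlt
    have h1 : horo (R y - R x) • point y = point x := by
      rw [← horo_neg_smul (R x) (point x), ← h.point_eq, hxy, h.point_eq, smul_smul,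
        horo_mul_horo]
      congr 2
      ring
    have h2 : R y - R x ∈ {s : ℝ | 0 < s ∧ horo s • point y ∈ sectionSurfaces} :=
      ⟨sub_pos.2 hlt, by rw [h1, sectionSurfaces_eq]; exact ⟨x, rfl⟩⟩
    have h3 := (h.isLeast y).2 h2
    linarith [h.one_le x]
  intro x y hxy
  have hR : R x = R y := le_antisymm (key y x hxy.symm) (key x y hxy)
  apply point_injective
  rw [← horo_neg_smul (R x) (point x), ← h.point_eq, hxy, h.point_eq, hR, horo_neg_smul]

/-- As successive return times are at least `1`, the past visits to the section are discrete. The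
last one is mapped to the given point. -/
theorem IsReturn.surjective {R T} (h : IsReturn R T) : Function.Surjective T := by
  intro y
  set B := {s : ℝ | 0 < s ∧ horo (-s) • point y ∈ sectionSurfaces} with hB
  have hne : B.Nonempty := exists_past y
  have hbdd : BddBelow B := ⟨0, fun s hs => hs.1.le⟩
  have hback : ∀ s ∈ B, ∃ x, point x = horo (-s) • point y ∧ ∀ t, horo t • point x =
      horo (-(s - t)) • point y := by
    rintro s ⟨-, hs⟩
    rw [sectionSurfaces_eq] at hs
    obtain ⟨x, hx⟩ := hs
    refine ⟨x, hx, fun t => ?_⟩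
    rw [hx, smul_smul, horo_mul_horo]
    congr 2
    ring
  have hsep : ∀ s ∈ B, ∀ s' ∈ B, s' < s → s' ≤ s - 1 := by
    rintro s hs s' hs' hlt
    obtain ⟨x, -, hx⟩ := hback s hs
    have h1 := (h.isLeast x).2 (show s - s' ∈ _ from ⟨sub_pos.2 hlt, by
      rw [hx, sub_sub_cancel]; exact hs'.2⟩)
    linarith [h.one_le x]
  obtain ⟨s, hs, hlt⟩ := exists_lt_of_csInf_lt hne (lt_add_one (sInf B))
  have hmin : ∀ s' ∈ B, s ≤ s' := by
    intro s' hs'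
    by_contra! hlt'
    linarith [hsep s hs s' hs' hlt', csInf_le hbdd hs']
  obtain ⟨x, -, hx⟩ := hback s hs
  have h1 : R x ≤ s := (h.isLeast x).2 ⟨hs.1, by
    rw [hx, sub_self, sectionSurfaces_eq]
    refine ⟨y, ?_⟩
    have : horo (-0) = 1 := by apply ext_entries <;> simp
    rw [this, one_smul]⟩
  have h2 : s ≤ R x := by
    by_contra! hlt'
    have h3 := (h.isLeast x).1
    have h4 := hmin (s - R x) ⟨sub_pos.2 hlt', by rw [← hx]; exact h3.2⟩
    linarith [h3.1]
  refine ⟨x, point_injective ?_⟩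
  rw [h.point_eq, hx, le_antisymm h1 h2, sub_self]
  have : horo (-0) = 1 := by apply ext_entries <;> simp
  rw [this, one_smul]

/-! ### Convex polygons -/

/-- Finite intersections of half planes. -/
def IsPolyhedral (P : Set (ℝ × ℝ)) : Prop :=
  ∃ F : Set (Set (ℝ × ℝ)), F.Finite ∧ (∀ H ∈ F, IsHalfPlane H) ∧ P = ⋂₀ F

theorem IsPolyhedral.inter {P Q : Set (ℝ × ℝ)} (hP : IsPolyhedral P) (hQ : IsPolyhedral Q) :
    IsPolyhedral (P ∩ Q) := by
  obtain ⟨F, hF, hF', rfl⟩ := hP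
  obtain ⟨G, hG, hG', rfl⟩ := hQ
  exact ⟨F ∪ G, hF.union hG, fun H hH => hH.elim (hF' H) (hG' H), (Set.sInter_union F G).symm⟩

theorem IsHalfPlane.isPolyhedral {H : Set (ℝ × ℝ)} (hH : IsHalfPlane H) : IsPolyhedral H :=
  ⟨{H}, Set.finite_singleton H, by rintro _ rfl; exact hH, (Set.sInter_singleton H).symm⟩

theorem isPolyhedral_le {α β γ : ℝ} (h : (α, β) ≠ (0, 0)) :
    IsPolyhedral {p | α * p.1 + β * p.2 ≤ γ} :=
  IsHalfPlane.isPolyhedral ⟨α, β, γ, h, Or.inl rfl⟩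

theorem isPolyhedral_gt {α β γ : ℝ} (h : (α, β) ≠ (0, 0)) :
    IsPolyhedral {p | γ < α * p.1 + β * p.2} := by
  refine IsHalfPlane.isPolyhedral ⟨-α, -β, -γ, ?_, Or.inr ?_⟩
  · intro h'
    rw [Prod.mk.injEq, neg_eq_zero, neg_eq_zero] at h'
    exact h (Prod.ext h'.1 h'.2)
  · ext p
    simp only [Set.mem_ofPred_eq]
    constructor <;> intro h <;> linarith

theorem IsPolyhedral.measurableSet {P : Set (ℝ × ℝ)} (hP : IsPolyhedral P) : MeasurableSet P := by
  obtain ⟨F, hF, hF', rfl⟩ := hP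
  refine MeasurableSet.sInter hF.countable fun H hH => ?_
  obtain ⟨α, β, γ, -, rfl | rfl⟩ := hF' H hH
  · exact measurableSet_le (by fun_prop) measurable_const
  · exact measurableSet_lt (by fun_prop) measurable_const

theorem isPolyhedral_triangle (j : Bool) : IsPolyhedral (triangle j) := by
  have h1 : ((1 : ℝ), (0 : ℝ)) ≠ (0, 0) := by simp
  have h2 : ∀ t : ℝ, (t, (1 : ℝ)) ≠ (0, 0) := by simp
  convert ((isPolyhedral_gt (γ := 0) h1).inter (isPolyhedral_le (γ := 1) h1)).inter
    ((isPolyhedral_gt (γ := 1) (h2 (width j))).inter (isPolyhedral_le (γ := 1) (h2 0))) using 1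
  ext p
  simp only [triangle, Set.mem_inter_iff, Set.mem_ofPred_eq]
  constructor
  · rintro ⟨h1, h2, h3, h4⟩
    refine ⟨⟨?_, ?_⟩, ?_, ?_⟩ <;> linarith
  · rintro ⟨⟨h1, h2⟩, h3, h4⟩
    refine ⟨?_, ?_, ?_, ?_⟩ <;> linarith

theorem isBounded_triangle (j : Bool) : Bornology.IsBounded (triangle j) := by
  refine (Metric.isBounded_Icc ((0, 1 - width j) : ℝ × ℝ) (1, 1)).subset ?_
  rintro p ⟨h1, h2, h3, h4⟩
  have h5 := mul_le_mul_of_nonneg_left h2 (width_pos j).le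
  exact ⟨⟨h1.le, by simp only; linarith⟩, h2, h4⟩

theorem Ω₁_eq : Ω₁ = triangle false := Set.ext mem_Ω₁_iff

theorem Ω₂_eq : Ω₂ = triangle true := Set.ext mem_Ω₂_iff

theorem isPolyhedral_dom (r : Fin 5) : IsPolyhedral (branch r).dom := by
  have h1 : ∀ s t : ℝ, 0 < s → (s, t) ≠ (0, 0) := fun s t hs h =>
    hs.ne' (Prod.ext_iff.1 h).1
  have hs : 0 < 1 + √2 := by positivity
  have hΩ : IsPolyhedral Ω₁ := Ω₁_eq ▸ isPolyhedral_triangle false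
  fin_cases r
  · convert hΩ.inter (isPolyhedral_gt (γ := 1) (h1 1 1 one_pos)) using 1
    ext p
    change (p ∈ Ω₁ ∧ 1 < p.1 + p.2) ↔ (p ∈ Ω₁ ∧ 1 < 1 * p.1 + 1 * p.2)
    rw [one_mul, one_mul]
  · convert hΩ.inter ((isPolyhedral_le (γ := 1) (h1 1 1 one_pos)).inter
      ((isPolyhedral_gt (γ := 1) (h1 (1 + √2) (√2) hs)).inter
        (isPolyhedral_gt (γ := 1) (h1 (1 + √2) 1 hs)))) using 1
    ext p
    change (p ∈ Ω₁ ∧ p.1 + p.2 ≤ 1 ∧ 1 < (1 + √2) * p.1 + √2 * p.2 ∧ 1 < (1 + √2) * p.1 + p.2) ↔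
      (p ∈ Ω₁ ∧ 1 * p.1 + 1 * p.2 ≤ 1 ∧ 1 < (1 + √2) * p.1 + √2 * p.2 ∧
        1 < (1 + √2) * p.1 + 1 * p.2)
    rw [one_mul, one_mul]
  · convert hΩ.inter ((isPolyhedral_le (γ := 1) (h1 (1 + √2) (√2) hs)).inter
        (isPolyhedral_gt (γ := 1) (h1 (1 + √2) 1 hs))) using 1
    ext p
    change (p ∈ Ω₁ ∧ (1 + √2) * p.1 + √2 * p.2 ≤ 1 ∧ 1 < (1 + √2) * p.1 + p.2) ↔
      (p ∈ Ω₁ ∧ (1 + √2) * p.1 + √2 * p.2 ≤ 1 ∧ 1 < (1 + √2) * p.1 + 1 * p.2)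
    rw [one_mul]
  · convert hΩ.inter (isPolyhedral_le (γ := 1) (h1 (1 + √2) 1 hs)) using 1
    ext p
    change (p ∈ Ω₁ ∧ (1 + √2) * p.1 + p.2 ≤ 1) ↔ (p ∈ Ω₁ ∧ (1 + √2) * p.1 + 1 * p.2 ≤ 1)
    rw [one_mul]
  · change IsPolyhedral Ω₂
    exact Ω₂_eq ▸ isPolyhedral_triangle true

/-! ### The pieces of the return map -/

/-- The set on which the return map is given by branch `r` and by `k` translations. -/
def pieceOf (z : Fin 5 × ℤ) : Set (Ω₁ ⊕ Ω₂) :=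
  {x | kind x = (branch z.1).src ∧ coord x ∈ (branch z.1).dom ∧ (branch z.1).shift (coord x) = z.2}

/-- The linear map of a piece of the return map. -/
noncomputable def pieceMap (z : Fin 5 × ℤ) : (ℝ × ℝ) →ₗ[ℝ] (ℝ × ℝ) :=
  Matrix.toLin (Module.Basis.finTwoProd ℝ) (Module.Basis.finTwoProd ℝ)
    !![(branch z.1).u.1, (branch z.1).u.2;
      (branch z.1).w.1 + width (branch z.1).tgt * z.2 * (branch z.1).u.1,
      (branch z.1).w.2 + width (branch z.1).tgt * z.2 * (branch z.1).u.2]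

theorem det_pieceMap (z : Fin 5 × ℤ) : LinearMap.det (pieceMap z) = 1 := by
  rw [pieceMap, LinearMap.det_toLin, Matrix.det_fin_two_of]
  linear_combination branch_det z.1

theorem exists_mem_pieceOf (x : Ω₁ ⊕ Ω₂) : ∃ z, x ∈ pieceOf z := by
  obtain ⟨r, hr, hr'⟩ := exists_branch x
  exact ⟨(r, (branch r).shift (coord x)), hr, hr', rfl⟩

theorem eq_of_mem_pieceOf {x : Ω₁ ⊕ Ω₂} {y z : Fin 5 × ℤ} (hy : x ∈ pieceOf y)
    (hz : x ∈ pieceOf z) : y = z := by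
  obtain ⟨r, k⟩ := y
  obtain ⟨s, l⟩ := z
  obtain rfl : r = s := branch_unique hy.1 hy.2.1 hz.1 hz.2.1
  exact Prod.ext rfl (hy.2.2.symm.trans hz.2.2)

theorem IsReturn.coord_eq {R T} (h : IsReturn R T) {z : Fin 5 × ℤ} {x : Ω₁ ⊕ Ω₂}
    (hx : x ∈ pieceOf z) : kind (T x) = (branch z.1).tgt ∧ coord (T x) = pieceMap z (coord x) := by
  obtain ⟨-, h1, h2, -⟩ := h x z.1 hx.1 hx.2.1
  refine ⟨h1, ?_⟩
  rw [h2, pieceMap, Matrix.toLin_finTwoProd_apply, Branch.image, hx.2.2, dot, dot]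
  congr 1
  ring

theorem isPolyhedral_pieceOf (z : Fin 5 × ℤ) : IsPolyhedral (coord '' pieceOf z) := by
  obtain ⟨r, k⟩ := z
  set B := branch r with hB
  have hdet := branch_det r
  rw [← hB] at hdet
  have hne : ∀ t : ℝ, (B.w.1 + t * B.u.1, B.w.2 + t * B.u.2) ≠ (0, 0) := by
    intro t h
    rw [Prod.mk.injEq] at h
    have : B.u.1 * B.w.2 - B.w.1 * B.u.2 = 0 := by
      linear_combination B.u.1 * h.2 - B.u.2 * h.1
    linarith
  convert ((isPolyhedral_triangle B.src).inter (isPolyhedral_dom r)).inter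
    ((isPolyhedral_le (γ := 1) (hne (width B.tgt * k))).inter
      (isPolyhedral_gt (γ := 1) (hne (width B.tgt * (k + 1))))) using 1
  have key : ∀ p, p ∈ triangle B.src → p ∈ B.dom →
      (B.shift p = k ↔ (B.w.1 + width B.tgt * k * B.u.1) * p.1 +
        (B.w.2 + width B.tgt * k * B.u.2) * p.2 ≤ 1 ∧
        1 < (B.w.1 + width B.tgt * (k + 1) * B.u.1) * p.1 +
        (B.w.2 + width B.tgt * (k + 1) * B.u.2) * p.2) := by
    intro p hp hp'
    have h0 := mul_pos (width_pos B.tgt) (dot_pos_and_le (r := r) hp hp').1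
    rw [Branch.shift, Int.floor_eq_iff, le_div_iff₀ h0, div_lt_iff₀ h0, dot, dot]
    constructor <;> rintro ⟨h1, h2⟩ <;> constructor <;> linarith
  ext p
  constructor
  · rintro ⟨x, ⟨h1, h2, h3⟩, rfl⟩
    have hx := h1 ▸ coord_mem x
    exact ⟨⟨hx, h2⟩, (key _ hx h2).1 h3⟩
  · rintro ⟨⟨h1, h2⟩, h3⟩
    obtain ⟨x, hx, rfl⟩ := exists_kind_coord h1
    exact ⟨x, ⟨hx, h2, (key _ h1 h2).2 h3⟩, rfl⟩

theorem range_inl_eq : Set.range (Sum.inl : Ω₁ → Ω₁ ⊕ Ω₂) = {x | kind x = false} := by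
  ext x
  rcases x with x | x <;> simp [kind]

theorem range_inr_eq : Set.range (Sum.inr : Ω₂ → Ω₁ ⊕ Ω₂) = {x | kind x = true} := by
  ext x
  rcases x with x | x <;> simp [kind]

theorem subset_range {E : Set (Ω₁ ⊕ Ω₂)} {j : Bool} (h : ∀ x ∈ E, kind x = j) :
    E ⊆ Set.range Sum.inl ∨ E ⊆ Set.range Sum.inr := by
  rw [range_inl_eq, range_inr_eq]
  cases j
  · exact Or.inl h
  · exact Or.inr h

theorem IsReturn.isPiecewiseLinear {R T} (h : IsReturn R T) : IsPiecewiseLinear T := by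
  refine ⟨Set.range pieceOf, Set.countable_range _, ?_, ?_, ?_⟩
  · rintro _ ⟨z, rfl⟩
    refine ⟨⟨(isBounded_triangle (branch z.1).src).subset ?_, isPolyhedral_pieceOf z⟩,
      subset_range fun x hx => hx.1⟩
    rintro _ ⟨x, hx, rfl⟩
    exact hx.1 ▸ coord_mem x
  · intro x
    obtain ⟨z, hz⟩ := exists_mem_pieceOf x
    refine ⟨pieceOf z, ⟨⟨z, rfl⟩, hz⟩, ?_⟩
    rintro _ ⟨⟨y, rfl⟩, hy⟩
    rw [eq_of_mem_pieceOf hy hz]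
  · rintro _ ⟨z, rfl⟩
    refine ⟨pieceMap z, fun x hx => (h.coord_eq hx).2, subset_range (j := (branch z.1).tgt) ?_⟩
    rintro _ ⟨x, hx, rfl⟩
    exact (h.coord_eq hx).1

/-! ### Invariance of Lebesgue measure -/

theorem measurableSet_Ω₁ : MeasurableSet Ω₁ := Ω₁_eq ▸ (isPolyhedral_triangle false).measurableSet

theorem measurableSet_Ω₂ : MeasurableSet Ω₂ := Ω₂_eq ▸ (isPolyhedral_triangle true).measurableSet

theorem measurable_coord : Measurable coord :=
  measurable_subtype_coe.sumElim measurable_subtype_coe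

theorem measurableSet_kind (j : Bool) : MeasurableSet {x | kind x = j} := by
  cases j
  · rw [← range_inl_eq]
    exact measurableSet_range_inl
  · rw [← range_inr_eq]
    exact measurableSet_range_inr

theorem coord_image_eq (E : Set (Ω₁ ⊕ Ω₂)) :
    coord '' E = Subtype.val '' (Sum.inl ⁻¹' E) ∪ Subtype.val '' (Sum.inr ⁻¹' E) := by
  ext p
  constructor
  · rintro ⟨x | x, hx, rfl⟩
    · exact Or.inl ⟨x, hx, rfl⟩
    · exact Or.inr ⟨x, hx, rfl⟩
  · rintro (⟨x, hx, rfl⟩ | ⟨x, hx, rfl⟩) <;> exact ⟨_, hx, rfl⟩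

theorem measurableSet_coord_image {E : Set (Ω₁ ⊕ Ω₂)} (hE : MeasurableSet E) :
    MeasurableSet (coord '' E) := by
  rw [coord_image_eq]
  exact (measurableSet_Ω₁.subtype_image (measurable_inl hE)).union
    (measurableSet_Ω₂.subtype_image (measurable_inr hE))

theorem lebesgue_apply {E : Set (Ω₁ ⊕ Ω₂)} (hE : MeasurableSet E) {j : Bool}
    (hj : ∀ x ∈ E, kind x = j) : lebesgue E = volume (coord '' E) := by
  rw [lebesgue, Measure.add_apply, Measure.map_apply measurable_inl hE,
    Measure.map_apply measurable_inr hE,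
    (MeasurableEmbedding.subtype_coe measurableSet_Ω₁).comap_apply,
    (MeasurableEmbedding.subtype_coe measurableSet_Ω₂).comap_apply, coord_image_eq]
  cases j
  · have : (Sum.inr ⁻¹' E : Set Ω₂) = ∅ :=
      Set.eq_empty_of_forall_notMem fun x hx => absurd (hj _ hx).symm Bool.false_ne_true
    simp [this]
  · have : (Sum.inl ⁻¹' E : Set Ω₁) = ∅ :=
      Set.eq_empty_of_forall_notMem fun x hx => absurd (hj _ hx) Bool.false_ne_true
    simp [this]

theorem measurableSet_pieceOf (z : Fin 5 × ℤ) : MeasurableSet (pieceOf z) := by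
  have : pieceOf z = {x | kind x = (branch z.1).src} ∩ coord ⁻¹' (coord '' pieceOf z) := by
    ext x
    constructor
    · exact fun hx => ⟨hx.1, x, hx, rfl⟩
    · rintro ⟨h1, y, hy, h2⟩
      exact ext_kind_coord (hy.1.trans h1.symm) h2 ▸ hy
  rw [this]
  exact (measurableSet_kind _).inter (measurable_coord (isPolyhedral_pieceOf z).measurableSet)

theorem measurable_pieceMap (z : Fin 5 × ℤ) : Measurable (pieceMap z) :=
  (LinearMap.continuous_of_finiteDimensional _).measurable

theorem pieceMap_injective (z : Fin 5 × ℤ) : Function.Injective (pieceMap z) :=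
  ((LinearMap.equivOfDetNeZero (pieceMap z) (by rw [det_pieceMap]; exact one_ne_zero))).injective

/-- The return map preserves Lebesgue measure, as it is a bijection and its pieces have determinant
`1`. -/
theorem IsReturn.measurePreserving {R T} (h : IsReturn R T) :
    MeasurePreserving T lebesgue lebesgue := by
  -- the part of a piece that is mapped to a given set
  have hpiece : ∀ {E : Set (Ω₁ ⊕ Ω₂)}, MeasurableSet E → ∀ z,
      MeasurableSet (pieceOf z ∩ T ⁻¹' E) := by
    intro E hE z
    have : pieceOf z ∩ T ⁻¹' E = pieceOf z ∩
        coord ⁻¹' (pieceMap z ⁻¹' (coord '' (E ∩ {x | kind x = (branch z.1).tgt}))) := by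
      ext x
      refine and_congr_right fun hx => ?_
      obtain ⟨h1, h2⟩ := h.coord_eq hx
      constructor
      · exact fun hx' => ⟨T x, ⟨hx', h1⟩, h2⟩
      · rintro ⟨y, ⟨hy, hy'⟩, hxy⟩
        rw [← h2] at hxy
        exact (ext_kind_coord (hy'.trans h1.symm) hxy ▸ hy : T x ∈ E)
    rw [this]
    exact (measurableSet_pieceOf z).inter (measurable_coord (measurable_pieceMap z
      (measurableSet_coord_image (hE.inter (measurableSet_kind _)))))
  have hunion : ∀ E : Set (Ω₁ ⊕ Ω₂), T ⁻¹' E = ⋃ z, pieceOf z ∩ T ⁻¹' E := by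
    intro E
    rw [← Set.iUnion_inter, Set.iUnion_eq_univ_iff.2 exists_mem_pieceOf, Set.univ_inter]
  have hdisj : ∀ E : Set (Ω₁ ⊕ Ω₂),
      Pairwise (Function.onFun Disjoint fun z => pieceOf z ∩ T ⁻¹' E) := by
    intro E y z hyz
    exact Set.disjoint_left.2 fun x hy hz => hyz (eq_of_mem_pieceOf hy.1 hz.1)
  refine ⟨fun E hE => ?_, Measure.ext fun E hE => ?_⟩
  · rw [hunion]
    exact MeasurableSet.iUnion (hpiece hE)
  · have hT : Measurable T := fun E hE => by
      rw [hunion]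
      exact MeasurableSet.iUnion (hpiece hE)
    rw [Measure.map_apply hT hE]
    have himage : ∀ z, coord '' (T '' (pieceOf z ∩ T ⁻¹' E)) =
        pieceMap z '' (coord '' (pieceOf z ∩ T ⁻¹' E)) := by
      intro z
      rw [Set.image_image, Set.image_image]
      exact Set.image_congr fun x hx => (h.coord_eq hx.1).2
    have hkind : ∀ z, ∀ y ∈ T '' (pieceOf z ∩ T ⁻¹' E), kind y = (branch z.1).tgt := by
      rintro z _ ⟨x, hx, rfl⟩
      exact (h.coord_eq hx.1).1
    have hmeas : ∀ z, MeasurableSet (T '' (pieceOf z ∩ T ⁻¹' E)) := by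
      intro z
      have : T '' (pieceOf z ∩ T ⁻¹' E) = {y | kind y = (branch z.1).tgt} ∩
          coord ⁻¹' (pieceMap z '' (coord '' (pieceOf z ∩ T ⁻¹' E))) := by
        rw [← himage]
        ext y
        constructor
        · exact fun hy => ⟨hkind z y hy, y, hy, rfl⟩
        · rintro ⟨h1, x, hx, h2⟩
          exact ext_kind_coord ((hkind z x hx).trans h1.symm) h2 ▸ hx
      rw [this]
      exact (measurableSet_kind _).inter (measurable_coord
        ((measurableSet_coord_image (hpiece hE z)).image_of_measurable_injOn
          (measurable_pieceMap z) (pieceMap_injective z).injOn))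
    have hE' : E = ⋃ z, T '' (pieceOf z ∩ T ⁻¹' E) := by
      rw [← Set.image_iUnion, ← hunion, Set.image_preimage_eq _ h.surjective]
    have hdisj' : Pairwise (Function.onFun Disjoint fun z => T '' (pieceOf z ∩ T ⁻¹' E)) :=
      fun y z hyz => (Set.disjoint_image_iff h.injective).2 (hdisj E hyz)
    have hsum : lebesgue E = ∑' z, lebesgue (T '' (pieceOf z ∩ T ⁻¹' E)) := by
      conv_lhs => rw [hE']
      exact measure_iUnion hdisj' hmeas
    rw [hsum, hunion E, measure_iUnion (hdisj E) (hpiece hE)]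
    simp only [← hunion]
    refine tsum_congr fun z => ?_
    rw [lebesgue_apply (hpiece hE z) fun x hx => hx.1.1, lebesgue_apply (hmeas z) (hkind z),
      himage, Measure.addHaar_image_linearMap, det_pieceMap]
    simp

/-! ### The return map in coordinates -/

theorem exists_inl_of_kind {x : Ω₁ ⊕ Ω₂} (h : kind x = false) : ∃ q, x = Sum.inl q := by
  rcases x with x | x
  · exact ⟨x, rfl⟩
  · exact absurd h.symm Bool.false_ne_true

theorem exists_inr_of_kind {x : Ω₁ ⊕ Ω₂} (h : kind x = true) : ∃ q, x = Sum.inr q := by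
  rcases x with x | x
  · exact absurd h Bool.false_ne_true
  · exact ⟨x, rfl⟩

end NormalizedL

theorem theorem3p1 :
    -- the canonical bijection maps the two parts of the section to the two families of surfaces
    ((fun x => (Θ x : TranslationSurface.Moduli)) '' sectionH = Set.range point₁ ∧
      (fun x => (Θ x : TranslationSurface.Moduli)) '' sectionV = Set.range point₂) ∧
    -- the two families are bijectively parametrized, also taken together
    (Function.Injective point₁ ∧ Function.Injective point₂ ∧
      Set.BijOn point Set.univ sectionSurfaces) ∧
    -- the return time `R` and the return map `T` of the horocycle flow
    ∃ (R : Ω₁ ⊕ Ω₂ → ℝ) (T : Ω₁ ⊕ Ω₂ → Ω₁ ⊕ Ω₂),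
      (∀ x, IsLeast {s : ℝ | 0 < s ∧ horo s • point x ∈ sectionSurfaces} (R x)) ∧
      (∀ x, point (T x) = horo (R x) • point x) ∧
      -- the return time is piecewise rational with five pieces
      (ΩAH ∪ ΩBD ∪ ΩHF ∪ ΩAE = Ω₁ ∧
        Disjoint ΩAH ΩBD ∧ Disjoint ΩAH ΩHF ∧ Disjoint ΩAH ΩAE ∧
        Disjoint ΩBD ΩHF ∧ Disjoint ΩBD ΩAE ∧ Disjoint ΩHF ΩAE) ∧
      (∀ (a b : ℝ) (hp : (a, b) ∈ Ω₁), (a, b) ∈ ΩAH → R (Sum.inl ⟨(a, b), hp⟩) = 1 / (a * b)) ∧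
      (∀ (a b : ℝ) (hp : (a, b) ∈ Ω₁), (a, b) ∈ ΩBD →
        R (Sum.inl ⟨(a, b), hp⟩) = 1 / (a * (a + b))) ∧
      (∀ (a b : ℝ) (hp : (a, b) ∈ Ω₁), (a, b) ∈ ΩHF →
        R (Sum.inl ⟨(a, b), hp⟩) = √2 / (a * ((1 + √2) * a + √2 * b))) ∧
      (∀ (a b : ℝ) (hp : (a, b) ∈ Ω₁), (a, b) ∈ ΩAE →
        R (Sum.inl ⟨(a, b), hp⟩) = 1 / (a * ((1 + √2) * a + b))) ∧
      (∀ (a b : ℝ) (hp : (a, b) ∈ Ω₂), R (Sum.inr ⟨(a, b), hp⟩) = 1 / (a * b)) ∧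
      -- it is bounded below by 1
      (∀ x, 1 ≤ R x) ∧
      -- the return map is a measure preserving bijection, linear on each of countably many pieces
      Function.Bijective T ∧
      MeasurePreserving T lebesgue lebesgue ∧
      IsPiecewiseLinear T ∧
      -- explicit formulas for the return map
      (∀ (a b : ℝ) (hp : (a, b) ∈ Ω₁), (a, b) ∈ ΩAH →
        ∃ q : Ω₂, T (Sum.inl ⟨(a, b), hp⟩) = Sum.inr q ∧
          (q : ℝ × ℝ) = (b, -a + b * (⌊(1 + a) / b⌋ : ℝ))) ∧
      (∀ (a b : ℝ) (hp : (a, b) ∈ Ω₁), (a, b) ∈ ΩBD →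
        ∃ q : Ω₁, T (Sum.inl ⟨(a, b), hp⟩) = Sum.inl q ∧
          (q : ℝ × ℝ) = (a + b,
            b + (2 + √2) * (a + b) * (⌊(1 - b) / ((2 + √2) * (a + b))⌋ : ℝ))) ∧
      (∀ (a b : ℝ) (hp : (a, b) ∈ Ω₁), (a, b) ∈ ΩHF →
        ∃ q : Ω₁, T (Sum.inl ⟨(a, b), hp⟩) = Sum.inl q ∧
          (q : ℝ × ℝ) = ((1 + √2) * a + √2 * b,
            (2 + √2) * a + (1 + √2) * b + ((1 + √2) * a + √2 * b) * (2 + √2) *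
              (⌊(1 - ((2 + √2) * a + (1 + √2) * b)) /
                ((2 + √2) * ((1 + √2) * a + √2 * b))⌋ : ℝ))) ∧
      (∀ (a b : ℝ) (hp : (a, b) ∈ Ω₁), (a, b) ∈ ΩAE →
        ∃ q : Ω₁, T (Sum.inl ⟨(a, b), hp⟩) = Sum.inl q ∧
          (q : ℝ × ℝ) = ((1 + √2) * a + b,
            2 * (1 + √2) * a + (1 + √2) * b + ((1 + √2) * a + b) * (2 + √2) *
              (⌊(1 - (2 * (1 + √2) * a + (1 + √2) * b)) /
                ((2 + √2) * ((1 + √2) * a + b))⌋ : ℝ))) ∧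
      (∀ (a b : ℝ) (hp : (a, b) ∈ Ω₂),
        ∃ q : Ω₁, T (Sum.inr ⟨(a, b), hp⟩) = Sum.inl q ∧
          (q : ℝ × ℝ) = (b, -a + (2 + √2) * b * (⌊(1 + a) / ((2 + √2) * b)⌋ : ℝ))) := by
  obtain ⟨R, T, h⟩ := exists_isReturn
  have hw : width false = 2 + √2 := rfl
  have hw' : width true = 1 := rfl
  have hsections := And.intro (image_section false) (image_section true)
  refine ⟨⟨?_, ?_⟩, ⟨?_, ?_, ?_⟩, R, T, h.isLeast, h.point_eq, ⟨?_, disjoint_regions⟩,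
    ?_, ?_, ?_, ?_, ?_, h.one_le, ⟨h.injective, h.surjective⟩, h.measurePreserving,
    h.isPiecewiseLinear, ?_, ?_, ?_, ?_, ?_⟩
  · refine hsections.1.trans (Set.ext fun X => ⟨?_, ?_⟩)
    · rintro ⟨x | x, hx, rfl⟩
      · exact ⟨x, rfl⟩
      · exact absurd hx.symm Bool.false_ne_true
    · rintro ⟨x, rfl⟩
      exact ⟨Sum.inl x, rfl, rfl⟩
  · refine hsections.2.trans (Set.ext fun X => ⟨?_, ?_⟩)
    · rintro ⟨x | x, hx, rfl⟩
      · exact absurd hx Bool.false_ne_true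
      · exact ⟨x, rfl⟩
    · rintro ⟨x, rfl⟩
      exact ⟨Sum.inr x, rfl, rfl⟩
  · exact fun x y hxy => Sum.inl_injective (point_injective (a₁ := Sum.inl x) (a₂ := Sum.inl y) hxy)
  · exact fun x y hxy => Sum.inr_injective (point_injective (a₁ := Sum.inr x) (a₂ := Sum.inr y) hxy)
  · rw [sectionSurfaces_eq, ← Set.image_univ]
    exact point_injective.injOn.bijOn_image
  · ext p
    constructor
    · rintro (((hp | hp) | hp) | hp) <;> exact hp.1
    · intro hp
      obtain ⟨r, hr, hr'⟩ := exists_branch (Sum.inl ⟨p, hp⟩)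
      fin_cases r
      · exact Or.inl (Or.inl (Or.inl hr'))
      · exact Or.inl (Or.inl (Or.inr hr'))
      · exact Or.inl (Or.inr hr')
      · exact Or.inr hr'
      · exact absurd hr Bool.false_ne_true
  · intro a b hp hr
    rw [(h (Sum.inl ⟨(a, b), hp⟩) 0 rfl hr).1]
    simp [Branch.time, branch, dot, coord]
  · intro a b hp hr
    rw [(h (Sum.inl ⟨(a, b), hp⟩) 1 rfl hr).1]
    simp [Branch.time, branch, dot, coord]
  · intro a b hp hr
    rw [(h (Sum.inl ⟨(a, b), hp⟩) 2 rfl hr).1]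
    simp [Branch.time, branch, dot, coord]
  · intro a b hp hr
    rw [(h (Sum.inl ⟨(a, b), hp⟩) 3 rfl hr).1]
    simp [Branch.time, branch, dot, coord]
  · intro a b hp
    rw [(h (Sum.inr ⟨(a, b), hp⟩) 4 rfl hp).1]
    simp [Branch.time, branch, dot, coord]
  · intro a b hp hr
    obtain ⟨-, h1, h2, -⟩ := h (Sum.inl ⟨(a, b), hp⟩) 0 rfl hr
    obtain ⟨q, hq⟩ := exists_inr_of_kind h1
    refine ⟨q, hq, ?_⟩
    rw [hq] at h2
    refine h2.trans ?_
    simp [Branch.image, Branch.shift, branch, dot, coord, hw']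
  · intro a b hp hr
    obtain ⟨-, h1, h2, -⟩ := h (Sum.inl ⟨(a, b), hp⟩) 1 rfl hr
    obtain ⟨q, hq⟩ := exists_inl_of_kind h1
    refine ⟨q, hq, ?_⟩
    rw [hq] at h2
    refine h2.trans ?_
    simp [Branch.image, Branch.shift, branch, dot, coord, hw]
  · intro a b hp hr
    obtain ⟨-, h1, h2, -⟩ := h (Sum.inl ⟨(a, b), hp⟩) 2 rfl hr
    obtain ⟨q, hq⟩ := exists_inl_of_kind h1
    refine ⟨q, hq, ?_⟩
    rw [hq] at h2
    refine h2.trans ?_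
    rw [mul_comm ((1 + √2) * a + √2 * b) (2 + √2)]
    simp [Branch.image, Branch.shift, branch, dot, coord, hw]
  · intro a b hp hr
    obtain ⟨-, h1, h2, -⟩ := h (Sum.inl ⟨(a, b), hp⟩) 3 rfl hr
    obtain ⟨q, hq⟩ := exists_inl_of_kind h1
    refine ⟨q, hq, ?_⟩
    rw [hq] at h2
    refine h2.trans ?_
    rw [mul_comm ((1 + √2) * a + b) (2 + √2)]
    simp [Branch.image, Branch.shift, branch, dot, coord, hw]
  · intro a b hp
    obtain ⟨-, h1, h2, -⟩ := h (Sum.inr ⟨(a, b), hp⟩) 4 rfl hp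
    obtain ⟨q, hq⟩ := exists_inl_of_kind h1
    refine ⟨q, hq, ?_⟩
    rw [hq] at h2
    refine h2.trans ?_
    simp [Branch.image, Branch.shift, branch, dot, coord, hw]
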